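/- Let $\mathfrak g$ be a finite-dimensional simple complex Lie algebra and let $\mathfrak k\subset\mathfrak g$ be a principal $\mathfrak{sl}(2)$-subalgebra, i.e. the span of an $\mathfrak{sl}(2)$-triple $\{e,h,f\}$ ($[h,e]=2e$, $[h,f]=-2f$, $[e,f]=h\neq 0$) such that $\mathfrak k$ contains a regular nilpotent element of $\mathfrak g$ (an $\mathrm{ad}$-nilpotent element whose centralizer has dimension $\operatorname{rk}\mathfrak g$). Put $\mathfrak t=\langle h\rangle_{\mathbb C}$ and let $\mathfrak h$ be the centralizer of $\mathfrak t$ in $\mathfrak g$. Let $\bar{\mathfrak b}$ (respectively $\mathfrak b$) be the sum of the eigenspaces of $\mathrm{ad}_h$ with nonnegative (respectively nonpositive) eigenvalues, and put $\bar{\mathfrak n}=[\bar{\mathfrak b},\bar{\mathfrak b}]$. Let $\mathfrak k^\perp$ be the orthogonal complement of $\mathfrak k$ with respect to the Killing form of $\mathfrak g$. Let $\rho_{\mathfrak k}=\alpha/2\in\mathfrak t^*$, where $\alpha$ is the root of $\mathfrak k$ with root space $\langle e\rangle_{\mathbb C}$, so that $\rho_{\mathfrak k}(h)=1$. For $\nu\in\mathfrak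 t^*$ let $P(\nu)$ be the multiplicity of the weight $\nu$ in the symmetric algebra of the $\mathfrak t$-module $\bar{\mathfrak n}\cap\mathfrak k^\perp$. For $\mu\in\mathfrak t^*$ with $\mu(h)\in\mathbb Z_{\ge 0}$ let $W(\mu)$ be the irreducible finite-dimensional $\mathfrak k$-module with highest weight $\mu$. Let $C(\mathfrak g,\mathfrak t)$ be the category of $\mathfrak g$-modules on which every element of $\mathfrak t$ acts locally finitely and which are semisimple as $\mathfrak t$-modules. Let $\Gamma_{\mathfrak k,\mathfrak t}$ be the left exact functor on $C(\mathfrak g,\mathfrak t)$ that takes $V$ to its $\mathfrak g$-submodule $\{v\in V: \dim U(\mathfrak k)v<\infty\}$, and let $R^i\Gamma_{\mathfrak k,\mathfrak t}$ be its right derived functors. For $\lambda\in\mathfrak h^*$ let $M(\lambda)=U(\mathfrak g)\otimes_{U(\mathfrak b)}\mathbb C_\lambda$ be the Verma module, where $[\mathfrak b,\mathfrak b]$ acts by zero on $\mathbb C_\lambda$, and let $A^1(\lambda)=R^1\Gamma_{\mathfrak k,\mathfrak t}(M(\lambda))$. (1) If $\lambda\in\mathfrak h^*$ is not $\mathfrak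 g$-integral (that is, $\lambda$ takes a non-integral value on some coroot of $\mathfrak g$ with respect to $\mathfrak h$), then for every $\mu\in\mathfrak t^*$ with $\mu(h)\in\mathbb Z_{\ge 0}$ the space $\operatorname{Hom}_{\mathfrak k}(W(\mu),A^1(\lambda))$ is finite-dimensional and $$\dim \operatorname{Hom}_{\mathfrak k}(W(\mu),A^1(\lambda)) = P(\mu-\lambda|_{\mathfrak t}+2\rho_{\mathfrak k})-P(-\mu-\lambda|_{\mathfrak t}).$$ (2) If $\lambda\in\mathfrak h^*$ and $\lambda(h)-2=n\in\mathbb Z_{\ge 0}$, then $\dim \operatorname{Hom}_{\mathfrak k}(W(n\rho_{\mathfrak k}),A^1(\lambda))=1$, and $m\ge n$ for every $m\in\mathbb Z_{\ge 0}$ such that $\operatorname{Hom}_{\mathfrak k}(W(m\rho_{\mathfrak k}),A^1(\lambda))\neq 0$. -/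

import Mathlib

universe u v

namespace PrincipalSl2

noncomputable section

open CategoryTheory CategoryTheory.Limits
open scoped ModuleCat

attribute [local instance 100] LieRing.ofAssociativeRing

variable {g : Type u} [LieRing g] [LieAlgebra ℂ g]

/-- The homomorphism `U(l) → U(g)` induced by the inclusion of a subalgebra. -/
def envMap (l : LieSubalgebra ℂ g) :
    UniversalEnvelopingAlgebra ℂ l →ₐ[ℂ] UniversalEnvelopingAlgebra ℂ g :=
  UniversalEnvelopingAlgebra.lift ℂ ((UniversalEnvelopingAlgebra.ι ℂ).comp l.incl)

/-- The smallest subspace containing `v` and stable under `x`. -/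
def cyclicSpan (V : ModuleCat.{u} (UniversalEnvelopingAlgebra ℂ g)) (x : g) (v : V) :
    Submodule ℂ V :=
  Submodule.span ℂ (Set.range fun n : ℕ => (UniversalEnvelopingAlgebra.ι ℂ x) ^ n • v)

/-- `x` acts locally finitely on the `g`-module `V`. -/
def ActsLocallyFinitely (V : ModuleCat.{u} (UniversalEnvelopingAlgebra ℂ g)) (x : g) : Prop :=
  ∀ v : V, FiniteDimensional ℂ (cyclicSpan V x v)

/-- The `g`-modules on which every element of `l` acts locally finitely and which are semisimple
as `l`-modules. -/
def relProp (l : LieSubalgebra ℂ g) :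
    ObjectProperty (ModuleCat.{u} (UniversalEnvelopingAlgebra ℂ g)) := fun V =>
  (∀ x ∈ l, ActsLocallyFinitely V x) ∧
    IsSemisimpleModule (UniversalEnvelopingAlgebra ℂ l)
      ((ModuleCat.restrictScalars (envMap l).toRingHom).obj V)

/-- The category `C(g, l)`, a full subcategory of the category of `g`-modules. -/
abbrev RelCat (l : LieSubalgebra ℂ g) := (relProp l).FullSubcategory

/-- A morphism of `g`-modules as a `ℂ`-linear map. -/
def toComplexLinear {V W : ModuleCat.{u} (UniversalEnvelopingAlgebra ℂ g)} (φ : V ⟶ W) :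
    V →ₗ[ℂ] W :=
  φ.hom.restrictScalars ℂ

theorem cyclicSpan_map {V W : ModuleCat.{u} (UniversalEnvelopingAlgebra ℂ g)} (φ : V ⟶ W)
    (x : g) (v : V) : (cyclicSpan V x v).map (toComplexLinear φ) = cyclicSpan W x (φ.hom v) := by
  rw [cyclicSpan, cyclicSpan, Submodule.map_span, ← Set.range_comp]
  congr 2
  funext n
  exact φ.hom.map_smul _ _

theorem cyclicSpan_add_le (V : ModuleCat.{u} (UniversalEnvelopingAlgebra ℂ g)) (x : g) (v w : V) :
    cyclicSpan V x (v + w) ≤ cyclicSpan V x v ⊔ cyclicSpan V x w := by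
  refine Submodule.span_le.2 ?_
  rintro _ ⟨n, rfl⟩
  simp only [smul_add]
  exact Submodule.add_mem_sup (Submodule.subset_span ⟨n, rfl⟩) (Submodule.subset_span ⟨n, rfl⟩)

theorem relProp_of_injective (l : LieSubalgebra ℂ g)
    {V W : ModuleCat.{u} (UniversalEnvelopingAlgebra ℂ g)} (φ : V ⟶ W)
    (hφ : Function.Injective φ.hom) (hW : relProp l W) : relProp l V := by
  refine ⟨fun x hx v => ?_, ?_⟩
  · have := hW.1 x hx (φ.hom v)
    rw [← cyclicSpan_map] at this
    exact LinearEquiv.finiteDimensional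
      (Submodule.equivMapOfInjective (toComplexLinear φ) hφ (cyclicSpan V x v)).symm
  · have := hW.2
    exact IsSemisimpleModule.of_injective
      ((ModuleCat.restrictScalars (envMap l).toRingHom).map φ).hom hφ

/-- A `g`-module generated by images of modules in `C(g, l)` is in `C(g, l)`. -/
theorem relProp_of_iSup (l : LieSubalgebra ℂ g)
    {V : ModuleCat.{u} (UniversalEnvelopingAlgebra ℂ g)} {J : Type*}
    (W : J → ModuleCat.{u} (UniversalEnvelopingAlgebra ℂ g)) (φ : ∀ j, W j ⟶ V)
    (hW : ∀ j, relProp l (W j)) (hφ : ⨆ j, LinearMap.range (φ j).hom = ⊤) : relProp l V := by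
  refine ⟨fun x hx v => ?_, ?_⟩
  · have hv : v ∈ ⨆ j, LinearMap.range (φ j).hom := hφ ▸ Submodule.mem_top
    refine Submodule.iSup_induction _ (motive := fun v => FiniteDimensional ℂ (cyclicSpan V x v))
      hv ?_ ?_ ?_
    · rintro j _ ⟨w, rfl⟩
      rw [← cyclicSpan_map]
      have := (hW j).1 x hx w
      infer_instance
    · have : cyclicSpan V x 0 = ⊥ := by
        rw [cyclicSpan, Submodule.span_eq_bot]
        rintro _ ⟨n, rfl⟩
        exact smul_zero _
      rw [this]
      infer_instance
    · intro v w hv hw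
      exact Submodule.finiteDimensional_of_le (cyclicSpan_add_le V x v w)
  · let F (j : J) := ((ModuleCat.restrictScalars (envMap l).toRingHom).map (φ j)).hom
    refine isSemisimpleModule_of_isSemisimpleModule_submodule' (p := fun j => LinearMap.range (F j))
      (fun j => ?_) ?_
    · have := (hW j).2
      exact IsSemisimpleModule.range _
    · refine eq_top_iff.2 fun v _ => ?_
      have hv : (show V from v) ∈ ⨆ j, LinearMap.range (φ j).hom := hφ ▸ Submodule.mem_top
      refine Submodule.iSup_induction _
        (motive := fun w : V => (show (ModuleCat.restrictScalars (envMap l).toRingHom).obj V from w)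
          ∈ ⨆ j, LinearMap.range (F j)) hv ?_ ?_ ?_
      · rintro j _ ⟨w, rfl⟩
        exact Submodule.mem_iSup_of_mem j ⟨w, rfl⟩
      · exact Submodule.zero_mem _
      · intro v w hv hw
        exact Submodule.add_mem _ hv hw

instance (l : LieSubalgebra ℂ g) : (relProp l).IsClosedUnderSubobjects where
  prop_of_mono φ _ h := relProp_of_injective l φ ((ModuleCat.mono_iff_injective φ).1 ‹_›) h

instance (l : LieSubalgebra ℂ g) : (relProp l).IsClosedUnderQuotients where
  prop_of_epi φ _ h := relProp_of_iSup l (fun _ : Unit => _) (fun _ => φ) (fun _ => h)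
    (by simpa [iSup_const] using (ModuleCat.epi_iff_range_eq_top φ).1 ‹_›)

instance (l : LieSubalgebra ℂ g) : (relProp l).ContainsZero where
  exists_zero := ⟨ModuleCat.of _ PUnit, ModuleCat.isZero_of_subsingleton _,
    relProp_of_iSup l (fun j : Empty => j.elim) (fun j => j.elim) (fun j => j.elim)
      (Subsingleton.elim _ _)⟩

instance (l : LieSubalgebra ℂ g) : (relProp l).IsClosedUnderFiniteProducts where
  isClosedUnderLimitsOfShape J _ := ⟨by
    classical
    rintro X ⟨p⟩
    let W (j : J) := p.diag.obj ⟨j⟩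
    have e : X ≅ ModuleCat.of _ (∀ j, W j) :=
      p.isLimit.conePointsIsoOfNatIso (ModuleCat.HasLimit.productLimitCone W).isLimit
        Discrete.natIsoFunctor
    refine (relProp l).prop_of_iso e.symm
      (relProp_of_iSup l W (fun j => ModuleCat.ofHom (LinearMap.single _ (fun j => W j) j))
        (fun j => p.prop_diag_obj _) ?_)
    cases nonempty_fintype J
    exact LinearMap.iSup_range_single _ _⟩

/-- The largest submodule of a `g`-module that is in `C(g, l)`. -/
def relPart (l : LieSubalgebra ℂ g) (V : ModuleCat.{u} (UniversalEnvelopingAlgebra ℂ g)) :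
    Submodule (UniversalEnvelopingAlgebra ℂ g) V :=
  ⨆ N : {N : Submodule (UniversalEnvelopingAlgebra ℂ g) V // relProp l (ModuleCat.of _ N)}, N.1

theorem relProp_relPart (l : LieSubalgebra ℂ g)
    (V : ModuleCat.{u} (UniversalEnvelopingAlgebra ℂ g)) :
    relProp l (ModuleCat.of _ (relPart l V)) := by
  refine relProp_of_iSup l
    (J := {N : Submodule (UniversalEnvelopingAlgebra ℂ g) V // relProp l (ModuleCat.of _ N)})
    (fun N => ModuleCat.of _ N.1)
    (fun N => ModuleCat.ofHom (Submodule.inclusion (le_iSup (fun N : {N : Submodule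
      (UniversalEnvelopingAlgebra ℂ g) V // relProp l (ModuleCat.of _ N)} => N.1) N)))
    (fun N => N.2) ?_
  apply Submodule.map_injective_of_injective (relPart l V).injective_subtype
  rw [Submodule.map_iSup, Submodule.map_top, Submodule.range_subtype]
  refine iSup_congr fun N => ?_
  ext v
  simp only [Submodule.mem_map, LinearMap.mem_range]
  constructor
  · rintro ⟨_, ⟨w, rfl⟩, rfl⟩
    exact w.2
  · intro hv
    exact ⟨_, ⟨⟨v, hv⟩, rfl⟩, rfl⟩

theorem range_le_relPart (l : LieSubalgebra ℂ g)
    {W V : ModuleCat.{u} (UniversalEnvelopingAlgebra ℂ g)} (hW : relProp l W) (φ : W ⟶ V) :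
    LinearMap.range φ.hom ≤ relPart l V := by
  refine le_iSup (fun N : {N : Submodule (UniversalEnvelopingAlgebra ℂ g) V //
    relProp l (ModuleCat.of _ N)} => N.1) ⟨LinearMap.range φ.hom, ?_⟩
  refine relProp_of_iSup l (fun _ : Unit => W)
    (fun _ => ModuleCat.ofHom φ.hom.rangeRestrict) (fun _ => hW) ?_
  simp

/-- Morphisms from an object of `C(g, l)` factor through the largest submodule in `C(g, l)`. -/
def relPartEquiv (l : LieSubalgebra ℂ g) (W : RelCat l)
    (V : ModuleCat.{u} (UniversalEnvelopingAlgebra ℂ g)) :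
    ((relProp l).ι.obj W ⟶ V) ≃
      (W ⟶ (⟨ModuleCat.of _ (relPart l V), relProp_relPart l V⟩ : RelCat l)) where
  toFun φ := ObjectProperty.homMk (ModuleCat.ofHom
    (φ.hom.codRestrict _ fun w => range_le_relPart l W.property φ ⟨w, rfl⟩))
  invFun ψ := ψ.hom ≫ ModuleCat.ofHom (relPart l V).subtype
  left_inv _ := rfl
  right_inv _ := rfl

instance (l : LieSubalgebra ℂ g) : EnoughInjectives (RelCat l) := by
  have := (relProp l).preservesMonomorphisms_ι_of_isNormalEpiCategory
  exact EnoughInjectives.of_adjunction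
    (Adjunction.adjunctionOfEquivRight (relPartEquiv l) fun _ _ _ _ _ => rfl)

/-- The space `U(k) v`. -/
def envSpan (k : LieSubalgebra ℂ g) (V : ModuleCat.{u} (UniversalEnvelopingAlgebra ℂ g)) (v : V) :
    Submodule ℂ V :=
  LinearMap.range ((LinearMap.toSpanSingleton (UniversalEnvelopingAlgebra ℂ g) V v).restrictScalars
    ℂ ∘ₗ (envMap k).toLinearMap)

theorem envSpan_map (k : LieSubalgebra ℂ g)
    {V W : ModuleCat.{u} (UniversalEnvelopingAlgebra ℂ g)} (φ : V ⟶ W) (v : V) :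
    (envSpan k V v).map (toComplexLinear φ) = envSpan k W (φ.hom v) := by
  rw [envSpan, envSpan, ← LinearMap.range_comp]
  congr 1
  ext a
  exact φ.hom.map_smul _ _

theorem mem_envSpan_self (k : LieSubalgebra ℂ g)
    (V : ModuleCat.{u} (UniversalEnvelopingAlgebra ℂ g)) (v : V) : v ∈ envSpan k V v :=
  ⟨1, by simp⟩

theorem ι_smul_mem_envSpan (k : LieSubalgebra ℂ g)
    (V : ModuleCat.{u} (UniversalEnvelopingAlgebra ℂ g)) (v : V) {x : g} (hx : x ∈ k) {w : V}
    (hw : w ∈ envSpan k V v) : UniversalEnvelopingAlgebra.ι ℂ x • w ∈ envSpan k V v := by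
  obtain ⟨a, rfl⟩ := hw
  refine ⟨UniversalEnvelopingAlgebra.ι ℂ (⟨x, hx⟩ : k) * a, ?_⟩
  have : envMap k (UniversalEnvelopingAlgebra.ι ℂ (⟨x, hx⟩ : k)) =
    UniversalEnvelopingAlgebra.ι ℂ x := UniversalEnvelopingAlgebra.lift_ι_apply ..
  simp only [LinearMap.comp_apply, AlgHom.toLinearMap_apply, map_mul, this]
  exact mul_smul _ _ _

/-- An associative algebra statement: `U(g)` is generated by `g`. -/
theorem env_induction {g' : Type*} [LieRing g'] [LieAlgebra ℂ g']
    {p : UniversalEnvelopingAlgebra ℂ g' → Prop} (h1 : ∀ c : ℂ, p (algebraMap ℂ _ c))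
    (h2 : ∀ x, p (UniversalEnvelopingAlgebra.ι ℂ x)) (h3 : ∀ a b, p a → p b → p (a * b))
    (h4 : ∀ a b, p a → p b → p (a + b)) (a : UniversalEnvelopingAlgebra ℂ g') : p a := by
  obtain ⟨a, rfl⟩ : ∃ b, UniversalEnvelopingAlgebra.mkAlgHom ℂ g' b = a :=
    Quotient.mk_surjective a
  induction a using TensorAlgebra.induction with
  | algebraMap r => rw [AlgHom.commutes]; exact h1 r
  | ι x => exact h2 x
  | mul x y hx hy => rw [map_mul]; exact h3 _ _ hx hy
  | add x y hx hy => rw [map_add]; exact h4 _ _ hx hy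

theorem envSpan_le (k : LieSubalgebra ℂ g)
    (V : ModuleCat.{u} (UniversalEnvelopingAlgebra ℂ g)) (v : V) (N : Submodule ℂ V) (hv : v ∈ N)
    (hN : ∀ x ∈ k, ∀ w ∈ N, UniversalEnvelopingAlgebra.ι ℂ x • w ∈ N) : envSpan k V v ≤ N := by
  suffices h : ∀ a : UniversalEnvelopingAlgebra ℂ k, ∀ w ∈ N, envMap k a • w ∈ N by
    rintro _ ⟨a, rfl⟩
    exact h a v hv
  intro a
  induction a using env_induction with
  | h1 c =>
    intro w hw
    rw [AlgHom.commutes, algebraMap_smul]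
    exact N.smul_mem c hw
  | h2 x =>
    intro w hw
    have : envMap k (UniversalEnvelopingAlgebra.ι ℂ x) =
      UniversalEnvelopingAlgebra.ι ℂ (x : g) := UniversalEnvelopingAlgebra.lift_ι_apply ..
    rw [this]
    exact hN _ x.2 w hw
  | h3 a b ha hb =>
    intro w hw
    rw [map_mul, mul_smul]
    exact ha _ (hb w hw)
  | h4 a b ha hb =>
    intro w hw
    rw [map_add, add_smul]
    exact N.add_mem (ha w hw) (hb w hw)

theorem finiteDimensional_envSpan_ι_smul [FiniteDimensional ℂ g] (k : LieSubalgebra ℂ g)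
    (V : ModuleCat.{u} (UniversalEnvelopingAlgebra ℂ g)) (v : V)
    (hv : FiniteDimensional ℂ (envSpan k V v)) (x : g) :
    FiniteDimensional ℂ (envSpan k V (UniversalEnvelopingAlgebra.ι ℂ x • v)) := by
  let act : g →ₗ[ℂ] V →ₗ[ℂ] V :=
    LinearMap.mk₂ ℂ (fun x w => UniversalEnvelopingAlgebra.ι ℂ x • w)
      (fun x y w => by rw [map_add, add_smul]) (fun c x w => by rw [map_smul, smul_assoc])
      (fun x v w => smul_add _ _ _) (fun c x w => by rw [smul_comm])
  let N : Submodule ℂ V := Submodule.map₂ act ⊤ (envSpan k V v)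
  have hN : FiniteDimensional ℂ N := by
    refine Module.Finite.iff_fg.2 (Submodule.FG.map₂ _ ?_ ?_)
    · exact Module.Finite.fg_top
    · exact Module.Finite.iff_fg.1 hv
  refine Submodule.finiteDimensional_of_le (S₂ := N) (envSpan_le k V _ N ?_ ?_)
  · exact Submodule.apply_mem_map₂ act (Submodule.mem_top (x := x)) (mem_envSpan_self k V v)
  · intro y hy w hw
    suffices h : N ≤ N.comap (act y) from h hw
    refine Submodule.map₂_le.2 fun z _ w hw => ?_
    have h : act y (act z w) =
        act ⁅y, z⁆ w + act z (UniversalEnvelopingAlgebra.ι ℂ y • w) := by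
      simp only [act, LinearMap.mk₂_apply, LieHom.map_lie,
        LieRing.of_associative_ring_bracket, sub_smul, mul_smul]
      abel
    rw [Submodule.mem_comap, h]
    exact N.add_mem (Submodule.apply_mem_map₂ act Submodule.mem_top hw)
      (Submodule.apply_mem_map₂ act Submodule.mem_top (ι_smul_mem_envSpan k V v hy hw))

/-- The submodule of `k`-finite vectors of a `g`-module. -/
def finitePart [FiniteDimensional ℂ g] (k : LieSubalgebra ℂ g)
    (V : ModuleCat.{u} (UniversalEnvelopingAlgebra ℂ g)) :
    Submodule (UniversalEnvelopingAlgebra ℂ g) V where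
  carrier := {v | FiniteDimensional ℂ (envSpan k V v)}
  zero_mem' := by
    refine Submodule.finiteDimensional_of_le (S₂ := ⊥) (envSpan_le k V 0 ⊥ (by simp) ?_)
    intro x _ w hw
    rw [(Submodule.mem_bot ℂ).1 hw, smul_zero]
    exact Submodule.zero_mem _
  add_mem' {v w} hv hw := by
    have : FiniteDimensional ℂ (envSpan k V v) := hv
    have : FiniteDimensional ℂ (envSpan k V w) := hw
    refine Submodule.finiteDimensional_of_le (S₂ := envSpan k V v ⊔ envSpan k V w) ?_
    rintro _ ⟨a, rfl⟩
    refine Submodule.mem_sup.2 ⟨_, ⟨a, rfl⟩, _, ⟨a, rfl⟩, ?_⟩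
    exact (smul_add _ _ _).symm
  smul_mem' a := by
    induction a using env_induction with
    | h1 c =>
      intro v hv
      have : FiniteDimensional ℂ (envSpan k V v) := hv
      rw [algebraMap_smul]
      refine Submodule.finiteDimensional_of_le (S₂ := envSpan k V v) (envSpan_le k V _ _ ?_ ?_)
      · exact Submodule.smul_mem _ _ (mem_envSpan_self k V v)
      · intro x hx w hw
        exact ι_smul_mem_envSpan k V v hx hw
    | h2 x => exact fun {v} hv => finiteDimensional_envSpan_ι_smul k V v hv x
    | h3 a b ha hb =>
      intro v hv
      rw [mul_smul]
      exact ha (hb hv)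
    | h4 a b ha hb =>
      intro v hv
      rw [add_smul]
      have : FiniteDimensional ℂ (envSpan k V (a • v)) := ha hv
      have : FiniteDimensional ℂ (envSpan k V (b • v)) := hb hv
      refine Submodule.finiteDimensional_of_le
        (S₂ := envSpan k V (a • v) ⊔ envSpan k V (b • v)) ?_
      rintro _ ⟨a, rfl⟩
      refine Submodule.mem_sup.2 ⟨_, ⟨a, rfl⟩, _, ⟨a, rfl⟩, ?_⟩
      exact (smul_add _ _ _).symm

/-- The functor `Γ` from `C(g, t)` to `g`-modules that takes a module to its submodule of
`k`-finite vectors. -/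
def Gam [FiniteDimensional ℂ g] (k t : LieSubalgebra ℂ g) :
    RelCat t ⥤ ModuleCat.{u} (UniversalEnvelopingAlgebra ℂ g) where
  obj V := ModuleCat.of _ (finitePart k V.obj)
  map {V W} φ := ModuleCat.ofHom (φ.hom.hom.restrict (p := finitePart k V.obj)
    (q := finitePart k W.obj) fun v hv => by
      have : FiniteDimensional ℂ (envSpan k V.obj v) := hv
      change FiniteDimensional ℂ (envSpan k W.obj _)
      rw [← envSpan_map]
      infer_instance)

instance [FiniteDimensional ℂ g] (k t : LieSubalgebra ℂ g) : (Gam k t).Additive where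
  map_add := rfl

/-- The right derived functors `RⁱΓ`. -/
def derivedGam [FiniteDimensional ℂ g] (k t : LieSubalgebra ℂ g) (i : ℕ) :
    RelCat t ⥤ ModuleCat.{u} (UniversalEnvelopingAlgebra ℂ g) :=
  (Gam k t).rightDerived i

section Sl2

variable {L M : Type*} [LieRing L] [LieAlgebra ℂ L] [AddCommGroup M] [Module ℂ M]
  [LieRingModule L M] [LieModule ℂ L M] {h e f : L}

open LieModule Module.End

theorem sub_pow_lie_e (T : IsSl2Triple h e f) (a : ℂ) (n : ℕ) (v : M) :
    ((toEnd ℂ L M h - algebraMap ℂ _ (a + 2)) ^ n) ⁅e, v⁆ =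
      ⁅e, ((toEnd ℂ L M h - algebraMap ℂ _ a) ^ n) v⁆ := by
  induction n generalizing v with
  | zero => simp
  | succ n ih =>
    have : (toEnd ℂ L M h - algebraMap ℂ _ (a + 2)) ⁅e, v⁆ =
        ⁅e, (toEnd ℂ L M h - algebraMap ℂ _ a) v⁆ := by
      simp only [LinearMap.sub_apply, toEnd_apply_apply, Module.algebraMap_end_apply,
        leibniz_lie h e v, T.lie_h_e_smul ℂ, smul_lie, lie_sub, lie_smul]
      module
    rw [pow_succ, Module.End.mul_apply, this, ih, pow_succ, Module.End.mul_apply]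

theorem lie_e_mem (T : IsSl2Triple h e f) {a : ℂ} {v : M}
    (hv : v ∈ (toEnd ℂ L M h).maxGenEigenspace a) :
    ⁅e, v⁆ ∈ (toEnd ℂ L M h).maxGenEigenspace (a + 2) := by
  rw [mem_maxGenEigenspace] at hv ⊢
  obtain ⟨n, hn⟩ := hv
  exact ⟨n, by simpa [hn, Algebra.algebraMap_eq_smul_one] using sub_pow_lie_e T a n v⟩

theorem hasEigenvalue_of_mem {φ : Module.End ℂ M} {a : ℂ} {v : M}
    (hv : v ∈ φ.maxGenEigenspace a) (h0 : v ≠ 0) : φ.HasEigenvalue a := by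
  rw [mem_maxGenEigenspace] at hv
  obtain ⟨n, hn1, hn2⟩ := Nat.exists_not_and_succ_of_not_zero_of_exists
    (p := fun n => ((φ - a • 1) ^ n) v = 0) (by simpa using h0) hv
  refine hasEigenvalue_of_hasEigenvector (x := ((φ - a • 1) ^ n) v) ⟨?_, hn1⟩
  rw [pow_succ', Module.End.mul_apply] at hn2
  rw [mem_eigenspace_iff]
  simpa [sub_eq_zero] using hn2

/-- In a finite-dimensional module, vectors killed by `e` are sums of eigenvectors of `h`. -/
theorem lie_h_eq_of_lie_e_eq_zero [FiniteDimensional ℂ M] (T : IsSl2Triple h e f) {a : ℂ} {v : M}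
    (hv : v ∈ (toEnd ℂ L M h).maxGenEigenspace a) (he : ⁅e, v⁆ = 0) : ⁅h, v⁆ = a • v := by
  by_contra hne
  set D := toEnd ℂ L M h - algebraMap ℂ _ a with hD
  have hDv : D v ≠ 0 := by simpa [hD, sub_eq_zero] using hne
  obtain ⟨N, hN⟩ := (mem_maxGenEigenspace _ _ _).1 hv
  obtain ⟨i, hi1, hi2⟩ := Nat.exists_not_and_succ_of_not_zero_of_exists
    (p := fun n => (D ^ n) (D v) = 0) (by simpa using hDv)
    ⟨N, by
      rw [← Module.End.mul_apply, ← pow_succ, pow_succ', Module.End.mul_apply]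
      simp [hD, Algebra.algebraMap_eq_smul_one, hN]⟩
  set v0 := (D ^ i) v with hv0
  set w0 := (D ^ i) (D v) with hw0
  have hDv0 : D v0 = w0 := by
    rw [hv0, hw0, ← Module.End.mul_apply, ← Module.End.mul_apply, ← pow_succ, ← pow_succ']
  have hDw0 : D w0 = 0 := by
    rw [← hi2, hw0, pow_succ', Module.End.mul_apply]
  have hev0 : ⁅e, v0⁆ = 0 := by rw [hv0, hD, ← sub_pow_lie_e T, he, map_zero]
  have hew0 : ⁅e, w0⁆ = 0 := by
    have := sub_pow_lie_e T a 1 v0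
    rw [hev0, map_zero, pow_one, ← hD, hDv0] at this
    exact this.symm
  have hhv0 : ⁅h, v0⁆ = a • v0 + w0 := by
    rw [← hDv0]
    simp [hD]
  have hhw0 : ⁅h, w0⁆ = a • w0 := by simpa [hD, sub_eq_zero] using hDw0
  have P : T.HasPrimitiveVectorWith w0 a := ⟨hi1, hhw0, hew0⟩
  obtain ⟨n, rfl⟩ := P.exists_nat
  have hH (k : ℕ) : ⁅h, (toEnd ℂ L M f ^ k) v0⁆ =
      ((n : ℂ) - 2 * k) • (toEnd ℂ L M f ^ k) v0 + (toEnd ℂ L M f ^ k) w0 := by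
    induction k with
    | zero => simpa using hhv0
    | succ k ih =>
      rw [pow_succ', Module.End.mul_apply, Module.End.mul_apply, toEnd_apply_apply,
        toEnd_apply_apply, leibniz_lie h, T.lie_lie_smul_f ℂ, ih, lie_add, lie_smul, neg_lie,
        smul_lie]
      push_cast
      module
  have hE (k : ℕ) : ⁅e, (toEnd ℂ L M f ^ (k + 1)) v0⁆ =
      ((k : ℂ) + 1) • ((toEnd ℂ L M f ^ k) w0 + ((n : ℂ) - k) • (toEnd ℂ L M f ^ k) v0) := by
    induction k with
    | zero => simp [leibniz_lie e, T.lie_e_f, hev0, hhv0, add_comm]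
    | succ k ih =>
      rw [pow_succ', Module.End.mul_apply, toEnd_apply_apply, leibniz_lie e, T.lie_e_f, ih, hH,
        lie_smul, lie_add, lie_smul, pow_succ', Module.End.mul_apply, Module.End.mul_apply,
        toEnd_apply_apply, toEnd_apply_apply]
      push_cast
      module
  have hF (k : ℕ) : (toEnd ℂ L M f ^ (n + 1 + k)) w0 = 0 := by
    rw [add_comm, pow_add, Module.End.mul_apply, P.pow_toEnd_f_eq_zero_of_eq_nat rfl, map_zero]
  have hne0 (k : ℕ) : (toEnd ℂ L M f ^ (n + 1 + k)) v0 ≠ 0 := by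
    induction k with
    | zero =>
      intro h0
      have h1 := hE n
      rw [← add_zero (n + 1), h0, lie_zero, sub_self, zero_smul, add_zero] at h1
      exact smul_ne_zero (Nat.cast_add_one_ne_zero n)
        (P.pow_toEnd_f_ne_zero_of_eq_nat rfl le_rfl) h1.symm
    | succ k ih =>
      intro h0
      have h1 := hE (n + 1 + k)
      rw [add_assoc, h0, lie_zero, hF, zero_add] at h1
      refine smul_ne_zero (Nat.cast_add_one_ne_zero _) (smul_ne_zero ?_ ih) h1.symm
      push_cast
      intro h2
      have : ((1 + k : ℕ) : ℂ) = 0 := by push_cast; linear_combination -h2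
      exact absurd (Nat.cast_eq_zero.1 this) (by lia)
  have hinf : (Set.range fun k : ℕ => (n : ℂ) - 2 * (n + 1 + k : ℕ)).Infinite :=
    Set.infinite_range_of_injective fun k l hkl => by
      have : ((n + 1 + k : ℕ) : ℂ) = (n + 1 + l : ℕ) := by
        linear_combination (-1 / 2 : ℂ) * hkl
      have := Nat.cast_injective this
      lia
  refine hinf ((toEnd ℂ L M h).finite_hasEigenvalue.subset ?_)
  rintro _ ⟨k, rfl⟩
  refine hasEigenvalue_of_hasEigenvector (x := (toEnd ℂ L M f ^ (n + 1 + k)) v0) ⟨?_, hne0 k⟩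
  rw [mem_eigenspace_iff, toEnd_apply_apply, hH, hF, add_zero]

theorem exists_pow_lie_e_eq_zero [FiniteDimensional ℂ M] (T : IsSl2Triple h e f) {a : ℂ} {v : M}
    (hv : v ∈ (toEnd ℂ L M h).maxGenEigenspace a) : ∃ r, (toEnd ℂ L M e ^ r) v = 0 := by
  by_contra! hne
  have hmem (k : ℕ) :
      (toEnd ℂ L M e ^ k) v ∈ (toEnd ℂ L M h).maxGenEigenspace (a + 2 * k) := by
    induction k with
    | zero => simpa using hv
    | succ k ih =>
      have := lie_e_mem T ih
      rw [pow_succ', Module.End.mul_apply]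
      rw [Nat.cast_add_one, mul_add_one, ← add_assoc]
      exact this
  have hinf : (Set.range fun k : ℕ => a + 2 * (k : ℂ)).Infinite :=
    Set.infinite_range_of_injective fun k l hkl => by simpa using hkl
  refine hinf ((toEnd ℂ L M h).finite_hasEigenvalue.subset ?_)
  rintro _ ⟨k, rfl⟩
  exact hasEigenvalue_of_mem (hmem k) (hne k)

/-- The Casimir operator of an `sl(2)`-triple. -/
def casimir (M : Type*) [AddCommGroup M] [Module ℂ M] [LieRingModule L M] [LieModule ℂ L M]
    (h e f : L) : Module.End ℂ M :=
  (4 : ℂ) • (toEnd ℂ L M f * toEnd ℂ L M e) + toEnd ℂ L M h * toEnd ℂ L M h +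
    (2 : ℂ) • toEnd ℂ L M h

theorem casimir_commute_h (T : IsSl2Triple h e f) :
    Commute (casimir M h e f) (toEnd ℂ L M h) := by
  ext v
  have h1 := leibniz_lie h f ⁅e, v⁆
  have h2 := leibniz_lie h e v
  simp only [T.lie_lie_smul_f ℂ, T.lie_h_e_smul ℂ, neg_lie, smul_lie] at h1 h2
  simp only [casimir, Module.End.mul_apply, LinearMap.add_apply, LinearMap.smul_apply,
    toEnd_apply_apply, lie_add, lie_smul, h1, h2]
  module

theorem casimir_commute_e (T : IsSl2Triple h e f) :
    Commute (casimir M h e f) (toEnd ℂ L M e) := by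
  ext v
  have h1 := leibniz_lie e f ⁅e, v⁆
  have h2 := leibniz_lie h e v
  have h3 := leibniz_lie h e ⁅h, v⁆
  simp only [T.lie_e_f, T.lie_h_e_smul ℂ, smul_lie] at h1 h2 h3
  simp only [casimir, Module.End.mul_apply, LinearMap.add_apply, LinearMap.smul_apply,
    toEnd_apply_apply, lie_add, lie_smul, h1, h2, h3]
  module

theorem casimir_eigenvalue {a c : ℂ} {v : M} (h0 : v ≠ 0) (he : ⁅e, v⁆ = 0)
    (hh : ⁅h, v⁆ = a • v) (hc : v ∈ (casimir M h e f).maxGenEigenspace c) :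
    c = a * a + 2 * a := by
  obtain ⟨n, hn⟩ := (mem_maxGenEigenspace _ _ _).1 hc
  have h1 : (casimir M h e f - c • 1) v = (a * a + 2 * a - c) • v := by
    simp only [casimir, Module.End.mul_apply, LinearMap.add_apply, LinearMap.smul_apply,
      LinearMap.sub_apply, Module.End.one_apply, toEnd_apply_apply, he, hh, lie_smul, lie_zero]
    module
  have h2 (k : ℕ) : ((casimir M h e f - c • 1) ^ k) v = (a * a + 2 * a - c) ^ k • v := by
    induction k with
    | zero => simp
    | succ k ih => rw [pow_succ', Module.End.mul_apply, ih, map_smul, h1, smul_smul, pow_succ]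
  rw [h2] at hn
  have := eq_zero_of_pow_eq_zero ((smul_eq_zero.1 hn).resolve_right h0)
  linear_combination -this

theorem lie_h_eq_of_mem [FiniteDimensional ℂ M] (T : IsSl2Triple h e f) {c : ℂ} (r : ℕ) :
    ∀ {a : ℂ} {v : M}, v ∈ (toEnd ℂ L M h).maxGenEigenspace a →
      v ∈ (casimir M h e f).maxGenEigenspace c → (toEnd ℂ L M e ^ r) v = 0 → ⁅h, v⁆ = a • v := by
  induction r with
  | zero =>
    intro a v _ _ h0
    have h0 : v = 0 := by simpa using h0
    simp [h0]
  | succ r ih =>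
    intro a v hv hc h0
    by_cases hev : ⁅e, v⁆ = 0
    · exact lie_h_eq_of_lie_e_eq_zero T hv hev
    have hcE {w : M} (hw : w ∈ (casimir M h e f).maxGenEigenspace c) :
        ⁅e, w⁆ ∈ (casimir M h e f).maxGenEigenspace c :=
      mapsTo_maxGenEigenspace_of_comm (casimir_commute_e T) c hw
    have h1 : ⁅h, ⁅e, v⁆⁆ = (a + 2) • ⁅e, v⁆ :=
      ih (lie_e_mem T hv) (hcE hc) (by rw [← h0, pow_succ, Module.End.mul_apply]; rfl)
    by_contra hne
    set w := ⁅h, v⁆ - a • v with hw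
    have hw0 : w ≠ 0 := sub_ne_zero.2 hne
    have hew : ⁅e, w⁆ = 0 := by
      have h2 := leibniz_lie h e v
      rw [h1, T.lie_h_e_smul ℂ, smul_lie] at h2
      have h3 : ⁅e, ⁅h, v⁆⁆ = a • ⁅e, v⁆ := by
        rw [← sub_eq_zero, ← sub_eq_zero.2 h2.symm]
        module
      rw [hw, lie_sub, lie_smul, h3, sub_self]
    have hwH : w ∈ (toEnd ℂ L M h).maxGenEigenspace a :=
      Submodule.sub_mem _ (mapsTo_maxGenEigenspace_of_comm (Commute.refl _) a hv)
        (Submodule.smul_mem _ _ hv)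
    have hwC : w ∈ (casimir M h e f).maxGenEigenspace c :=
      Submodule.sub_mem _ (mapsTo_maxGenEigenspace_of_comm (casimir_commute_h T) c hc)
        (Submodule.smul_mem _ _ hc)
    have hhw := lie_h_eq_of_lie_e_eq_zero T hwH hew
    obtain ⟨n, rfl⟩ := IsSl2Triple.HasPrimitiveVectorWith.exists_nat
      (t := T) (m := w) (μ := a) ⟨hw0, hhw, hew⟩
    obtain ⟨j, hj1, hj2⟩ := Nat.exists_not_and_succ_of_not_zero_of_exists
      (p := fun j => (toEnd ℂ L M e ^ j) ⁅e, v⁆ = 0) (by simpa using hev)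
      (exists_pow_lie_e_eq_zero T (lie_e_mem T hv))
    have hjh := T.lie_h_pow_toEnd_e h1 j
    have hjC (j : ℕ) : (toEnd ℂ L M e ^ j) ⁅e, v⁆ ∈ (casimir M h e f).maxGenEigenspace c := by
      induction j with
      | zero => simpa using hcE hc
      | succ j ihj =>
        rw [pow_succ', Module.End.mul_apply]
        exact hcE ihj
    have c1 := casimir_eigenvalue hw0 hew hhw hwC
    have c2 := casimir_eigenvalue hj1 (by rw [IsSl2Triple.lie_e_pow_toEnd_e, hj2]) hjh (hjC j)
    have c3 : ((n * n + 2 * n : ℕ) : ℂ) =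
        ((n + 2 + 2 * j) * (n + 2 + 2 * j) + 2 * (n + 2 + 2 * j) : ℕ) := by
      push_cast
      rw [← c1, c2]
    have c4 := Nat.cast_injective c3
    nlinarith

/-- In a finite-dimensional module, `h` acts diagonalizably. -/
theorem iSup_eigenspace_eq_top [FiniteDimensional ℂ M] (T : IsSl2Triple h e f) :
    ⨆ a : ℂ, (toEnd ℂ L M h).eigenspace a = ⊤ := by
  let Φ : Bool → Module.End ℂ M := fun b => cond b (toEnd ℂ L M h) (casimir M h e f)
  have htop := iSup_iInf_maxGenEigenspace_eq_top_of_iSup_maxGenEigenspace_eq_top_of_commute Φ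
    (by
      rintro (_ | _) (_ | _) hij
      · exact absurd rfl hij
      · exact casimir_commute_h T
      · exact (casimir_commute_h T).symm
      · exact absurd rfl hij)
    (fun b => iSup_maxGenEigenspace_eq_top (Φ b))
  rw [eq_top_iff, ← htop]
  refine iSup_le fun χ v hv => ?_
  rw [Submodule.mem_iInf] at hv
  have h1 := hv true
  have h2 := hv false
  obtain ⟨r, hr⟩ := exists_pow_lie_e_eq_zero T h1
  exact Submodule.mem_iSup_of_mem (χ true) (mem_eigenspace_iff.2 (lie_h_eq_of_mem T r h1 h2 hr))

end Sl2

/-- The centralizer of a subset of `g`. -/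
def centralizer (s : Set g) : LieSubalgebra ℂ g where
  carrier := {x | ∀ y ∈ s, ⁅y, x⁆ = 0}
  zero_mem' y _ := lie_zero y
  add_mem' {a b} ha hb y hy := by rw [lie_add, ha y hy, hb y hy, add_zero]
  smul_mem' c a ha y hy := by rw [lie_smul, ha y hy, smul_zero]
  lie_mem' {a b} ha hb y hy := by
    rw [leibniz_lie, ha y hy, hb y hy, zero_lie, lie_zero, add_zero]

/-- A subalgebra contains a regular nilpotent element: an `ad`-nilpotent element of `g` whose
centralizer has dimension equal to the rank of `g`. -/
def ContainsRegularNilpotent [FiniteDimensional ℂ g] (k : LieSubalgebra ℂ g) : Prop :=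
  ∃ x ∈ k, IsNilpotent (LieAlgebra.ad ℂ g x) ∧
    Module.finrank ℂ (centralizer {x}) = LieAlgebra.rank ℂ g

/-- The subalgebra `t` spanned by `h`. -/
def torus (h : g) : LieSubalgebra ℂ g where
  __ := Submodule.span ℂ {h}
  lie_mem' {x y} hx hy := by
    obtain ⟨a, rfl⟩ := Submodule.mem_span_singleton.1 hx
    obtain ⟨b, rfl⟩ := Submodule.mem_span_singleton.1 hy
    simp

theorem mem_torus (h : g) : h ∈ torus h := Submodule.mem_span_singleton_self h

/-- The subalgebra `C(t)`. -/
def cartan (h : g) : LieSubalgebra ℂ g := centralizer (torus h)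

theorem torus_le_cartan (h : g) : torus h ≤ cartan h := by
  rintro x hx y hy
  obtain ⟨a, rfl⟩ := Submodule.mem_span_singleton.1 hx
  obtain ⟨b, rfl⟩ := Submodule.mem_span_singleton.1 hy
  simp

/-- Restriction of a weight from `C(t)` to `t`. -/
def restrictWeight {h : g} (lam : Module.Dual ℂ (cartan h)) : Module.Dual ℂ (torus h) :=
  lam ∘ₗ (LieSubalgebra.inclusion (torus_le_cartan h) : torus h →ₗ[ℂ] cartan h)

/-- The sum of all eigenspaces of `ad h` with nonnegative real eigenvalue. -/
def nonnegPart (h : g) : LieSubalgebra ℂ g where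
  __ := ⨆ r : {r : ℝ // 0 ≤ r}, (LieAlgebra.ad ℂ g h).eigenspace ((r : ℝ) : ℂ)
  lie_mem' {x y} hx hy := by
    refine Submodule.iSup_induction _ (motive := fun x => ⁅x, y⁆ ∈
      ⨆ r : {r : ℝ // 0 ≤ r}, (LieAlgebra.ad ℂ g h).eigenspace ((r : ℝ) : ℂ)) hx ?_ ?_ ?_
    · intro r x hx
      refine Submodule.iSup_induction _ (motive := fun y => ⁅x, y⁆ ∈
        ⨆ r : {r : ℝ // 0 ≤ r}, (LieAlgebra.ad ℂ g h).eigenspace ((r : ℝ) : ℂ)) hy ?_ ?_ ?_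
      · intro s y hy
        refine Submodule.mem_iSup_of_mem ⟨r.1 + s.1, add_nonneg r.2 s.2⟩ ?_
        rw [Module.End.mem_eigenspace_iff, LieAlgebra.ad_apply] at hx hy ⊢
        rw [leibniz_lie, hx, hy, smul_lie, lie_smul, ← add_smul]
        push_cast
        rfl
      · rw [lie_zero]
        exact Submodule.zero_mem _
      · intro a b ha hb
        rw [lie_add]
        exact Submodule.add_mem _ ha hb
    · rw [zero_lie]
      exact Submodule.zero_mem _
    · intro a b ha hb
      rw [add_lie]
      exact Submodule.add_mem _ ha hb

/-- The subalgebra `b̄`: the sum of the eigenspaces of `ad h` with nonnegative eigenvalue. -/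
def borelBar (h : g) : LieSubalgebra ℂ g := nonnegPart h

/-- The opposite subalgebra `b`: the sum of the eigenspaces of `ad h` with nonpositive
eigenvalue. -/
def borel (h : g) : LieSubalgebra ℂ g := nonnegPart (-h)

/-- The subspace `[b, b]` of `g`. -/
def commutator (b : LieSubalgebra ℂ g) : Submodule ℂ g :=
  Submodule.span ℂ {z | ∃ x ∈ b, ∃ y ∈ b, ⁅x, y⁆ = z}

/-- The left ideal of `U(g)` generated by `n = [b, b]` and all `x - λ(x)` with `x ∈ C(t)`. -/
def vermaIdeal {h : g} (lam : Module.Dual ℂ (cartan h)) :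
    Submodule (UniversalEnvelopingAlgebra ℂ g) (UniversalEnvelopingAlgebra ℂ g) :=
  Submodule.span _ ({a | ∃ x ∈ commutator (borel h), a = UniversalEnvelopingAlgebra.ι ℂ x} ∪
    {a | ∃ x : cartan h, a = UniversalEnvelopingAlgebra.ι ℂ (x : g) - algebraMap ℂ _ (lam x)})

/-- The Verma module `M(λ) = U(g) ⊗_{U(b)} ℂ_λ`, presented as the quotient of `U(g)` by the left
ideal generated by the kernel of `U(b) → End ℂ_λ`. -/
def verma {h : g} (lam : Module.Dual ℂ (cartan h)) :
    ModuleCat.{u} (UniversalEnvelopingAlgebra ℂ g) :=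
  ModuleCat.of _ (UniversalEnvelopingAlgebra ℂ g ⧸ vermaIdeal lam)

/-- The span of the eigenvectors of `h` in a `g`-module. -/
def eigSpan (h : g) (V : ModuleCat.{u} (UniversalEnvelopingAlgebra ℂ g)) : Submodule ℂ V :=
  Submodule.span ℂ {v | ∃ a : ℂ, UniversalEnvelopingAlgebra.ι ℂ h • v = a • v}

theorem relProp_torus_of_eigSpan {h : g} {V : ModuleCat.{u} (UniversalEnvelopingAlgebra ℂ g)}
    (hV : eigSpan h V = ⊤) : relProp (torus h) V := by
  refine ⟨fun x hx v => ?_, ?_⟩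
  · obtain ⟨s, rfl⟩ := Submodule.mem_span_singleton.1 hx
    have hv : v ∈ eigSpan h V := hV ▸ Submodule.mem_top
    induction hv using Submodule.span_induction with
    | mem v hv =>
      obtain ⟨a, ha⟩ := hv
      refine Submodule.finiteDimensional_of_le (S₂ := Submodule.span ℂ {v}) ?_
      refine Submodule.span_le.2 ?_
      rintro _ ⟨n, rfl⟩
      refine Submodule.mem_span_singleton.2 ⟨(s * a) ^ n, ?_⟩
      induction n with
      | zero => simp
      | succ n ih =>
        beta_reduce at ih ⊢
        rw [pow_succ', pow_succ', mul_smul (UniversalEnvelopingAlgebra.ι ℂ (s • h)), ← ih,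
          smul_comm (UniversalEnvelopingAlgebra.ι ℂ (s • h)), map_smul, smul_assoc, ha, smul_smul,
          smul_smul]
        ring_nf
    | zero =>
      refine Submodule.finiteDimensional_of_le (S₂ := ⊥) (Submodule.span_le.2 ?_)
      rintro _ ⟨n, rfl⟩
      exact smul_zero _
    | add v w _ _ hv hw => exact Submodule.finiteDimensional_of_le (cyclicSpan_add_le V _ v w)
    | smul c v _ hv =>
      refine Submodule.finiteDimensional_of_le (S₂ := cyclicSpan V (s • h) v)
        (Submodule.span_le.2 ?_)
      rintro _ ⟨n, rfl⟩
      beta_reduce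
      rw [smul_comm]
      exact Submodule.smul_mem _ _ (Submodule.subset_span ⟨n, rfl⟩)
  · let V' := (ModuleCat.restrictScalars (envMap (torus h)).toRingHom).obj V
    let E := {v : V // v ≠ 0 ∧ ∃ a : ℂ, UniversalEnvelopingAlgebra.ι ℂ h • v = a • v}
    have key (v : E) (b : UniversalEnvelopingAlgebra ℂ (torus h)) :
        ∃ c : ℂ, envMap (torus h) b • v.1 = c • v.1 := by
      induction b using env_induction with
      | h1 c => exact ⟨c, by rw [AlgHom.commutes, algebraMap_smul]⟩
      | h2 x =>
        obtain ⟨s, hs⟩ := Submodule.mem_span_singleton.1 x.2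
        obtain ⟨a, ha⟩ := v.2.2
        have : envMap (torus h) (UniversalEnvelopingAlgebra.ι ℂ x) =
          UniversalEnvelopingAlgebra.ι ℂ (x : g) := UniversalEnvelopingAlgebra.lift_ι_apply ..
        exact ⟨s * a, by rw [this, ← hs, map_smul, smul_assoc, ha, smul_smul]⟩
      | h3 a b ha hb =>
        obtain ⟨c, hc⟩ := ha
        obtain ⟨d, hd⟩ := hb
        exact ⟨d * c, by rw [map_mul, mul_smul, hd, smul_comm, hc, smul_smul]⟩
      | h4 a b ha hb =>
        obtain ⟨c, hc⟩ := ha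
        obtain ⟨d, hd⟩ := hb
        exact ⟨c + d, by rw [map_add, add_smul, hc, hd, add_smul]⟩
    let p (v : E) : Submodule (UniversalEnvelopingAlgebra ℂ (torus h)) V' :=
      Submodule.span _ {(v.1 : V')}
    have hp (v : E) (w : V) : (show V' from w) ∈ p v ↔ ∃ c : ℂ, c • v.1 = w := by
      refine Submodule.mem_span_singleton.trans ⟨?_, ?_⟩
      · rintro ⟨b, rfl⟩
        obtain ⟨c, hc⟩ := key v b
        exact ⟨c, hc.symm⟩
      · rintro ⟨c, rfl⟩
        refine ⟨algebraMap ℂ _ c, ?_⟩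
        change envMap (torus h) (algebraMap ℂ _ c) • v.1 = _
        rw [AlgHom.commutes, algebraMap_smul]
    refine isSemisimpleModule_of_isSemisimpleModule_submodule' (p := p) (fun v => ?_) ?_
    · have : IsSimpleModule (UniversalEnvelopingAlgebra ℂ (torus h)) (p v) := by
        rw [isSimpleModule_iff_isAtom]
        refine ⟨fun h0 => v.2.1 ?_, fun N hN => ?_⟩
        · have h1 : (show V' from v.1) ∈ p v := Submodule.mem_span_singleton_self _
          rw [h0] at h1
          exact (Submodule.mem_bot (M := V') _).1 h1
        by_contra hne
        obtain ⟨w, hwN, hw0⟩ := Submodule.exists_mem_ne_zero_of_ne_bot hne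
        obtain ⟨c, hc⟩ := (hp v w).1 (hN.le hwN)
        have hc0 : c ≠ 0 := by
          rintro rfl
          exact hw0 (by rw [← hc]; exact zero_smul ℂ v.1)
        refine hN.not_ge (Submodule.span_le.2 (Set.singleton_subset_iff.2 ?_))
        have h1 := N.smul_mem (algebraMap ℂ _ c⁻¹) hwN
        have h2 : envMap (torus h) (algebraMap ℂ _ c⁻¹) • (show V from w) = v.1 := by
          rw [AlgHom.commutes, algebraMap_smul, ← hc, smul_smul, inv_mul_cancel₀ hc0, one_smul]
        exact h2 ▸ h1
      infer_instance
    · refine eq_top_iff.2 fun v _ => ?_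
      have hv : (show V from v) ∈ eigSpan h V := hV ▸ Submodule.mem_top
      refine Submodule.span_induction
        (p := fun (w : V) _ => (show V' from w) ∈ ⨆ i, p i) ?_ ?_ ?_ ?_ hv
      · intro w hw
        by_cases hw0 : w = 0
        · rw [hw0]
          exact Submodule.zero_mem _
        · exact Submodule.mem_iSup_of_mem ⟨w, hw0, hw⟩ (Submodule.mem_span_singleton_self _)
      · exact Submodule.zero_mem _
      · intro a b _ _ ha hb
        exact Submodule.add_mem _ ha hb
      · intro c w _ hw
        have := Submodule.smul_mem _ (algebraMap ℂ (UniversalEnvelopingAlgebra ℂ (torus h)) c) hw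
        convert this
        change _ = envMap (torus h) (algebraMap ℂ _ c) • (w : V)
        rw [AlgHom.commutes, algebraMap_smul]

/-- The Verma module is an object of `C(g, t)`. -/
theorem relProp_verma [FiniteDimensional ℂ g] {h e f : g} (T : IsSl2Triple h e f)
    (lam : Module.Dual ℂ (cartan h)) : relProp (torus h) (verma lam) := by
  refine relProp_torus_of_eigSpan (eq_top_iff.2 ?_)
  have hg : ∀ x : g, ∀ v ∈ eigSpan h (verma lam),
      UniversalEnvelopingAlgebra.ι ℂ x • v ∈ eigSpan h (verma lam) := by
    intro x v hv
    have hx : x ∈ ⨆ a : ℂ, (LieAlgebra.ad ℂ g h).eigenspace a :=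
      (iSup_eigenspace_eq_top (M := g) T).symm ▸ Submodule.mem_top
    induction hx using Submodule.iSup_induction' with
    | mem a x hx =>
      rw [Module.End.mem_eigenspace_iff, LieAlgebra.ad_apply] at hx
      induction hv using Submodule.span_induction with
      | mem v hv =>
        obtain ⟨b, hb⟩ := hv
        refine Submodule.subset_span ⟨a + b, ?_⟩
        have h1 : UniversalEnvelopingAlgebra.ι ℂ h * UniversalEnvelopingAlgebra.ι ℂ x =
            a • UniversalEnvelopingAlgebra.ι ℂ x +
              UniversalEnvelopingAlgebra.ι ℂ x * UniversalEnvelopingAlgebra.ι ℂ h := by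
          have := (UniversalEnvelopingAlgebra.ι ℂ (L := g)).map_lie h x
          rw [hx, map_smul, LieRing.of_associative_ring_bracket] at this
          rw [this, sub_add_cancel]
        rw [← mul_smul, h1, add_smul, mul_smul, hb, smul_assoc, add_smul, smul_comm b]
      | zero =>
        rw [smul_zero]
        exact Submodule.zero_mem _
      | add v w _ _ hv hw =>
        rw [smul_add]
        exact Submodule.add_mem _ hv hw
      | smul c v _ hv =>
        rw [smul_comm]
        exact Submodule.smul_mem _ _ hv
    | zero =>
      rw [map_zero, zero_smul]
      exact Submodule.zero_mem _
    | add x y _ _ hx hy =>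
      rw [map_add, add_smul]
      exact Submodule.add_mem _ hx hy
  have hU : ∀ a : UniversalEnvelopingAlgebra ℂ g, ∀ v ∈ eigSpan h (verma lam),
      a • v ∈ eigSpan h (verma lam) := by
    intro a
    induction a using env_induction with
    | h1 c =>
      intro v hv
      rw [algebraMap_smul]
      exact Submodule.smul_mem _ _ hv
    | h2 x => exact hg x
    | h3 a b ha hb =>
      intro v hv
      rw [mul_smul]
      exact ha _ (hb _ hv)
    | h4 a b ha hb =>
      intro v hv
      rw [add_smul]
      exact Submodule.add_mem _ (ha _ hv) (hb _ hv)
  intro v _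
  obtain ⟨a, rfl⟩ := Submodule.Quotient.mk_surjective (vermaIdeal lam) v
  have h1 : (Submodule.Quotient.mk a : UniversalEnvelopingAlgebra ℂ g ⧸ vermaIdeal lam) =
      a • Submodule.Quotient.mk 1 := by
    rw [← Submodule.Quotient.mk_smul, smul_eq_mul, mul_one]
  rw [h1]
  refine hU a _ (Submodule.subset_span ⟨lam ⟨h, torus_le_cartan h (mem_torus h)⟩, ?_⟩)
  refine Eq.trans ?_ (algebraMap_smul (UniversalEnvelopingAlgebra ℂ g) _ _)
  refine (Submodule.Quotient.eq (vermaIdeal lam)).2 ?_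
  refine Submodule.subset_span (Or.inr ⟨⟨h, torus_le_cartan h (mem_torus h)⟩, ?_⟩)
  simp

/-- The modules `Aⁱ(λ) = RⁱΓ(M(λ))`, for `k` the span of an `sl(2)`-triple and `t = ⟨h⟩`. -/
def A [FiniteDimensional ℂ g] {h e f : g} (T : IsSl2Triple h e f) (i : ℕ)
    (lam : Module.Dual ℂ (cartan h)) : ModuleCat.{u} (UniversalEnvelopingAlgebra ℂ g) :=
  (derivedGam (T.toLieSubalgebra ℂ) (torus h) i).obj ⟨verma lam, relProp_verma T lam⟩

/-- `λ` is `g`-integral: it takes integral values on all coroots of `g` with respect to `C(t)`. The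
coroots are the elements `H ∈ C(t)` of `sl(2)`-triples `(H, E, F)` with `E` and `F` in the root
spaces of some `α` and `-α`. -/
def IsIntegral {h : g} (lam : Module.Dual ℂ (cartan h)) : Prop :=
  ∀ (H : cartan h) (E F : g) (α : Module.Dual ℂ (cartan h)), IsSl2Triple (H : g) E F →
    (∀ x : cartan h, ⁅(x : g), E⁆ = α x • E) → (∀ x : cartan h, ⁅(x : g), F⁆ = -α x • F) →
    ∃ n : ℤ, lam H = n

/-- The root `α` of `k` on `t = ⟨h⟩` with root space `⟨e⟩`. -/
def rootOf {h e f : g} (T : IsSl2Triple h e f) : Module.Dual ℂ (torus h) :=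
  (2 : ℂ) • (LinearEquiv.coord ℂ g h T.h_ne_zero : Submodule.span ℂ {h} →ₗ[ℂ] ℂ)

theorem lie_eq_rootOf {h e f : g} (T : IsSl2Triple h e f) (x : torus h) :
    ⁅(x : g), e⁆ = rootOf T x • e := by
  have h1 : (rootOf T x / 2) • h = (x : g) := by
    have := LinearEquiv.coord_apply_smul ℂ g h T.h_ne_zero x
    have h2 : rootOf T x / 2 = LinearEquiv.coord ℂ g h T.h_ne_zero x :=
      mul_div_cancel_left₀ _ two_ne_zero
    rw [h2, this]
  rw [← h1, smul_lie, T.lie_h_e_smul ℂ, smul_smul, div_mul_cancel₀ _ two_ne_zero]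

/-- `ρ_k = α / 2`. -/
def rho {h e f : g} (T : IsSl2Triple h e f) : Module.Dual ℂ (torus h) :=
  (1 / 2 : ℂ) • rootOf T

/-- `μ ∈ t*` is dominant integral for `k`: its value on the coroot `h` is in `ℤ₊`. -/
def IsDominantIntegral {h : g} (μ : Module.Dual ℂ (torus h)) : Prop :=
  ∃ m : ℕ, μ ⟨h, mem_torus h⟩ = m

/-- `W` is an irreducible finite-dimensional `k`-module with highest weight `μ`. -/
structure IsTypeOfHighestWeight {h e f : g} (T : IsSl2Triple h e f)
    (μ : Module.Dual ℂ (torus h)) (W : Type*) [AddCommGroup W] [Module ℂ W]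
    [LieRingModule (T.toLieSubalgebra ℂ) W] [LieModule ℂ (T.toLieSubalgebra ℂ) W] : Prop where
  finite : FiniteDimensional ℂ W
  irreducible : LieModule.IsIrreducible ℂ (T.toLieSubalgebra ℂ) W
  exists_vector : ∃ w : W, w ≠ 0 ∧
    (∀ x : T.toLieSubalgebra ℂ, (x : g) = e → ⁅x, w⁆ = 0) ∧
    ∀ (x : T.toLieSubalgebra ℂ) (hx : (x : g) ∈ torus h), ⁅x, w⁆ = μ ⟨x, hx⟩ • w

/-- The space `Hom_k(W, V)` for a `k`-module `W` and a `g`-module `V`. -/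
def homK (k : LieSubalgebra ℂ g) (W : Type*) [AddCommGroup W] [Module ℂ W]
    [LieRingModule k W] (V : ModuleCat.{u} (UniversalEnvelopingAlgebra ℂ g)) :
    Submodule ℂ (W →ₗ[ℂ] V) where
  carrier := {φ | ∀ (x : k) (w : W), φ ⁅x, w⁆ = UniversalEnvelopingAlgebra.ι ℂ (x : g) • φ w}
  zero_mem' x w := (smul_zero _).symm
  add_mem' {φ ψ} hφ hψ x w := by simp only [LinearMap.add_apply, hφ x w, hψ x w, smul_add]
  smul_mem' c φ hφ x w := by
    simp only [LinearMap.smul_apply, hφ x w]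
    exact smul_comm _ _ _

section Sym

variable {V : Type*} [AddCommGroup V] [Module ℂ V]

/-- The algebra homomorphism `S(V) → S(V)[ε]` with `v ↦ v + D(v) ε`. -/
def symHom (D : V →ₗ[ℂ] V) :
    SymmetricAlgebra ℂ V →ₐ[ℂ] DualNumber (SymmetricAlgebra ℂ V) :=
  SymmetricAlgebra.lift
    ((TrivSqZeroExt.inlAlgHom ℂ (SymmetricAlgebra ℂ V) (SymmetricAlgebra ℂ V)).toLinearMap ∘ₗ
        SymmetricAlgebra.ι ℂ V +
      (TrivSqZeroExt.inrHom (SymmetricAlgebra ℂ V) (SymmetricAlgebra ℂ V)).restrictScalars ℂ ∘ₗ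
        SymmetricAlgebra.ι ℂ V ∘ₗ D)

theorem fst_symHom (D : V →ₗ[ℂ] V) (s : SymmetricAlgebra ℂ V) :
    TrivSqZeroExt.fst (symHom D s) = s := by
  have : (TrivSqZeroExt.fstHom ℂ (SymmetricAlgebra ℂ V) (SymmetricAlgebra ℂ V)).comp (symHom D) =
      AlgHom.id ℂ _ := by
    ext v
    simp [symHom]
  exact DFunLike.congr_fun this s

/-- The derivation of `S(V)` that extends an endomorphism of `V`. -/
def symDerivation (D : V →ₗ[ℂ] V) :
    Derivation ℂ (SymmetricAlgebra ℂ V) (SymmetricAlgebra ℂ V) :=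
  Derivation.mk'
    ((TrivSqZeroExt.sndHom (SymmetricAlgebra ℂ V) (SymmetricAlgebra ℂ V)).restrictScalars ℂ ∘ₗ
      (symHom D).toLinearMap)
    fun a b => by
      simp [TrivSqZeroExt.snd_mul, fst_symHom, mul_comm]

theorem symDerivation_ι (D : V →ₗ[ℂ] V) (v : V) :
    symDerivation D (SymmetricAlgebra.ι ℂ V v) = SymmetricAlgebra.ι ℂ V (D v) := by
  simp [symDerivation, symHom]

end Sym

/-- The `t`-module `n̄ ∩ k^⊥`, where `n̄ = [b̄, b̄]` and the orthogonal complement is with respect to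
the Killing form of `g`. -/
def nbarPerp {h e f : g} (T : IsSl2Triple h e f) : LieSubmodule ℂ (torus h) g where
  __ := commutator (borelBar h) ⊓ (killingForm ℂ g).orthogonal (T.toLieSubalgebra ℂ).toSubmodule
  lie_mem {x m} hm := by
    obtain ⟨s, hs⟩ := Submodule.mem_span_singleton.1 x.2
    have hx : ⁅x, m⁆ = s • ⁅h, m⁆ := by
      change ⁅(x : g), m⁆ = _
      rw [← hs, smul_lie]
    have hb : h ∈ borelBar h := by
      refine Submodule.mem_iSup_of_mem ⟨0, le_rfl⟩ ?_
      rw [Module.End.mem_eigenspace_iff]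
      simp
    have hk : h ∈ T.toLieSubalgebra ℂ := Submodule.subset_span (by simp)
    obtain ⟨h1, h2⟩ := hm
    rw [hx]
    refine Submodule.smul_mem _ s ⟨?_, ?_⟩
    · have hstab : commutator (borelBar h) ≤
          (commutator (borelBar h)).comap (LieAlgebra.ad ℂ g h) := by
        refine Submodule.span_le.2 ?_
        rintro _ ⟨y, hy, z, hz, rfl⟩
        exact Submodule.subset_span ⟨h, hb, ⁅y, z⁆, (borelBar h).lie_mem hy hz, rfl⟩
      exact hstab h1
    · refine LinearMap.BilinForm.mem_orthogonal_iff.2 fun y hy => ?_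
      have h3 := LinearMap.BilinForm.mem_orthogonal_iff.1 h2 ⁅y, h⁆
        ((T.toLieSubalgebra ℂ).lie_mem hy hk)
      rw [← h3]
      exact (LieModule.traceForm_apply_lie_apply ℂ g g y h m).symm

/-- `P(ν)`: the multiplicity of `ν ∈ t*` in the symmetric algebra of `n̄ ∩ k^⊥`. -/
def partitionFunction {h e f : g} (T : IsSl2Triple h e f) (ν : Module.Dual ℂ (torus h)) : ℕ :=
  Module.finrank ℂ (⨅ x : torus h, Module.End.eigenspace
    ((symDerivation (LieModule.toEnd ℂ (torus h) (nbarPerp T) x)).toLinearMap) (ν x) :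
      Submodule ℂ (SymmetricAlgebra ℂ (nbarPerp T)))

end

end PrincipalSl2

/-! Write M for M(λ). Since b is the nonpositive part, λ(h) is the lowest weight of M and all
weights lie in λ(h) + ℕ. The regular nilpotent in k bounds the dimension of the centralizer of h by
the rank of g, so this centralizer is a Cartan subalgebra, hence abelian
(`lie_eq_zero_of_mem_cartan`). It follows that n̄ is the whole positive part of g, that n̄ = ℂe ⊕
(n̄ ∩ k^⊥), and that M has the PBW basis e^k · (monomial in n̄ ∩ k^⊥) · v. Thus M is free over ℂ[e],
and dim M_{c+2} − dim M_c = P(c + 2 − λ(h)) (`vermaFacts`).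

On k-finite vectors e acts nilpotently, while on the localization Y = M[e⁻¹] it acts bijectively.
Morally ΓY = R¹ΓY = 0 and the long exact sequence of M → Y → Y/M gives A¹(λ) ≅ Γ(Y/M); this is
carried out as a diagram chase in an injective resolution (`exists_equiv_of_exact`,
`exists_derivedGam_equiv`).

Maps from W(m) into a module correspond to vectors of weight m killed by e and by f^{m+1}. In Y/M
the vectors killed by e form e⁻¹M/M ≅ M/eM with weights lowered by 2, so those of weight c have
dimension P(c + 2 − λ(h)) (`finrank_singularSpace`). The operator f^{m+1} carries those of weight m
to those of weight −m − 2, and its kernel is the space wanted. If it is onto, the dimension is P(m +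
2 − λ(h)) − P(−m − λ(h)) (`IsLocalizationAt.finrank_primitiveSpace`, `finrank_homK`).

Surjectivity follows from M_{−m} = eM_{−m−2} + f^{m+1}M_{m+2}. If this fails, a functional vanishing
on the right side and on the other weight spaces is a nonzero k-finite vector of the dual of M. The
k-finite part of the dual is a g-module whose h-weights are bounded on one side and, by
sl(2)-theory, symmetric, so it is finite-dimensional. It pairs nontrivially with the generator of M,
which makes −λ(H) an eigenvalue of each coroot H on a finite-dimensional module, hence an integer.
So surjectivity is automatic for λ not integral, which is (1). In (2) all weights of M are positive,
so M_{−m} = 0 and surjectivity is trivial; the second term is 0, and P(m − n) is 1 for m = n and 0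
for m < n. -/

namespace PrincipalSl2

noncomputable section

open CategoryTheory CategoryTheory.Limits
open scoped ModuleCat

attribute [local instance 100] LieRing.ofAssociativeRing

/-! ### The Poincaré–Birkhoff–Witt theorem, for Lie algebras embedded in their enveloping algebra -/

section PBW

open scoped TensorProduct

/-- The ordered monomial `x₀ ^ a₀ * x₁ ^ a₁ * ⋯`. -/
def orderedMonomial {A : Type*} [Monoid A] {n : ℕ} (x : Fin n → A) (a : Fin n → ℕ) : A :=
  (List.ofFn fun i => x i ^ a i).prod

theorem orderedMonomial_cons {A : Type*} [Monoid A] {n : ℕ} (x : Fin (n + 1) → A) (k : ℕ)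
    (a : Fin n → ℕ) :
    orderedMonomial x (Fin.cons k a) = x 0 ^ k * orderedMonomial (fun i => x i.succ) a := by
  simp [orderedMonomial, List.ofFn_succ]

theorem orderedMonomial_append {A : Type*} [Monoid A] {m n : ℕ} (x : Fin m → A) (y : Fin n → A)
    (a : Fin m → ℕ) (b : Fin n → ℕ) :
    orderedMonomial (Fin.append x y) (Fin.append a b) =
      orderedMonomial x a * orderedMonomial y b := by
  rw [orderedMonomial, orderedMonomial, orderedMonomial, ← List.prod_append, ← List.ofFn_fin_append]
  congr 2
  funext i
  refine Fin.addCases (fun i => ?_) (fun i => ?_) i <;> simp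

theorem map_orderedMonomial {A B : Type*} [Monoid A] [Monoid B] (φ : A →* B) {n : ℕ}
    (x : Fin n → A) (a : Fin n → ℕ) :
    φ (orderedMonomial x a) = orderedMonomial (fun i => φ (x i)) a := by
  simp [orderedMonomial, map_list_prod, List.map_ofFn, Function.comp_def]

theorem orderedMonomial_zero {A : Type*} [Monoid A] {n : ℕ} (x : Fin n → A) :
    orderedMonomial x 0 = 1 := by
  simp [orderedMonomial]

theorem orderedMonomial_single {A : Type*} [Monoid A] {n : ℕ} (x : Fin n → A) (i : Fin n) :
    orderedMonomial x (Pi.single i 1) = x i := by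
  have key : ∀ {n : ℕ} (x : Fin n → A) (i : Fin n), orderedMonomial x (Pi.single i 1) = x i := by
    intro n
    induction n with
    | zero => exact fun x i => i.elim0
    | succ n ih =>
      intro x i
      refine Fin.cases ?_ (fun i => ?_) i
      · have : (Pi.single 0 1 : Fin (n + 1) → ℕ) = Fin.cons 1 0 := by
          funext j
          refine Fin.cases ?_ (fun j => ?_) j <;> simp
        rw [this, orderedMonomial_cons, orderedMonomial_zero, pow_one, mul_one]
      · have : (Pi.single i.succ 1 : Fin (n + 1) → ℕ) = Fin.cons 0 (Pi.single i 1) := by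
          funext j
          refine Fin.cases ?_ (fun j => ?_) j
          · simp [Fin.succ_ne_zero]
          · simp [Pi.single_apply]
        rw [this, orderedMonomial_cons, ih, pow_zero, one_mul]
  exact key x i

variable {L : Type*} [LieRing L] [LieAlgebra ℂ L]

local notation "𝒰" => UniversalEnvelopingAlgebra ℂ L
local notation "ιU" => UniversalEnvelopingAlgebra.ι ℂ (L := L)

/-- The span of the products of at most `N` elements of the family `x` in `U(L)`. -/
def wordSpan {n : ℕ} (x : Fin n → L) (N : ℕ) : Submodule ℂ 𝒰 :=
  Submodule.span ℂ {u | ∃ l : List (Fin n), l.length ≤ N ∧ (l.map fun i => ιU (x i)).prod = u}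

theorem wordSpan_mono {n : ℕ} (x : Fin n → L) {N N' : ℕ} (h : N ≤ N') :
    wordSpan x N ≤ wordSpan x N' :=
  Submodule.span_mono fun _ ⟨l, hl, hu⟩ => ⟨l, hl.trans h, hu⟩

theorem mul_mem_wordSpan {n : ℕ} (x : Fin n → L) {N N' : ℕ} {a b : 𝒰} (ha : a ∈ wordSpan x N)
    (hb : b ∈ wordSpan x N') : a * b ∈ wordSpan x (N + N') := by
  have h := Submodule.mul_mem_mul ha hb
  rw [wordSpan, wordSpan, Submodule.span_mul_span] at h
  refine Submodule.span_mono ?_ h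
  rintro _ ⟨_, ⟨l, hl, rfl⟩, _, ⟨l', hl', rfl⟩, rfl⟩
  exact ⟨l ++ l', by rw [List.length_append]; lia, by simp⟩

theorem ι_mem_wordSpan {n : ℕ} {x : Fin n → L} (hx : Submodule.span ℂ (Set.range x) = ⊤) (y : L) :
    ιU y ∈ wordSpan x 1 := by
  have hy : y ∈ Submodule.span ℂ (Set.range x) := hx ▸ Submodule.mem_top
  induction hy using Submodule.span_induction with
  | mem y hy =>
    obtain ⟨i, rfl⟩ := hy
    exact Submodule.subset_span ⟨[i], by simp, by simp⟩
  | zero => rw [map_zero]; exact Submodule.zero_mem _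
  | add y z _ _ hy hz => rw [map_add]; exact Submodule.add_mem _ hy hz
  | smul c y _ hy => rw [map_smul]; exact Submodule.smul_mem _ c hy

/-- Swapping two adjacent letters changes a word by the same word with the pair replaced by its
bracket. The bracket is a combination of single letters, so the difference has length one less. This
lets words be sorted modulo shorter words. -/
theorem prod_sub_prod_mem_wordSpan {n : ℕ} {x : Fin n → L}
    (hx : Submodule.span ℂ (Set.range x) = ⊤) {l l' : List (Fin n)} (h : l.Perm l') :
    ∀ N, l.length ≤ N + 1 → (l.map fun i => ιU (x i)).prod - (l'.map fun i => ιU (x i)).prod ∈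
      wordSpan x N := by
  induction h with
  | nil => simp
  | @cons i l l' h ih =>
    intro N hN
    rw [List.map_cons, List.map_cons, List.prod_cons, List.prod_cons, ← mul_sub]
    cases N with
    | zero =>
      have h1 : l = [] := by simpa using hN
      subst h1
      have h2 : l' = [] := by simpa using h
      simp [h2]
    | succ N =>
      rw [add_comm N]
      refine mul_mem_wordSpan x (ι_mem_wordSpan hx _) (ih N ?_)
      simpa using hN
  | swap i j l =>
    intro N hN
    have h1 : ((j :: i :: l).map fun i => ιU (x i)).prod -
        ((i :: j :: l).map fun i => ιU (x i)).prod =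
        ιU ⁅x j, x i⁆ * (l.map fun i => ιU (x i)).prod := by
      rw [LieHom.map_lie, LieRing.of_associative_ring_bracket]
      simp only [List.map_cons, List.prod_cons]
      noncomm_ring
    rw [h1]
    refine wordSpan_mono x (N := 1 + l.length) (by simp at hN; lia) ?_
    exact mul_mem_wordSpan x (ι_mem_wordSpan hx _) (Submodule.subset_span ⟨l, le_rfl, rfl⟩)
  | trans h _ ih ih' =>
    intro N hN
    have := Submodule.add_mem _ (ih N hN) (ih' N (h.length_eq ▸ hN))
    rwa [sub_add_sub_cancel] at this

theorem exists_orderedMonomial_of_list {A : Type*} [Monoid A] {n : ℕ} (x : Fin n → A)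
    (l : List (Fin n)) :
    ∃ l' : List (Fin n), l.Perm l' ∧
      (l'.map x).prod = orderedMonomial x fun i => l.count i := by
  refine ⟨(List.ofFn fun i => List.replicate (l.count i) i).flatten, ?_, ?_⟩
  · refine List.perm_iff_count.2 fun i => ?_
    rw [List.count_flatten, List.map_ofFn, List.sum_ofFn]
    simp [List.count_replicate]
  · rw [List.map_flatten, List.prod_flatten, List.map_map, List.map_ofFn]
    simp [orderedMonomial, Function.comp_def]

/-- The ordered monomials in a spanning family of `L` span `U(L)`. -/
theorem span_orderedMonomial {n : ℕ} {x : Fin n → L} (hx : Submodule.span ℂ (Set.range x) = ⊤) :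
    Submodule.span ℂ (Set.range (orderedMonomial fun i => ιU (x i))) = ⊤ := by
  set S := Submodule.span ℂ (Set.range (orderedMonomial fun i => ιU (x i))) with hS
  have h0 (l : List (Fin n)) : orderedMonomial (fun i => ιU (x i)) (fun i => l.count i) ∈ S :=
    Submodule.subset_span ⟨_, rfl⟩
  have hword : ∀ N, wordSpan x N ≤ S := by
    intro N
    induction N with
    | zero =>
      refine Submodule.span_le.2 ?_
      rintro _ ⟨l, hl, rfl⟩
      have : l = [] := by simpa using hl
      subst this
      refine Submodule.subset_span ⟨0, ?_⟩
      simp [orderedMonomial]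
    | succ N ih =>
      refine Submodule.span_le.2 ?_
      rintro _ ⟨l, hl, rfl⟩
      obtain ⟨l', h1, h2⟩ := exists_orderedMonomial_of_list (fun i => ιU (x i)) l
      have h3 := ih (prod_sub_prod_mem_wordSpan hx h1 N hl)
      rw [h2] at h3
      simpa using Submodule.add_mem _ h3 (h0 l)
  refine eq_top_iff.2 fun u hu => ?_
  clear hu
  suffices h : ∃ N, u ∈ wordSpan x N by
    obtain ⟨N, hN⟩ := h
    exact hword N hN
  induction u using env_induction with
  | h1 c =>
    refine ⟨0, ?_⟩
    rw [Algebra.algebraMap_eq_smul_one]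
    exact Submodule.smul_mem _ _ (Submodule.subset_span ⟨[], by simp, by simp⟩)
  | h2 y => exact ⟨1, ι_mem_wordSpan hx y⟩
  | h3 a b ha hb =>
    obtain ⟨N, hN⟩ := ha
    obtain ⟨N', hN'⟩ := hb
    exact ⟨_, mul_mem_wordSpan x hN hN'⟩
  | h4 a b ha hb =>
    obtain ⟨N, hN⟩ := ha
    obtain ⟨N', hN'⟩ := hb
    exact ⟨max N N', Submodule.add_mem _ (wordSpan_mono x (le_max_left _ _) hN)
      (wordSpan_mono x (le_max_right _ _) hN')⟩

variable (L) in
/-- The coproduct of `U(L)`. -/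
def coproduct : 𝒰 →ₐ[ℂ] 𝒰 ⊗[ℂ] 𝒰 :=
  UniversalEnvelopingAlgebra.lift ℂ
    { toFun := fun x => ιU x ⊗ₜ 1 + 1 ⊗ₜ ιU x
      map_add' := fun x y => by
        simp only [map_add, TensorProduct.add_tmul, TensorProduct.tmul_add]; abel
      map_smul' := fun c x => by
        simp only [map_smul, TensorProduct.smul_tmul', TensorProduct.tmul_smul, smul_add,
          RingHom.id_apply]
      map_lie' := fun {x y} => by
        simp only [LieHom.map_lie, LieRing.of_associative_ring_bracket, mul_add, add_mul,
          Algebra.TensorProduct.tmul_mul_tmul, one_mul, mul_one, TensorProduct.sub_tmul,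
          TensorProduct.tmul_sub]
        abel }

theorem coproduct_ι (x : L) : coproduct L (ιU x) = ιU x ⊗ₜ 1 + 1 ⊗ₜ ιU x :=
  UniversalEnvelopingAlgebra.lift_ι_apply ..

variable (L) in
/-- The counit of `U(L)`. -/
def counit : 𝒰 →ₐ[ℂ] ℂ := UniversalEnvelopingAlgebra.lift ℂ 0

theorem counit_ι (x : L) : counit L (ιU x) = 0 := UniversalEnvelopingAlgebra.lift_ι_apply ..

/-- The divided ordered monomial `∏ xᵢ ^ aᵢ / aᵢ!`. -/
def dividedMonomial {n : ℕ} (x : Fin n → L) (a : Fin n → ℕ) : 𝒰 :=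
  (List.ofFn fun i => ((a i).factorial : ℂ)⁻¹ • ιU (x i) ^ a i).prod

theorem dividedMonomial_eq {n : ℕ} (x : Fin n → L) (a : Fin n → ℕ) :
    dividedMonomial x a =
      (∏ i, ((a i).factorial : ℂ)⁻¹) • orderedMonomial (fun i => ιU (x i)) a := by
  induction n with
  | zero => simp [dividedMonomial, orderedMonomial]
  | succ n ih =>
    have := ih (fun i => x i.succ) (fun i => a i.succ)
    simp only [dividedMonomial, orderedMonomial, List.ofFn_succ, List.prod_cons] at this ⊢
    rw [this, Fin.prod_univ_succ, mul_smul, smul_mul_assoc, mul_smul_comm]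

theorem dividedMonomial_cons {n : ℕ} (x : Fin (n + 1) → L) (k : ℕ) (a : Fin n → ℕ) :
    dividedMonomial x (Fin.cons k a) =
      ((k.factorial : ℂ)⁻¹ • ιU (x 0) ^ k) * dividedMonomial (fun i => x i.succ) a := by
  simp [dividedMonomial, List.ofFn_succ]

theorem dividedMonomial_zero {n : ℕ} (x : Fin n → L) : dividedMonomial x 0 = 1 := by
  simp [dividedMonomial]

theorem dividedMonomial_single {n : ℕ} (x : Fin n → L) (i : Fin n) :
    dividedMonomial x (Pi.single i 1) = ιU (x i) := by
  rw [dividedMonomial_eq, orderedMonomial_single, Finset.prod_eq_one, one_smul]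
  intro j _
  by_cases h : j = i
  · subst h; simp
  · simp [h]

theorem counit_dividedMonomial {n : ℕ} (x : Fin n → L) {a : Fin n → ℕ} (ha : a ≠ 0) :
    counit L (dividedMonomial x a) = 0 := by
  obtain ⟨i, hi⟩ := Function.ne_iff.1 ha
  rw [dividedMonomial_eq, map_smul, orderedMonomial, map_list_prod, List.map_ofFn,
    List.prod_eq_zero, smul_zero]
  refine (List.mem_ofFn' _ _).2 ⟨i, ?_⟩
  change counit L (ιU (x i) ^ a i) = 0
  rw [map_pow, counit_ι, zero_pow hi]

/-- The two summands of the coproduct of x commute, so this is the binomial formula. Dividing by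
factorials is what turns every binomial coefficient into 1. -/
theorem coproduct_pow (x : L) (k : ℕ) :
    coproduct L ((k.factorial : ℂ)⁻¹ • ιU x ^ k) = ∑ j ∈ Finset.Iic k,
      (((j.factorial : ℂ)⁻¹ • ιU x ^ j) ⊗ₜ (((k - j).factorial : ℂ)⁻¹ • ιU x ^ (k - j)) :
        𝒰 ⊗[ℂ] 𝒰) := by
  have hc : Commute (ιU x ⊗ₜ 1 : 𝒰 ⊗[ℂ] 𝒰) (1 ⊗ₜ ιU x) := by
    simp [Commute, SemiconjBy]
  rw [map_smul, map_pow, coproduct_ι, hc.add_pow, Finset.smul_sum, ← Nat.range_succ_eq_Iic]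
  refine Finset.sum_congr rfl fun j hj => ?_
  have hj : j ≤ k := by simpa [Nat.lt_succ_iff] using hj
  rw [Algebra.TensorProduct.tmul_pow, Algebra.TensorProduct.tmul_pow,
    Algebra.TensorProduct.tmul_mul_tmul, one_pow, one_pow, one_mul, mul_one,
    TensorProduct.smul_tmul_smul, ← nsmul_eq_mul', ← Nat.cast_smul_eq_nsmul ℂ, smul_smul]
  congr 1
  rw [Nat.cast_choose ℂ hj]
  have := Nat.factorial_ne_zero k
  field_simp

theorem coproduct_dividedMonomial {n : ℕ} (x : Fin n → L) (a : Fin n → ℕ) :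
    coproduct L (dividedMonomial x a) = ∑ b ∈ Finset.Iic a,
      (dividedMonomial x b ⊗ₜ dividedMonomial x (a - b) : 𝒰 ⊗[ℂ] 𝒰) := by
  induction n with
  | zero =>
    have : Finset.Iic a = {a} := by
      ext b; simp [Subsingleton.elim b a]
    rw [this]
    simp [dividedMonomial, Algebra.TensorProduct.one_def]
  | succ n ih =>
    obtain ⟨k, a, rfl⟩ : ∃ k a', a = Fin.cons k a' := ⟨a 0, Fin.tail a, (Fin.cons_self_tail a).symm⟩
    rw [dividedMonomial_cons, map_mul, coproduct_pow, ih, Finset.sum_mul_sum,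
      ← Finset.sum_product']
    refine Finset.sum_bij (fun p _ => Fin.cons p.1 p.2) ?_ ?_ ?_ ?_
    · rintro ⟨j, b⟩ h
      simp only [Finset.mem_product, Finset.mem_Iic] at h ⊢
      exact Fin.cons_le_cons.2 h
    · rintro ⟨j, b⟩ _ ⟨j', b'⟩ _ h
      simpa [Fin.cons_inj] using h
    · intro b hb
      refine ⟨(b 0, Fin.tail b), ?_, Fin.cons_self_tail b⟩
      simp only [Finset.mem_product, Finset.mem_Iic] at hb ⊢
      exact ⟨hb 0, fun i => hb i.succ⟩
    · rintro ⟨j, b⟩ _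
      have h1 : (Fin.cons k a - Fin.cons j b : Fin (n + 1) → ℕ) = Fin.cons (k - j) (a - b) := by
        funext i
        refine Fin.cases ?_ (fun i => ?_) i <;> simp
      rw [h1, dividedMonomial_cons, dividedMonomial_cons, Algebra.TensorProduct.tmul_mul_tmul]

/-- Induction on the degree through the coproduct. A relation of degree at most 1 is excluded by the
counit and by the embedding of L. For higher degree, independence in degree at most N supplies dual
functionals, and a product of two of them composed with the coproduct isolates the coefficient of
one monomial of degree at most N + 1. -/
theorem dividedMonomial_coeff_eq_zero {n : ℕ} {x : Fin n → L} (hx : LinearIndependent ℂ x)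
    (hι : Function.Injective ιU) (N : ℕ) :
    ∀ l : (Fin n → ℕ) →₀ ℂ, (∀ a ∈ l.support, ∑ i, a i ≤ N) →
      Finsupp.linearCombination ℂ (dividedMonomial x) l = 0 → l = 0 := by
  have hl0 (l : (Fin n → ℕ) →₀ ℂ) (hl : Finsupp.linearCombination ℂ (dividedMonomial x) l = 0) :
      l 0 = 0 := by
    have h := congrArg (counit L) hl
    rw [map_zero, Finsupp.linearCombination_apply, Finsupp.sum, map_sum,
      Finset.sum_eq_single 0] at h
    · simpa [dividedMonomial_zero] using h
    · intro a _ ha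
      rw [map_smul, counit_dividedMonomial x ha, smul_zero]
    · intro h0
      simp [Finsupp.notMem_support_iff.1 h0]
  have hdeg (a : Fin n → ℕ) (ha : ∑ i, a i ≤ 1) : a = 0 ∨ ∃ i, a = Pi.single i 1 := by
    by_cases h : a = 0
    · exact Or.inl h
    obtain ⟨i, hi⟩ := Function.ne_iff.1 h
    refine Or.inr ⟨i, funext fun j => ?_⟩
    have h1 := Finset.add_sum_erase Finset.univ a (Finset.mem_univ i)
    have hi' : a i ≠ 0 := hi
    by_cases hj : j = i
    · subst hj
      simp
      lia
    · have := Finset.single_le_sum (f := a) (fun _ _ => Nat.zero_le _)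
        (Finset.mem_erase.2 ⟨hj, Finset.mem_univ j⟩)
      simp [hj]
      lia
  have h1 (l : (Fin n → ℕ) →₀ ℂ) (hs : ∀ a ∈ l.support, ∑ i, a i ≤ 1)
      (hl : Finsupp.linearCombination ℂ (dividedMonomial x) l = 0) : l = 0 := by
    have hsum : Finsupp.linearCombination ℂ (dividedMonomial x) l =
        ∑ i, l (Pi.single i 1) • ιU (x i) := by
      rw [Finsupp.linearCombination_apply, Finsupp.sum]
      have hinj : Function.Injective fun i : Fin n => (Pi.single i 1 : Fin n → ℕ) := by
        intro i j hij
        by_contra hne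
        have := congrFun hij i
        simp [hne] at this
      rw [Finset.sum_subset (s₁ := l.support) (s₂ := l.support ∪
        Finset.univ.image fun i : Fin n => (Pi.single i 1 : Fin n → ℕ)) Finset.subset_union_left
        (fun a _ ha => by simp [Finsupp.notMem_support_iff.1 ha])]
      rw [← Finset.sum_subset (s₁ := Finset.univ.image fun i : Fin n =>
        (Pi.single i 1 : Fin n → ℕ)) Finset.subset_union_right, Finset.sum_image (fun _ _ _ _ h =>
          hinj h)]
      · simp [dividedMonomial_single]
      · intro a ha ha'
        have ha2 : a ∈ l.support := (Finset.mem_union.1 ha).resolve_right ha'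
        rcases hdeg a (hs a ha2) with rfl | ⟨i, rfl⟩
        · rw [hl0 l hl, zero_smul]
        · exact absurd (Finset.mem_image_of_mem _ (Finset.mem_univ i)) ha'
    have hl' := hl
    rw [hsum] at hl'
    have h2 : ιU (∑ i, l (Pi.single i 1) • x i) = 0 := by
      rw [← hl', map_sum]
      exact Finset.sum_congr rfl fun i _ => map_smul _ _ _
    have h3 := Fintype.linearIndependent_iff.1 hx _ ((map_eq_zero_iff _ hι).1 h2)
    ext a
    by_cases ha : a ∈ l.support
    · rcases hdeg a (hs a ha) with rfl | ⟨i, rfl⟩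
      · exact hl0 l hl
      · exact h3 i
    · simpa using ha
  induction N with
  | zero => exact fun l hs hl => h1 l (fun a ha => (hs a ha).trans zero_le_one) hl
  -- It is enough to show that no monomial of degree at least 2 occurs; the case of degree at most 1
  -- then finishes.
  | succ N ih =>
    intro l hs hl
    refine h1 l (fun a ha => ?_) hl
    by_contra hlt
    have hinj : Function.Injective (Finsupp.linearCombination ℂ
        fun a : {a : Fin n → ℕ // ∑ i, a i ≤ N} => dividedMonomial x a.1) := by
      rw [← LinearMap.ker_eq_bot, LinearMap.ker_eq_bot']
      intro c hc
      have h2 : Finsupp.linearCombination ℂ (dividedMonomial x)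
          (c.mapDomain Subtype.val) = 0 := by
        rw [Finsupp.linearCombination_mapDomain]
        exact hc
      have h3 := ih _ (fun a ha => by
        obtain ⟨b, _, rfl⟩ := Finset.mem_image.1 (Finsupp.mapDomain_support ha)
        exact b.2) h2
      exact Finsupp.mapDomain_injective Subtype.val_injective (h3.trans Finsupp.mapDomain_zero.symm)
    obtain ⟨Φ, hΦ⟩ := LinearMap.exists_leftInverse_of_injective _ (LinearMap.ker_eq_bot.2 hinj)
    let φ (b : {a : Fin n → ℕ // ∑ i, a i ≤ N}) : 𝒰 →ₗ[ℂ] ℂ := Finsupp.lapply b ∘ₗ Φ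
    have hφ (b : {a : Fin n → ℕ // ∑ i, a i ≤ N}) (a : Fin n → ℕ) (ha : ∑ i, a i ≤ N) :
        φ b (dividedMonomial x a) = if a = b then 1 else 0 := by
      have := DFunLike.congr_fun hΦ (Finsupp.single ⟨a, ha⟩ 1)
      simp only [LinearMap.comp_apply, Finsupp.linearCombination_single, one_smul,
        LinearMap.id_apply] at this
      simp [φ, this, Finsupp.single_apply, Subtype.ext_iff]
    have hane : a ≠ 0 := by
      rintro rfl
      simp at hlt
    obtain ⟨i, hi⟩ := Function.ne_iff.1 hane
    have hi : 1 ≤ a i := Nat.one_le_iff_ne_zero.2 hi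
    -- The monomial a is split as b + (a − b) with both parts nonzero, which is possible since a has
    -- degree at least 2. Both parts then have degree at most N, where the dual functionals are
    -- under control.
    set b : Fin n → ℕ := Pi.single i 1 with hb
    have hba : b ≤ a := by
      intro j
      by_cases hj : j = i
      · subst hj; simpa [hb] using hi
      · simp [hb, hj]
    have hbsum : ∑ i, b i = 1 := by simp [hb]
    have hsub (c d : Fin n → ℕ) (hcd : c ≤ d) : ∑ i, (d - c) i + ∑ i, c i = ∑ i, d i := by
      rw [← Finset.sum_add_distrib]
      exact Finset.sum_congr rfl fun j _ => Nat.sub_add_cancel (hcd j)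
    have haN := hs a ha
    have hb1 := hsub b a hba
    have hN1 : ∑ i, b i ≤ N := by lia
    have hN2 : ∑ i, (a - b) i ≤ N := by lia
    have hb0 : b ≠ 0 := by
      intro h0
      rw [h0] at hbsum
      simp at hbsum
    have hab0 : a - b ≠ 0 := by
      intro h0
      rw [h0] at hb1
      simp at hb1
      lia
    let Ψ : 𝒰 ⊗[ℂ] 𝒰 →ₗ[ℂ] ℂ :=
      LinearMap.mul' ℂ ℂ ∘ₗ TensorProduct.map (φ ⟨b, hN1⟩) (φ ⟨a - b, hN2⟩)
    have hΨ (d : Fin n → ℕ) (hd : ∑ i, d i ≤ N + 1) :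
        Ψ (coproduct L (dividedMonomial x d)) = if d = a then 1 else 0 := by
      rw [coproduct_dividedMonomial, map_sum]
      have hterm (c : Fin n → ℕ) (hc : c ≤ d) :
          Ψ (dividedMonomial x c ⊗ₜ dividedMonomial x (d - c)) =
            if c = b ∧ d = a then 1 else 0 := by
        have hcd := hsub c d hc
        simp only [Ψ, LinearMap.comp_apply, TensorProduct.map_tmul, LinearMap.mul'_apply]
        -- When c or d − c is zero, the other factor may have degree N + 1, and the functional on it
        -- is unknown. The functional on the trivial factor is 0 because b and a − b are nonzero, so
        -- these terms vanish anyway.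
        by_cases hc0 : c = 0
        · subst hc0
          rw [hφ _ 0 (by simp), if_neg (fun h => hb0 h.symm), zero_mul,
            if_neg (fun h => hb0 h.1.symm)]
        by_cases hdc0 : d - c = 0
        · rw [hdc0, hφ ⟨a - b, hN2⟩ 0 (by simp), if_neg (fun h => hab0 h.symm), mul_zero, if_neg]
          rintro ⟨rfl, rfl⟩
          exact hab0 hdc0
        have hpos (c : Fin n → ℕ) (hc : c ≠ 0) : 1 ≤ ∑ i, c i := by
          obtain ⟨j, hj⟩ := Function.ne_iff.1 hc
          exact (Nat.one_le_iff_ne_zero.2 hj).trans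
            (Finset.single_le_sum (f := c) (fun _ _ => Nat.zero_le _) (Finset.mem_univ j))
        have h4 := hpos c hc0
        have h5 := hpos _ hdc0
        rw [hφ _ c (by lia), hφ _ (d - c) (by lia)]
        by_cases hcb : c = b
        · subst hcb
          have : d - b = a - b ↔ d = a := by
            refine ⟨fun h => funext fun j => ?_, fun h => by rw [h]⟩
            have h6 := congrFun h j
            have h7 := hc j
            have h8 := hba j
            simp only [Pi.sub_apply] at h6
            lia
          simp [this]
        · simp [hcb]
      rw [Finset.sum_congr rfl fun c hc => hterm c (Finset.mem_Iic.1 hc)]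
      by_cases hda : d = a
      · subst hda
        simp [hba]
      · simp [hda]
    have h6 := congrArg (fun u => Ψ (coproduct L u)) hl
    simp only [map_zero] at h6
    rw [Finsupp.linearCombination_apply, Finsupp.sum, map_sum, map_sum,
      Finset.sum_congr rfl fun d hd => by rw [map_smul, map_smul, hΨ d (hs d hd)]] at h6
    simp only [smul_eq_mul, mul_ite, mul_one, mul_zero, Finset.sum_ite_eq', ha, if_true] at h6
    exact (Finsupp.mem_support_iff.1 ha) h6

/-- The ordered monomials in a linearly independent family of `L` are linearly independent in
`U(L)`, provided that `L` embeds into `U(L)`. -/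
theorem linearIndependent_orderedMonomial {n : ℕ} {x : Fin n → L} (hx : LinearIndependent ℂ x)
    (hι : Function.Injective ιU) :
    LinearIndependent ℂ (orderedMonomial fun i => ιU (x i)) := by
  have h1 : LinearIndependent ℂ (dividedMonomial x) := by
    rw [linearIndependent_iff]
    intro l hl
    exact dividedMonomial_coeff_eq_zero hx hι (l.support.sup fun a => ∑ i, a i) l
      (fun a ha => Finset.le_sup (f := fun a : Fin n → ℕ => ∑ i, a i) ha) hl
  have h2 (a : Fin n → ℕ) : (∏ i, ((a i).factorial : ℂ)⁻¹) ≠ 0 :=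
    Finset.prod_ne_zero_iff.2 fun i _ => inv_ne_zero (Nat.cast_ne_zero.2 (Nat.factorial_ne_zero _))
  have h3 := h1.units_smul fun a => (Units.mk0 _ (h2 a))⁻¹
  convert h3 using 1
  funext a
  rw [Pi.smul_apply', dividedMonomial_eq, Units.smul_def, smul_smul, Units.val_inv_eq_inv_val,
    Units.val_mk0, inv_mul_cancel₀ (h2 a), one_smul]

end PBW

/-! ### Finite-dimensional sl(2)-modules: integrality and symmetry of weights -/

section Sl2Modules

variable {L M : Type*} [LieRing L] [LieAlgebra ℂ L] [AddCommGroup M] [Module ℂ M]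
  [LieRingModule L M] [LieModule ℂ L M] {h e f : L}

open LieModule

/-- Apply e until the last nonzero vector; each step raises the weight by 2, and the weight reached
is a natural number. -/
theorem exists_primitive_of_eigenvector [FiniteDimensional ℂ M] (T : IsSl2Triple h e f) {a : ℂ}
    {v : M} (h0 : v ≠ 0) (hv : ⁅h, v⁆ = a • v) :
    ∃ j n : ℕ, a + 2 * j = n ∧ T.HasPrimitiveVectorWith ((toEnd ℂ L M e ^ j) v) (n : ℂ) := by
  have hv' : v ∈ (toEnd ℂ L M h).maxGenEigenspace a :=
    Module.End.genEigenspace_le_maximal _ a 1 (Module.End.mem_eigenspace_iff.2 hv)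
  obtain ⟨j, hj1, hj2⟩ := Nat.exists_not_and_succ_of_not_zero_of_exists
    (p := fun j => (toEnd ℂ L M e ^ j) v = 0) (by simpa using h0)
    (exists_pow_lie_e_eq_zero T hv')
  have P : T.HasPrimitiveVectorWith ((toEnd ℂ L M e ^ j) v) (a + 2 * j) :=
    ⟨hj1, T.lie_h_pow_toEnd_e hv j, by rw [IsSl2Triple.lie_e_pow_toEnd_e, hj2]⟩
  obtain ⟨n, hn⟩ := P.exists_nat
  exact ⟨j, n, hn, hn ▸ P⟩

theorem exists_int_of_eigenvector [FiniteDimensional ℂ M] (T : IsSl2Triple h e f) {a : ℂ}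
    {v : M} (h0 : v ≠ 0) (hv : ⁅h, v⁆ = a • v) : ∃ z : ℤ, a = z := by
  obtain ⟨j, n, hjn, _⟩ := exists_primitive_of_eigenvector T h0 hv
  exact ⟨n - 2 * j, by push_cast; linear_combination hjn⟩

/-- The weights of a finite-dimensional `sl(2)`-module are symmetric. -/
theorem exists_neg_eigenvector [FiniteDimensional ℂ M] (T : IsSl2Triple h e f) {a : ℂ}
    {v : M} (h0 : v ≠ 0) (hv : ⁅h, v⁆ = a • v) : ∃ w : M, w ≠ 0 ∧ ⁅h, w⁆ = (-a) • w := by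
  have key {h e f : L} (T : IsSl2Triple h e f) {a : ℂ} {v : M} {j n : ℕ} (hjn : a + 2 * j = n)
      (hle : j ≤ n) (P : T.HasPrimitiveVectorWith ((toEnd ℂ L M e ^ j) v) (n : ℂ)) :
      ∃ w : M, w ≠ 0 ∧ ⁅h, w⁆ = (-a) • w := by
    refine ⟨_, P.pow_toEnd_f_ne_zero_of_eq_nat rfl (Nat.sub_le n j), ?_⟩
    rw [P.lie_h_pow_toEnd_f, Nat.cast_sub hle]
    congr 1
    linear_combination hjn
  obtain ⟨j, n, hjn, P⟩ := exists_primitive_of_eigenvector T h0 hv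
  by_cases hle : j ≤ n
  -- Descending from weight n by n − j applications of f gives the weight n − 2(n − j) = −a. If j >
  -- n, then −a is positive, and the triple with e and f exchanged gives the inequality needed, by
  -- comparing the two equations.
  · exact key T hjn hle P
  · have hv' : ⁅-h, v⁆ = (-a) • v := by rw [neg_lie, hv, neg_smul]
    obtain ⟨j', n', hjn', P'⟩ := exists_primitive_of_eigenvector T.symm h0 hv'
    have h1 : ((2 * j + 2 * j' : ℕ) : ℂ) = (n + n' : ℕ) := by
      push_cast
      linear_combination hjn + hjn'
    have h2 := Nat.cast_injective h1
    obtain ⟨w, hw0, hw⟩ := key T.symm hjn' (by lia) P'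
    refine ⟨w, hw0, ?_⟩
    rw [neg_lie] at hw
    rw [← neg_neg ⁅h, w⁆, hw, neg_neg, neg_smul]

theorem isNilpotent_toEnd_e [FiniteDimensional ℂ M] (T : IsSl2Triple h e f) :
    IsNilpotent (toEnd ℂ L M e) := by
  rw [Module.End.isNilpotent_iff_of_finite]
  intro v
  have hv : v ∈ ⨆ a : ℂ, (toEnd ℂ L M h).eigenspace a :=
    (iSup_eigenspace_eq_top (M := M) T).symm ▸ Submodule.mem_top
  induction hv using Submodule.iSup_induction' with
  | mem a v hv =>
    exact exists_pow_lie_e_eq_zero T (Module.End.genEigenspace_le_maximal _ a 1 hv)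
  | zero => exact ⟨0, by simp⟩
  | add v w _ _ hv hw =>
    obtain ⟨m, hm⟩ := hv
    obtain ⟨n, hn⟩ := hw
    refine ⟨m + n, ?_⟩
    rw [map_add, pow_add, Module.End.mul_apply, Module.End.mul_apply, hn, map_zero, add_zero,
      ← Module.End.mul_apply, ← pow_add, add_comm, pow_add, Module.End.mul_apply, hm, map_zero]

end Sl2Modules

/-! ### Principal sl(2)-subalgebras: the centralizer of h is abelian -/

section Principal

variable {g : Type u} [LieRing g] [LieAlgebra ℂ g]

/-- The sum of all eigenspaces of `ad h` with positive real eigenvalue. -/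
def posPart (h : g) : Submodule ℂ g :=
  ⨆ r : {r : ℝ // 0 < r}, (LieAlgebra.ad ℂ g h).eigenspace ((r : ℝ) : ℂ)

theorem mem_cartan_iff {h x : g} : x ∈ cartan h ↔ ⁅h, x⁆ = 0 := by
  refine ⟨fun hx => hx h (mem_torus h), fun hx y hy => ?_⟩
  obtain ⟨c, rfl⟩ := Submodule.mem_span_singleton.1 hy
  rw [smul_lie, hx, smul_zero]

theorem cartan_eq_eigenspace (h : g) :
    (cartan h).toSubmodule = (LieAlgebra.ad ℂ g h).eigenspace 0 := by
  ext x
  rw [Module.End.mem_eigenspace_iff, zero_smul, LieAlgebra.ad_apply]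
  exact mem_cartan_iff

theorem posPart_le_nonnegPart (h : g) : posPart h ≤ (nonnegPart h).toSubmodule :=
  iSup_le fun r => le_iSup (fun r : {r : ℝ // 0 ≤ r} =>
    (LieAlgebra.ad ℂ g h).eigenspace ((r : ℝ) : ℂ)) ⟨r.1, r.2.le⟩

theorem cartan_le_nonnegPart (h : g) : cartan h ≤ nonnegPart h := by
  intro x hx
  refine Submodule.mem_iSup_of_mem ⟨0, le_rfl⟩ ?_
  rw [Module.End.mem_eigenspace_iff, LieAlgebra.ad_apply, mem_cartan_iff.1 hx]
  simp

theorem disjoint_cartan_posPart (h : g) : Disjoint (cartan h).toSubmodule (posPart h) := by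
  rw [cartan_eq_eigenspace]
  refine ((LieAlgebra.ad ℂ g h).eigenspaces_iSupIndep 0).mono_right (iSup_le fun r => ?_)
  exact le_iSup₂ (f := fun (a : ℂ) (_ : a ≠ 0) => (LieAlgebra.ad ℂ g h).eigenspace a)
    ((r : ℝ) : ℂ) (by simpa using r.2.ne')

theorem lie_mem_posPart {h e x : g} (he : ⁅h, e⁆ = (2 : ℂ) • e) (hx : x ∈ nonnegPart h) :
    ⁅e, x⁆ ∈ posPart h := by
  refine Submodule.iSup_induction _ (motive := fun x => ⁅e, x⁆ ∈ posPart h) hx ?_ ?_ ?_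
  · intro r x hx
    refine Submodule.mem_iSup_of_mem ⟨2 + r.1, by have := r.2; linarith⟩ ?_
    rw [Module.End.mem_eigenspace_iff, LieAlgebra.ad_apply] at hx ⊢
    rw [leibniz_lie, hx, he, smul_lie, lie_smul, ← add_smul]
    push_cast
    rfl
  · rw [lie_zero]
    exact Submodule.zero_mem _
  · intro a b ha hb
    rw [lie_add]
    exact Submodule.add_mem _ ha hb

/-- The automorphism is exp(s · ad f). It moves e, up to a scalar, to any nilpotent element of k
with nonzero e-coefficient. -/
theorem exists_lieEquiv_apply_e {h e f : g} (T : IsSl2Triple h e f)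
    (hf : IsNilpotent (LieAlgebra.ad ℂ g f)) (s : ℂ) :
    ∃ φ : g ≃ₗ⁅ℂ⁆ g, φ e = e - s • h - (s * s) • f := by
  -- The exponential of a nilpotent derivation is taken over ℚ, so the rational structure is
  -- restricted from ℂ.
  let : Module ℚ g := Module.compHom g (algebraMap ℚ ℂ)
  let : LieAlgebra ℚ g := { lie_smul := fun q x y => lie_smul (algebraMap ℚ ℂ q) x y }
  have hDeq : (LieDerivation.ad ℂ g (s • f)).toLinearMap = s • LieAlgebra.ad ℂ g f := by
    ext x
    simp
  have hD : IsNilpotent (LieDerivation.ad ℂ g (s • f)).toLinearMap := by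
    rw [hDeq]
    exact hf.smul s
  refine ⟨LieDerivation.exp _ hD, ?_⟩
  rw [LieDerivation.exp_map_apply]
  set D := (LieDerivation.ad ℂ g (s • f)).toLinearMap
  obtain ⟨n, hn⟩ := hD
  have hD1 : D e = -(s • h) := by
    rw [hDeq, LinearMap.smul_apply, LieAlgebra.ad_apply, ← lie_skew, T.lie_e_f, smul_neg]
  have hD2 : D (D e) = -((2 * (s * s)) • f) := by
    rw [hD1, map_neg, map_smul]
    rw [hDeq, LinearMap.smul_apply, LieAlgebra.ad_apply, ← lie_skew, T.lie_lie_smul_f ℂ, neg_neg, smul_smul, smul_smul]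
    congr 2
    ring
  have hD3 : D (D (D e)) = 0 := by
    rw [hD2, map_neg, map_smul]
    rw [hDeq, LinearMap.smul_apply, LieAlgebra.ad_apply, lie_self, smul_zero, smul_zero, neg_zero]
  -- The exponent is raised by 3 so that the exponential sum splits into its first three terms and a
  -- tail, and the tail vanishes on e because D³e = 0.
  have hn' : D ^ (n + 3) = 0 := by rw [pow_add, hn, zero_mul]
  rw [IsNilpotent.exp_eq_sum hn', LinearMap.sum_apply, add_comm n 3, Finset.sum_range_add,
    Finset.sum_eq_zero (s := Finset.range n), add_zero]
  · have hq (q : ℚ) (x : g) : q • x = (q : ℂ) • x := rfl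
    simp only [Finset.sum_range_succ, Finset.sum_range_zero, LinearMap.smul_apply, hq, pow_succ,
      pow_zero, one_mul, Module.End.mul_apply, Module.End.one_apply, hD2, zero_add]
    simp only [Nat.factorial, hD1]
    push_cast
    module
  · intro i _
    rw [LinearMap.smul_apply, add_comm 3 i, pow_add, Module.End.mul_apply]
    have : (D ^ 3) e = 0 := by simpa [pow_succ] using hD3
    rw [this, map_zero, smul_zero]

variable [FiniteDimensional ℂ g]

/-- The map ad e carries the nonnegative part of g into the positive part. The former exceeds the
latter in dimension by at least that of the zero eigenspace of ad h, so the kernel of ad e is at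
least that large. -/
theorem finrank_cartan_le_finrank_centralizer {h e f : g} (T : IsSl2Triple h e f) :
    Module.finrank ℂ (cartan h) ≤ Module.finrank ℂ (centralizer {e}) := by
  let φ : nonnegPart h →ₗ[ℂ] posPart h := (LieAlgebra.ad ℂ g e).restrict
    (p := (nonnegPart h).toSubmodule) fun x hx => lie_mem_posPart (T.lie_h_e_smul ℂ) hx
  have h1 := φ.finrank_range_add_finrank_ker
  have h2 := φ.range.finrank_le
  have h3 : Module.finrank ℂ (cartan h) + Module.finrank ℂ (posPart h) ≤
      Module.finrank ℂ (nonnegPart h) := by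
    have h4 := Submodule.finrank_sup_add_finrank_inf_eq (cartan h).toSubmodule (posPart h)
    rw [(disjoint_cartan_posPart h).eq_bot, finrank_bot, add_zero] at h4
    refine h4.symm.le.trans (Submodule.finrank_mono ?_)
    exact sup_le (cartan_le_nonnegPart h) (posPart_le_nonnegPart h)
  have h5 : Module.finrank ℂ φ.ker ≤ Module.finrank ℂ (centralizer {e}) := by
    have h6 := (φ.ker.equivMapOfInjective (nonnegPart h).toSubmodule.subtype
      (nonnegPart h).toSubmodule.injective_subtype).finrank_eq
    refine h6.le.trans (Submodule.finrank_mono (t := (centralizer {e}).toSubmodule) ?_)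
    rintro _ ⟨x, hx, rfl⟩ y rfl
    exact congrArg Subtype.val hx
  lia

theorem finrank_centralizer_le_of_lieEquiv (φ : g ≃ₗ⁅ℂ⁆ g) (x : g) (c : ℂ) :
    Module.finrank ℂ (centralizer {x}) ≤ Module.finrank ℂ (centralizer {c • φ x}) := by
  have h1 := φ.toLinearEquiv.finrank_map_eq (centralizer {x}).toSubmodule
  refine h1.symm.le.trans (Submodule.finrank_mono (t := (centralizer {c • φ x}).toSubmodule) ?_)
  rintro _ ⟨y, hy, rfl⟩ z rfl
  change ⁅c • φ x, φ y⁆ = 0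
  rw [smul_lie, ← LieEquiv.map_lie, hy x rfl, map_zero, smul_zero]

/-- The given regular nilpotent is an arbitrary element of k, not e itself. Nilpotency puts x on the
cone b² + ac = 0, where x is either a multiple of f or a multiple of an automorphic image of e, and
the bound for e or f transfers. -/
theorem finrank_cartan_le_of_isNilpotent {h e f : g} (T : IsSl2Triple h e f) {x : g}
    (hx : x ∈ T.toLieSubalgebra ℂ) (hn : IsNilpotent (LieAlgebra.ad ℂ g x)) :
    Module.finrank ℂ (cartan h) ≤ Module.finrank ℂ (centralizer {x}) := by
  obtain ⟨a, c, b, hx⟩ := IsSl2Triple.mem_toLieSubalgebra_iff.1 hx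
  rw [T.lie_e_f] at hx
  have hxh : ⁅x, h⁆ = (-(2 * a)) • e + (2 * c) • f := by
    rw [hx, add_lie, add_lie, smul_lie, smul_lie, smul_lie, lie_self, ← lie_skew e h,
      ← lie_skew f h, T.lie_h_e_smul ℂ, T.lie_lie_smul_f ℂ]
    module
  have hxe : ⁅x, e⁆ = (2 * b) • e - c • h := by
    rw [hx, add_lie, add_lie, smul_lie, smul_lie, smul_lie, lie_self, ← lie_skew f e,
      T.lie_h_e_smul ℂ, T.lie_e_f]
    module
  have hxf : ⁅x, f⁆ = a • h - (2 * b) • f := by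
    rw [hx, add_lie, add_lie, smul_lie, smul_lie, smul_lie, lie_self, T.lie_lie_smul_f ℂ,
      T.lie_e_f]
    module
  have hq : b * b + a * c = 0 := by
    by_contra hq
    obtain ⟨n, hn⟩ := hn
    -- On k, ad x has the eigenvalues 0 and ±2√(b² + ac). If b² + ac ≠ 0, nilpotency forces [x, h] =
    -- 0, so a = c = 0 and x = bh; but then e is an eigenvector of ad x with the nonzero eigenvalue
    -- 2b.
    have h2 : ⁅x, ⁅x, ⁅x, h⁆⁆⁆ = (4 * (b * b + a * c)) • ⁅x, h⁆ := by
      have h1 : ⁅x, ⁅x, h⁆⁆ = (4 * (b * b + a * c)) • h - (4 * b) • x := by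
        rw [hxh, lie_add, lie_smul, lie_smul, hxe, hxf]
        simp only [hx]
        module
      rw [h1, lie_sub, lie_smul, lie_smul, lie_self, smul_zero, sub_zero]
    have h3 (k : ℕ) : (LieAlgebra.ad ℂ g x ^ (2 * k)) ⁅x, h⁆ =
        (4 * (b * b + a * c)) ^ k • ⁅x, h⁆ := by
      induction k with
      | zero => simp
      | succ k ih =>
        rw [mul_add, mul_one, pow_add, Module.End.mul_apply, pow_two, Module.End.mul_apply,
          LieAlgebra.ad_apply, LieAlgebra.ad_apply, h2, map_smul, ih, smul_smul, pow_succ, mul_comm]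
    have h4 := h3 n
    rw [two_mul, pow_add, hn, zero_mul, LinearMap.zero_apply] at h4
    have h5 : ⁅x, h⁆ = 0 :=
      (smul_eq_zero.1 h4.symm).resolve_left (pow_ne_zero _ (mul_ne_zero (by norm_num) hq))
    have h6 : ⁅h, ⁅x, h⁆⁆ = 0 := by rw [h5, lie_zero]
    rw [hxh] at h5
    rw [hxh, lie_add, lie_smul, lie_smul, T.lie_h_e_smul ℂ, T.lie_lie_smul_f ℂ] at h6
    have h7 : a • e = 0 := by
      linear_combination (norm := module) (-(1 / 4) : ℂ) • h5 + (-(1 / 8) : ℂ) • h6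
    have h8 : c • f = 0 := by
      linear_combination (norm := module) (1 / 4 : ℂ) • h5 + (-(1 / 8) : ℂ) • h6
    have ha : a = 0 := (smul_eq_zero.1 h7).resolve_right T.e_ne_zero
    have hc : c = 0 := (smul_eq_zero.1 h8).resolve_right T.f_ne_zero
    have h9 (k : ℕ) : (LieAlgebra.ad ℂ g x ^ k) e = (2 * b) ^ k • e := by
      induction k with
      | zero => simp
      | succ k ih =>
        rw [pow_succ, Module.End.mul_apply, LieAlgebra.ad_apply, hxe, hc, zero_smul, sub_zero,
          map_smul, ih, smul_smul, pow_succ, mul_comm]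
    have h10 := h9 n
    rw [hn, LinearMap.zero_apply] at h10
    have h11 := eq_zero_of_pow_eq_zero ((smul_eq_zero.1 h10.symm).resolve_right T.e_ne_zero)
    refine hq ?_
    rw [ha]
    linear_combination (b / 2) * h11
  by_cases ha : a = 0
  · have hb : b = 0 := by simpa [ha] using hq
    have h1 := finrank_cartan_le_finrank_centralizer T.symm
    have h2 : cartan (-h) = cartan h := by
      ext y
      rw [mem_cartan_iff, mem_cartan_iff, neg_lie, neg_eq_zero]
    rw [h2] at h1
    refine h1.trans (Submodule.finrank_mono (s := (centralizer {f}).toSubmodule)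
      (t := (centralizer {x}).toSubmodule) ?_)
    rintro y hy z rfl
    rw [hx, ha, hb, zero_smul, zero_smul, zero_add, add_zero, smul_lie, hy f rfl, smul_zero]
  -- The parameter s = −b/a matches the h-coefficient of x/a; the f-coefficient then agrees because
  -- c = −b²/a.
  · obtain ⟨φ, hφ⟩ := exists_lieEquiv_apply_e T (isNilpotent_toEnd_e (M := g) T.symm) (-(b / a))
    have h1 : x = a • φ e := by
      have hc : c = -(b * b) / a := by
        field_simp
        linear_combination hq
      rw [hφ, hx, hc]
      match_scalars <;> field_simp
    rw [h1]
    exact (finrank_cartan_le_finrank_centralizer T).trans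
      (finrank_centralizer_le_of_lieEquiv φ e a)

/-- Since ad h is diagonalizable, its generalized null space is its null space. -/
theorem engel_eq_cartan {h e f : g} (T : IsSl2Triple h e f) :
    LieSubalgebra.engel ℂ h = cartan h := by
  apply LieSubalgebra.toSubmodule_injective
  refine le_antisymm ?_ ?_
  · intro x hx
    have hx1 : x ∈ (LieAlgebra.ad ℂ g h).maxGenEigenspace 0 := hx
    have hx2 : x ∈ ⨆ a : ℂ, (LieAlgebra.ad ℂ g h).eigenspace a :=
      (iSup_eigenspace_eq_top (M := g) T).symm ▸ Submodule.mem_top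
    rw [iSup_split_single _ 0] at hx2
    obtain ⟨y, hy, z, hz, rfl⟩ := Submodule.mem_sup.1 hx2
    have hy' := Module.End.genEigenspace_le_maximal (LieAlgebra.ad ℂ g h) 0 1 hy
    have hz1 : z ∈ (LieAlgebra.ad ℂ g h).maxGenEigenspace 0 := by
      simpa using Submodule.sub_mem _ hx1 hy'
    have hz2 : z ∈ ⨆ (a : ℂ) (_ : a ≠ 0), (LieAlgebra.ad ℂ g h).maxGenEigenspace a :=
      iSup₂_mono (fun a _ => Module.End.genEigenspace_le_maximal (LieAlgebra.ad ℂ g h) a 1) hz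
    have hz0 := Submodule.disjoint_def.1
      ((LieAlgebra.ad ℂ g h).independent_maxGenEigenspace 0) z hz1 hz2
    rw [hz0, add_zero, cartan_eq_eigenspace]
    exact hy
  · rw [cartan_eq_eigenspace]
    exact Module.End.genEigenspace_le_maximal _ 0 1

variable [LieAlgebra.IsSimple ℂ g]

/-- Regularity bounds the dimension of the Engel subalgebra of h by the rank, the least dimension of
an Engel subalgebra. A minimal Engel subalgebra is a Cartan subalgebra, and Cartan subalgebras of a
simple Lie algebra in characteristic zero are abelian. The principal hypothesis enters the theorem
only here. -/
theorem lie_eq_zero_of_mem_cartan {h e f : g} (T : IsSl2Triple h e f)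
    (hT : ContainsRegularNilpotent (T.toLieSubalgebra ℂ)) {x y : g} (hx : x ∈ cartan h)
    (hy : y ∈ cartan h) : ⁅x, y⁆ = 0 := by
  obtain ⟨z, hz, hz1, hz2⟩ := hT
  have hrank : Module.finrank ℂ (LieSubalgebra.engel ℂ h) ≤ LieAlgebra.rank ℂ g := by
    rw [engel_eq_cartan T, ← hz2]
    exact finrank_cartan_le_of_isNilpotent T hz hz1
  have hC : (LieSubalgebra.engel ℂ h).IsCartanSubalgebra := by
    refine ⟨?_, LieSubalgebra.normalizer_engel _ _⟩
    -- By Engel's theorem, nilpotency means being contained in the Engel subalgebra of each of its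
    -- elements. Minimality among these upgrades to being the least one.
    apply LieSubalgebra.isNilpotent_of_forall_le_engel
    intro y hy
    set Ex : {LieSubalgebra.engel ℂ z | z ∈ LieSubalgebra.engel ℂ h} :=
      ⟨LieSubalgebra.engel ℂ h, h, LieSubalgebra.self_mem_engel _ _, rfl⟩
    suffices IsBot Ex from @this ⟨LieSubalgebra.engel ℂ y, y, hy, rfl⟩
    refine LieAlgebra.engel_isBot_of_isMin
      (Cardinal.natCast_le_aleph0.trans (Cardinal.infinite_iff.mp inferInstance))
      (LieSubalgebra.engel ℂ h) Ex le_rfl ?_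
    rintro ⟨_, y, hy, rfl⟩ hyx
    suffices LieSubalgebra.engel ℂ y = LieSubalgebra.engel ℂ h from this.ge
    apply LieSubalgebra.toSubmodule_injective
    exact Submodule.eq_of_le_of_finrank_le hyx
      (hrank.trans (LieAlgebra.rank_le_finrank_engel ℂ y))
  have hab : IsLieAbelian (LieSubalgebra.engel ℂ h) :=
    LieAlgebra.IsKilling.instIsLieAbelianOfIsCartanSubalgebra ..
  rw [← engel_eq_cartan T] at hx hy
  exact congrArg Subtype.val (hab.trivial ⟨x, hx⟩ ⟨y, hy⟩)

end Principal

/-! ### The decomposition g = ℂe ⊕ (n̄ ∩ k^⊥) ⊕ b -/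

section Structure

theorem exists_eigenbasis {N : Type*} [AddCommGroup N] [Module ℂ N] [FiniteDimensional ℂ N]
    {D : Module.End ℂ N} (hD : ⨆ a : ℂ, D.eigenspace a = ⊤) :
    ∃ (r : ℕ) (b : Module.Basis (Fin r) ℂ N) (w : Fin r → ℂ), ∀ i, D (b i) = w i • b i := by
  have hs : ⊤ ≤ Submodule.span ℂ {v | ∃ a : ℂ, D v = a • v} := by
    rw [← hD]
    refine iSup_le fun a v hv => Submodule.subset_span ⟨a, ?_⟩
    exact Module.End.mem_eigenspace_iff.1 hv
  let b0 := Module.Basis.ofSpan hs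
  have : Finite ((linearIndepOn_empty ℂ id).extend
      (Set.empty_subset {v | ∃ a : ℂ, D v = a • v})) := Module.Finite.finite_basis b0
  let e := Finite.equivFin ((linearIndepOn_empty ℂ id).extend
      (Set.empty_subset {v | ∃ a : ℂ, D v = a • v}))
  have hb (i) : ∃ a : ℂ, D (b0.reindex e i) = a • b0.reindex e i := by
    rw [Module.Basis.reindex_apply]
    exact Module.Basis.ofSpan_subset hs ⟨_, rfl⟩
  choose w hw using hb
  exact ⟨_, b0.reindex e, w, hw⟩

theorem iSup_eigenspace_restrict {N : Type*} [AddCommGroup N] [Module ℂ N]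
    [FiniteDimensional ℂ N] {D : Module.End ℂ N} (hD : ⨆ a : ℂ, D.eigenspace a = ⊤)
    (p : Submodule ℂ N) (hp : ∀ x ∈ p, D x ∈ p) : 
    ⨆ a : ℂ, Module.End.eigenspace (D.restrict hp) a = ⊤ :=
  Module.End.genEigenspace_restrict_eq_top hp hD

variable {g : Type u} [LieRing g] [LieAlgebra ℂ g]

/-- A bracket of two vectors of weight zero vanishes by commutativity, and every other bracket of
eigenvectors has positive weight. Conversely an eigenvector of nonzero eigenvalue is a multiple of
its bracket with h. -/
theorem commutator_nonnegPart {h : g} (hab : ∀ x ∈ cartan h, ∀ y ∈ cartan h, ⁅x, y⁆ = 0) :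
    commutator (nonnegPart h) = posPart h := by
  refine le_antisymm (Submodule.span_le.2 ?_) (iSup_le ?_)
  · rintro _ ⟨x, hx, y, hy, rfl⟩
    refine Submodule.iSup_induction _ (motive := fun x => ⁅x, y⁆ ∈ posPart h) hx ?_ ?_ ?_
    · intro r x hx
      refine Submodule.iSup_induction _ (motive := fun y => ⁅x, y⁆ ∈ posPart h) hy ?_ ?_ ?_
      · intro s y hy
        rw [Module.End.mem_eigenspace_iff, LieAlgebra.ad_apply] at hx hy
        rcases (add_nonneg r.2 s.2).eq_or_lt with h0 | h0
        · have hr : r.1 = 0 := by have := r.2; have := s.2; linarith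
          have hs : s.1 = 0 := by have := r.2; have := s.2; linarith
          rw [hab x (mem_cartan_iff.2 (by rw [hx, hr]; simp)) y
            (mem_cartan_iff.2 (by rw [hy, hs]; simp))]
          exact Submodule.zero_mem _
        · refine Submodule.mem_iSup_of_mem ⟨r.1 + s.1, h0⟩ ?_
          rw [Module.End.mem_eigenspace_iff, LieAlgebra.ad_apply, leibniz_lie, hx, hy, smul_lie,
            lie_smul, ← add_smul]
          push_cast
          rfl
      · rw [lie_zero]
        exact Submodule.zero_mem _
      · intro a b ha hb
        rw [lie_add]
        exact Submodule.add_mem _ ha hb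
    · rw [zero_lie]
      exact Submodule.zero_mem _
    · intro a b ha hb
      rw [add_lie]
      exact Submodule.add_mem _ ha hb
  · rintro r x hx
    have hxn : x ∈ nonnegPart h := posPart_le_nonnegPart h (Submodule.mem_iSup_of_mem r hx)
    have hr : ((r : ℝ) : ℂ) ≠ 0 := by simpa using r.2.ne'
    rw [Module.End.mem_eigenspace_iff, LieAlgebra.ad_apply] at hx
    have hx' : x = (((r : ℝ) : ℂ)⁻¹) • ⁅h, x⁆ := by rw [hx, smul_smul, inv_mul_cancel₀ hr, one_smul]
    rw [hx']
    refine Submodule.smul_mem _ _ (Submodule.subset_span ⟨h, ?_, x, hxn, rfl⟩)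
    exact cartan_le_nonnegPart h (mem_cartan_iff.2 (lie_self h))

theorem cartan_neg (h : g) : cartan (-h) = cartan h := by
  ext y
  rw [mem_cartan_iff, mem_cartan_iff, neg_lie, neg_eq_zero]

theorem eigenspace_ad_neg (h : g) (a : ℂ) :
    (LieAlgebra.ad ℂ g (-h)).eigenspace a = (LieAlgebra.ad ℂ g h).eigenspace (-a) := by
  ext x
  rw [Module.End.mem_eigenspace_iff, Module.End.mem_eigenspace_iff, LieAlgebra.ad_apply,
    LieAlgebra.ad_apply, neg_lie, neg_smul, neg_eq_iff_eq_neg]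

theorem disjoint_posPart_nonnegPart_neg (h : g) :
    Disjoint (posPart h) (nonnegPart (-h)).toSubmodule := by
  have h1 := (LieAlgebra.ad ℂ g h).eigenspaces_iSupIndep.disjoint_biSup_biSup
    (s := {a : ℂ | 0 < a.re}) (t := {a : ℂ | a.re ≤ 0})
    (Set.disjoint_left.2 fun a ha hb => absurd (show 0 < a.re from ha) (not_lt.2 hb))
  refine h1.mono (iSup_le fun r => ?_) (iSup_le fun r => ?_)
  · exact le_iSup₂ (f := fun (a : ℂ) (_ : a ∈ {a : ℂ | 0 < a.re}) =>
      (LieAlgebra.ad ℂ g h).eigenspace a) ((r : ℝ) : ℂ) (by simpa using r.2)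
  · rw [eigenspace_ad_neg]
    exact le_iSup₂ (f := fun (a : ℂ) (_ : a ∈ {a : ℂ | a.re ≤ 0}) =>
      (LieAlgebra.ad ℂ g h).eigenspace a) (-((r : ℝ) : ℂ)) (by simpa using r.2)

variable {h e f : g}

theorem e_mem_posPart (T : IsSl2Triple h e f) : e ∈ posPart h := by
  refine Submodule.mem_iSup_of_mem ⟨2, two_pos⟩ ?_
  rw [Module.End.mem_eigenspace_iff, LieAlgebra.ad_apply, T.lie_h_e_smul ℂ]
  simp

theorem killingForm_eq_zero_of_mem_eigenspace {a b : ℂ} (hab : a + b ≠ 0) {x y : g}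
    (hx : ⁅h, x⁆ = a • x) (hy : ⁅h, y⁆ = b • y) : killingForm ℂ g x y = 0 := by
  have h1 := LieModule.traceForm_apply_lie_apply ℂ g g x h y
  have h2 : killingForm ℂ g ⁅x, h⁆ y = killingForm ℂ g x ⁅h, y⁆ := h1
  rw [← lie_skew, hx, hy, map_neg, map_smul, map_smul, LinearMap.neg_apply,
    LinearMap.smul_apply, smul_eq_mul, smul_eq_mul] at h2
  refine (mul_eq_zero.1 (?_ : (a + b) * _ = 0)).resolve_left hab
  linear_combination -h2

theorem killingForm_eq_zero_of_mem_posPart {a : ℝ} (ha : 0 ≤ a) {x y : g}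
    (hx : ⁅h, x⁆ = (a : ℂ) • x) (hy : y ∈ posPart h) : killingForm ℂ g x y = 0 := by
  refine Submodule.iSup_induction _ (motive := fun y => killingForm ℂ g x y = 0) hy ?_ ?_ ?_
  · intro r y hy
    refine killingForm_eq_zero_of_mem_eigenspace ?_ hx (Module.End.mem_eigenspace_iff.1 hy)
    have := r.2
    rw [← Complex.ofReal_add]
    exact Complex.ofReal_ne_zero.2 (by linarith)
  · exact map_zero _
  · intro y z hy hz
    rw [map_add, hy, hz, add_zero]

/-- By invariance the Killing form pairs only opposite eigenspaces of ad h, so a vector of positive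
weight is automatically orthogonal to e and h, and only f imposes a condition. -/
theorem mem_nbarPerp_iff (T : IsSl2Triple h e f)
    (hab : ∀ x ∈ cartan h, ∀ y ∈ cartan h, ⁅x, y⁆ = 0) {x : g} :
    x ∈ nbarPerp T ↔ x ∈ posPart h ∧ killingForm ℂ g f x = 0 := by
  have h0 : x ∈ nbarPerp T ↔ x ∈ commutator (borelBar h) ∧
    x ∈ (killingForm ℂ g).orthogonal (T.toLieSubalgebra ℂ).toSubmodule := Iff.rfl
  rw [h0, borelBar, commutator_nonnegPart hab]
  refine and_congr_right fun hx => ?_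
  rw [LinearMap.BilinForm.mem_orthogonal_iff]
  refine ⟨fun h1 => h1 f (Submodule.subset_span (by simp)), fun h1 y hy => ?_⟩
  obtain ⟨a, c, b, rfl⟩ := IsSl2Triple.mem_toLieSubalgebra_iff.1 hy
  have he := killingForm_eq_zero_of_mem_posPart (a := 2) zero_le_two
    (by rw [T.lie_h_e_smul ℂ]; simp) hx
  have hh := killingForm_eq_zero_of_mem_posPart (x := h) (a := 0) le_rfl (by simp) hx
  change killingForm ℂ g _ x = 0
  simp only [map_add, map_smul, LinearMap.add_apply, LinearMap.smul_apply, T.lie_e_f, h1, he, hh,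
    smul_zero, add_zero]

variable [FiniteDimensional ℂ g]

theorem posPart_sup_nonnegPart_neg (T : IsSl2Triple h e f) :
    posPart h ⊔ (nonnegPart (-h)).toSubmodule = ⊤ := by
  refine eq_top_iff.2 ?_
  rw [← iSup_eigenspace_eq_top (M := g) T]
  refine iSup_le fun a x hx => ?_
  by_cases hx0 : x = 0
  · rw [hx0]
    exact Submodule.zero_mem _
  obtain ⟨z, rfl⟩ := exists_int_of_eigenvector T hx0 (Module.End.mem_eigenspace_iff.1 hx)
  rcases lt_or_ge 0 z with hz | hz
  · refine Submodule.mem_sup_left (Submodule.mem_iSup_of_mem ⟨z, by exact_mod_cast hz⟩ ?_)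
    simpa using hx
  · refine Submodule.mem_sup_right (Submodule.mem_iSup_of_mem ⟨-z, ?_⟩ ?_)
    · rw [le_neg, neg_zero]
      exact_mod_cast hz
    · rw [eigenspace_ad_neg]
      simpa using hx

/-- By invariance κ(h, h) = 2κ(f, e), and κ(h, h) is the sum of the squares of the eigenvalues of ad
h. These are integers, so the sum vanishes only if ad h = 0, which contradicts [h, e] = 2e. -/
theorem killingForm_f_e_ne_zero (T : IsSl2Triple h e f) : killingForm ℂ g f e ≠ 0 := by
  intro h0
  have h1 : killingForm ℂ g h h = 0 := by
    have h2 : killingForm ℂ g ⁅f, e⁆ h = killingForm ℂ g f ⁅e, h⁆ :=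
      LieModule.traceForm_apply_lie_apply ℂ g g f e h
    rw [← lie_skew, T.lie_e_f, ← lie_skew e h, T.lie_h_e_smul ℂ, map_neg, map_neg, map_smul, h0,
      LinearMap.neg_apply, smul_zero] at h2
    exact neg_injective h2
  obtain ⟨r, b, w, hw⟩ := exists_eigenbasis (iSup_eigenspace_eq_top (M := g) T)
  have h3 : killingForm ℂ g h h = ∑ i, w i * w i := by
    rw [killingForm_apply_apply, LinearMap.trace_eq_matrix_trace ℂ b, Matrix.trace]
    refine Finset.sum_congr rfl fun i _ => ?_
    rw [Matrix.diag_apply, LinearMap.toMatrix_apply, LinearMap.comp_apply]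
    have h4 : LieAlgebra.ad ℂ g h (b i) = w i • b i := hw i
    rw [h4, map_smul, h4, map_smul, map_smul, Finsupp.smul_apply, Finsupp.smul_apply,
      Module.Basis.repr_self, Finsupp.single_eq_same, smul_eq_mul, smul_eq_mul, mul_one]
  have hz (i) : ∃ z : ℤ, w i = z := exists_int_of_eigenvector T (b.ne_zero i) (hw i)
  choose z hz using hz
  rw [h1] at h3
  simp only [hz] at h3
  have h5 : ∑ i, z i * z i = 0 := by exact_mod_cast h3.symm
  have h6 (i) : z i = 0 := by
    have := (Finset.sum_eq_zero_iff_of_nonneg fun i _ => mul_self_nonneg (z i)).1 h5 i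
      (Finset.mem_univ i)
    simpa using this
  have h7 : LieAlgebra.ad ℂ g h = 0 := by
    refine b.ext fun i => ?_
    have h4 : LieAlgebra.ad ℂ g h (b i) = w i • b i := hw i
    rw [h4, hz, h6, Int.cast_zero, zero_smul, LinearMap.zero_apply]
  have h8 := DFunLike.congr_fun h7 e
  rw [LieAlgebra.ad_apply, T.lie_h_e_smul ℂ, LinearMap.zero_apply] at h8
  exact T.e_ne_zero ((smul_eq_zero.1 h8).resolve_left two_ne_zero)

/-- A basis of `n̄ ∩ k^⊥` of eigenvectors of `h`; the weights are positive integers. -/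
theorem exists_basis_nbarPerp (T : IsSl2Triple h e f)
    (hab : ∀ x ∈ cartan h, ∀ y ∈ cartan h, ⁅x, y⁆ = 0) :
    ∃ (r : ℕ) (b : Module.Basis (Fin r) ℂ (nbarPerp T)) (w : Fin r → ℕ),
      (∀ i, 0 < w i) ∧ ∀ i, ⁅h, (b i : g)⁆ = (w i : ℂ) • (b i : g) := by
  obtain ⟨r, b, w, hw⟩ := exists_eigenbasis (iSup_eigenspace_restrict
    (iSup_eigenspace_eq_top (M := g) T) (nbarPerp T).toSubmodule
    fun x hx => (nbarPerp T).lie_mem (x := ⟨h, mem_torus h⟩) hx)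
  have hw' (i) : ⁅h, (b i : g)⁆ = w i • (b i : g) := congrArg Subtype.val (hw i)
  have hb0 (i) : (b i : g) ≠ 0 := fun h0 => b.ne_zero i (Subtype.ext h0)
  have hpos (i) : ∃ n : ℕ, 0 < n ∧ w i = n := by
    obtain ⟨z, hz⟩ := exists_int_of_eigenvector T (hb0 i) (hw' i)
    rcases lt_or_ge 0 z with h0 | h0
    · exact ⟨z.toNat, by lia, by rw [hz, ← Int.cast_natCast, Int.toNat_of_nonneg h0.le]⟩
    · refine absurd (Submodule.disjoint_def.1 (disjoint_posPart_nonnegPart_neg h) _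
        ((mem_nbarPerp_iff T hab).1 (b i).2).1 ?_) (hb0 i)
      refine Submodule.mem_iSup_of_mem ⟨-z, ?_⟩ ?_
      · rw [le_neg, neg_zero]
        exact_mod_cast h0
      · rw [eigenspace_ad_neg, Module.End.mem_eigenspace_iff, LieAlgebra.ad_apply, hw', hz]
        simp
  choose n hn hn' using hpos
  exact ⟨r, b, n, hn, fun i => by rw [hw', hn']⟩

/-- Since κ(f, e) ≠ 0, a multiple of e corrects any positive vector to one orthogonal to f. -/
theorem span_e_sup_nbarPerp (T : IsSl2Triple h e f)
    (hab : ∀ x ∈ cartan h, ∀ y ∈ cartan h, ⁅x, y⁆ = 0) :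
    Submodule.span ℂ {e} ⊔ (nbarPerp T).toSubmodule = posPart h := by
  refine le_antisymm (sup_le ?_ fun x hx => ((mem_nbarPerp_iff T hab).1 hx).1) fun x hx => ?_
  · rw [Submodule.span_singleton_le_iff_mem]
    exact e_mem_posPart T
  · set c := killingForm ℂ g f x / killingForm ℂ g f e with hc
    refine Submodule.mem_sup.2 ⟨c • e, Submodule.smul_mem _ _ (Submodule.mem_span_singleton_self e),
      x - c • e, ?_, by abel⟩
    refine (mem_nbarPerp_iff T hab).2
      ⟨Submodule.sub_mem _ hx (Submodule.smul_mem _ _ (e_mem_posPart T)), ?_⟩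
    rw [map_sub, map_smul, smul_eq_mul, hc, div_mul_cancel₀ _ (killingForm_f_e_ne_zero T), sub_self]

theorem e_notMem_nbarPerp (T : IsSl2Triple h e f)
    (hab : ∀ x ∈ cartan h, ∀ y ∈ cartan h, ⁅x, y⁆ = 0) : e ∉ nbarPerp T := fun he =>
  killingForm_f_e_ne_zero T ((mem_nbarPerp_iff T hab).1 he).2

theorem linearIndependent_cons_e (T : IsSl2Triple h e f)
    (hab : ∀ x ∈ cartan h, ∀ y ∈ cartan h, ⁅x, y⁆ = 0) {r : ℕ}
    (b : Module.Basis (Fin r) ℂ (nbarPerp T)) :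
    LinearIndependent ℂ (Fin.cons e (fun i => (b i : g)) : Fin (r + 1) → g) := by
  refine linearIndependent_finCons.2 ⟨b.linearIndependent.map' (nbarPerp T).toSubmodule.subtype
    (Submodule.ker_subtype _), fun he => e_notMem_nbarPerp T hab ?_⟩
  refine Submodule.span_le.2 ?_ he
  rintro _ ⟨i, rfl⟩
  exact (b i).2

theorem span_cons_e (T : IsSl2Triple h e f)
    (hab : ∀ x ∈ cartan h, ∀ y ∈ cartan h, ⁅x, y⁆ = 0) {r : ℕ}
    (b : Module.Basis (Fin r) ℂ (nbarPerp T)) :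
    Submodule.span ℂ (Set.range (Fin.cons e (fun i => (b i : g)) : Fin (r + 1) → g)) =
      posPart h := by
  rw [Fin.range_cons, Submodule.span_insert, ← span_e_sup_nbarPerp T hab]
  congr 1
  have h1 := congrArg (Submodule.map (nbarPerp T).toSubmodule.subtype) b.span_eq
  rw [Submodule.map_span, ← Set.range_comp, Submodule.map_top, Submodule.range_subtype] at h1
  exact h1

end Structure

/-! ### A PBW basis of the Verma module -/

section Verma

variable {g : Type u} [LieRing g] [LieAlgebra ℂ g]

local notation "𝒰" => UniversalEnvelopingAlgebra ℂ g
local notation "ιU" => UniversalEnvelopingAlgebra.ι ℂ (L := g)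

theorem envMap_ι (l : LieSubalgebra ℂ g) (x : l) :
    envMap l (UniversalEnvelopingAlgebra.ι ℂ x) = ιU (x : g) :=
  UniversalEnvelopingAlgebra.lift_ι_apply ..

/-- The adjoint representation is faithful and factors through U(g). This supplies the embedding
hypothesis of the PBW argument. -/
theorem ι_injective_of_isSimple [FiniteDimensional ℂ g] [LieAlgebra.IsSimple ℂ g] :
    Function.Injective ιU := by
  have h1 : Function.Injective (LieAlgebra.ad ℂ g) := by
    rw [← LieHom.ker_eq_bot, LieAlgebra.ad_ker_eq_bot_of_hasTrivialRadical]
  intro x y hxy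
  apply h1
  have h2 (z : g) : UniversalEnvelopingAlgebra.lift ℂ (LieAlgebra.ad ℂ g) (ιU z) =
    LieAlgebra.ad ℂ g z := UniversalEnvelopingAlgebra.lift_ι_apply ..
  rw [← h2, hxy, h2]

/-- The character of `b` with value `λ` on `C(t)`. -/
theorem exists_borel_character {h : g} (hab : ∀ x ∈ cartan h, ∀ y ∈ cartan h, ⁅x, y⁆ = 0)
    (lam : Module.Dual ℂ (cartan h)) :
    ∃ χ : borel h →ₗ⁅ℂ⁆ ℂ,
      (∀ (x : cartan h) (hx : (x : g) ∈ borel h), χ ⟨x, hx⟩ = lam x) ∧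
      ∀ (x : g) (hx : x ∈ borel h), x ∈ posPart (-h) → χ ⟨x, hx⟩ = 0 := by
  let q : cartan h →ₗ[ℂ] g ⧸ posPart (-h) :=
    (posPart (-h)).mkQ ∘ₗ (cartan h).toSubmodule.subtype
  have hq : LinearMap.ker q = ⊥ := by
    refine LinearMap.ker_eq_bot'.2 fun x hx => ?_
    have h1 : (x : g) ∈ posPart (-h) := (Submodule.Quotient.mk_eq_zero _).1 hx
    have h2 := disjoint_cartan_posPart (-h)
    rw [cartan_neg] at h2
    exact Subtype.ext (Submodule.disjoint_def.1 h2 x x.2 h1)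
  obtain ⟨s, hs⟩ := LinearMap.exists_leftInverse_of_injective q hq
  -- A linear form that equals λ on the centralizer of h and vanishes on the negative part. Since
  -- the negative part is [b, b], its restriction to b is a Lie character.
  let χ0 : g →ₗ[ℂ] ℂ := lam ∘ₗ s ∘ₗ (posPart (-h)).mkQ
  have h0 (x : g) (hx : x ∈ posPart (-h)) : χ0 x = 0 := by
    have : (posPart (-h)).mkQ x = 0 := (Submodule.Quotient.mk_eq_zero _).2 hx
    simp only [χ0, LinearMap.comp_apply, this, map_zero]
  have hab' : ∀ x ∈ cartan (-h), ∀ y ∈ cartan (-h), ⁅x, y⁆ = 0 := by rwa [cartan_neg]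
  refine ⟨{ (χ0 ∘ₗ (borel h).toSubmodule.subtype) with map_lie' := fun {x y} => ?_ }, ?_, ?_⟩
  · rw [LieRing.of_associative_ring_bracket, mul_comm, sub_self]
    refine h0 _ ?_
    rw [← commutator_nonnegPart hab']
    exact Submodule.subset_span ⟨x, x.2, y, y.2, rfl⟩
  · intro x hx
    exact congrArg lam (DFunLike.congr_fun hs x)
  · exact fun x hx hx' => h0 x hx'

theorem cartan_le_borel (h : g) : cartan h ≤ borel h := by
  rw [← cartan_neg]
  exact cartan_le_nonnegPart (-h)

/-- The generator of the Verma module. -/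
def vermaVector {h : g} (lam : Module.Dual ℂ (cartan h)) : verma lam :=
  Submodule.Quotient.mk (p := vermaIdeal lam) 1

theorem smul_vermaVector {h : g} (lam : Module.Dual ℂ (cartan h)) (a : 𝒰) :
    a • vermaVector lam = Submodule.Quotient.mk (p := vermaIdeal lam) a := by
  rw [vermaVector]
  refine (Submodule.Quotient.mk_smul (vermaIdeal lam) a 1).symm.trans ?_
  rw [smul_eq_mul, mul_one]

theorem smul_vermaVector_eq_zero_iff {h : g} (lam : Module.Dual ℂ (cartan h)) (a : 𝒰) :
    a • vermaVector lam = 0 ↔ a ∈ vermaIdeal lam := by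
  rw [smul_vermaVector]
  exact Submodule.Quotient.mk_eq_zero _

theorem exists_smul_vermaVector {h : g} (lam : Module.Dual ℂ (cartan h)) (v : verma lam) :
    ∃ a : 𝒰, a • vermaVector lam = v := by
  obtain ⟨a, rfl⟩ := Submodule.Quotient.mk_surjective (vermaIdeal lam) v
  exact ⟨a, smul_vermaVector lam a⟩

theorem ι_cartan_smul_vermaVector {h : g} (lam : Module.Dual ℂ (cartan h)) (x : cartan h) :
    ιU (x : g) • vermaVector lam = lam x • vermaVector lam := by
  rw [← sub_eq_zero, ← algebraMap_smul 𝒰 (lam x), ← sub_smul, smul_vermaVector_eq_zero_iff]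
  exact Submodule.subset_span (Or.inr ⟨x, rfl⟩)

theorem commutator_borel {h : g} (hab : ∀ x ∈ cartan h, ∀ y ∈ cartan h, ⁅x, y⁆ = 0) :
    commutator (borel h) = posPart (-h) :=
  commutator_nonnegPart (by rwa [cartan_neg])

theorem mem_borel_iff {h x : g} :
    x ∈ borel h ↔ ∃ y ∈ cartan h, ∃ z ∈ posPart (-h), y + z = x := by
  refine ⟨fun hx => ?_, ?_⟩
  · have h1 : (nonnegPart (-h)).toSubmodule ≤ (cartan h).toSubmodule ⊔ posPart (-h) := by
      refine iSup_le fun r => ?_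
      rcases r.2.eq_or_lt with h0 | h0
      · refine le_sup_of_le_left ?_
        rw [← cartan_neg, cartan_eq_eigenspace, ← h0, Complex.ofReal_zero]
      · exact le_sup_of_le_right (le_iSup (fun r : {r : ℝ // 0 < r} =>
          (LieAlgebra.ad ℂ g (-h)).eigenspace ((r : ℝ) : ℂ)) ⟨r.1, h0⟩)
    exact Submodule.mem_sup.1 (h1 hx)
  · rintro ⟨y, hy, z, hz, rfl⟩
    exact add_mem (cartan_le_borel h hy) (posPart_le_nonnegPart (-h) hz)

theorem linearIndependent_append {m n : ℕ} {x : Fin m → g} {y : Fin n → g}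
    (hx : LinearIndependent ℂ x) (hy : LinearIndependent ℂ y)
    (hxy : Disjoint (Submodule.span ℂ (Set.range x)) (Submodule.span ℂ (Set.range y))) :
    LinearIndependent ℂ (Fin.append x y) := by
  have h1 : Fin.append x y ∘ finSumFinEquiv = Sum.elim x y := by
    funext i
    rcases i with i | i <;> simp
  rw [← linearIndependent_equiv finSumFinEquiv, h1]
  exact hx.sum_type hy hxy

/-- Only generators need checking, and an element of b is a Cartan part, acting by λ, plus a
negative part, which lies in [b, b] and kills the generator. -/
theorem envMap_smul_vermaVector {h : g}
    (hab : ∀ x ∈ cartan h, ∀ y ∈ cartan h, ⁅x, y⁆ = 0) (lam : Module.Dual ℂ (cartan h))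
    {χ : borel h →ₗ⁅ℂ⁆ ℂ}
    (h1 : ∀ (x : cartan h) (hx : (x : g) ∈ borel h), χ ⟨x, hx⟩ = lam x)
    (h2 : ∀ (x : g) (hx : x ∈ borel h), x ∈ posPart (-h) → χ ⟨x, hx⟩ = 0)
    (u : UniversalEnvelopingAlgebra ℂ (borel h)) :
    envMap (borel h) u • vermaVector lam =
      UniversalEnvelopingAlgebra.lift ℂ χ u • vermaVector lam := by
  induction u using env_induction with
  | h1 c => rw [AlgHom.commutes, AlgHom.commutes, algebraMap_smul]; rfl
  | h2 x =>
    rw [envMap_ι, UniversalEnvelopingAlgebra.lift_ι_apply]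
    obtain ⟨x, hx⟩ := x
    obtain ⟨y, hy, z, hz, rfl⟩ := mem_borel_iff.1 hx
    have hyb := cartan_le_borel h hy
    have hzb : z ∈ borel h := posPart_le_nonnegPart (-h) hz
    have h3 : (⟨y + z, hx⟩ : borel h) = ⟨y, hyb⟩ + ⟨z, hzb⟩ := rfl
    have h4 : ιU z • vermaVector lam = 0 := by
      rw [smul_vermaVector_eq_zero_iff]
      exact Submodule.subset_span (Or.inl ⟨z, by rwa [commutator_borel hab], rfl⟩)
    rw [h3, map_add, h2 z hzb hz, h1 ⟨y, hy⟩ hyb, add_zero, ← ι_cartan_smul_vermaVector]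
    change ιU (y + z) • vermaVector lam = _
    rw [map_add, add_smul, h4, add_zero]
  | h3 a b ha hb => rw [map_mul, map_mul, mul_smul, hb, smul_comm, ha, smul_smul, mul_comm]
  | h4 a b ha hb => rw [map_add, map_add, add_smul, add_smul, ha, hb]

variable [FiniteDimensional ℂ g] [LieAlgebra.IsSimple ℂ g] {h e f : g}

/-- The ordered monomials in `e` and a basis of `n̄ ∩ k^⊥` give a basis of the Verma module. -/
theorem exists_verma_basis (T : IsSl2Triple h e f)
    (hab : ∀ x ∈ cartan h, ∀ y ∈ cartan h, ⁅x, y⁆ = 0) (lam : Module.Dual ℂ (cartan h)) {r : ℕ}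
    (b : Module.Basis (Fin r) ℂ (nbarPerp T)) :
    ∃ B : Module.Basis (Fin (r + 1) → ℕ) ℂ (verma lam), ∀ a, B a =
      orderedMonomial (fun i => ιU ((Fin.cons e (fun i => (b i : g)) : Fin (r + 1) → g) i)) a •
        vermaVector lam := by
  classical
  obtain ⟨χ, hχ1, hχ2⟩ := exists_borel_character hab lam
  set X : Fin (r + 1) → g := Fin.cons e (fun i => (b i : g)) with hX
  let bY := Module.finBasis ℂ (borel h)
  let Y : Fin (Module.finrank ℂ (borel h)) → g := fun i => bY i
  have hspanY : Submodule.span ℂ (Set.range Y) = (borel h).toSubmodule := by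
    have h1 := congrArg (Submodule.map (borel h).toSubmodule.subtype) bY.span_eq
    rw [Submodule.map_span, ← Set.range_comp, Submodule.map_top, Submodule.range_subtype] at h1
    exact h1
  have hspanX := span_cons_e T hab b
  have hli : LinearIndependent ℂ (Fin.append X Y) := by
    refine linearIndependent_append (linearIndependent_cons_e T hab b)
      (bY.linearIndependent.map' (borel h).toSubmodule.subtype (Submodule.ker_subtype _)) ?_
    rw [hspanX, hspanY]
    exact disjoint_posPart_nonnegPart_neg h
  have hsp : Submodule.span ℂ (Set.range (Fin.append X Y)) = ⊤ := by
    rw [eq_top_iff, ← posPart_sup_nonnegPart_neg T, ← hspanX]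
    refine sup_le (Submodule.span_mono ?_) (hspanY.symm.le.trans (Submodule.span_mono ?_))
    · rintro _ ⟨i, rfl⟩
      exact ⟨Fin.castAdd _ i, Fin.append_left ..⟩
    · rintro _ ⟨i, rfl⟩
      exact ⟨Fin.natAdd _ i, Fin.append_right ..⟩
  let M (a : Fin (r + 1) → ℕ) : 𝒰 := orderedMonomial (fun i => ιU (X i)) a
  let N (c : Fin (Module.finrank ℂ (borel h)) → ℕ) : UniversalEnvelopingAlgebra ℂ (borel h) :=
    orderedMonomial (fun i => UniversalEnvelopingAlgebra.ι ℂ (bY i)) c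
  let χU : UniversalEnvelopingAlgebra ℂ (borel h) →ₐ[ℂ] ℂ := UniversalEnvelopingAlgebra.lift ℂ χ
  have hN (c) : envMap (borel h) (N c) = orderedMonomial (fun i => ιU (Y i)) c := by
    have := map_orderedMonomial (envMap (borel h) : UniversalEnvelopingAlgebra ℂ (borel h) →* 𝒰)
      (fun i => UniversalEnvelopingAlgebra.ι ℂ (bY i)) c
    refine this.trans ?_
    congr 1
    funext i
    exact envMap_ι _ _
  have hNspan : Submodule.span ℂ (Set.range N) = ⊤ := span_orderedMonomial bY.span_eq
  -- PBW for a basis of g adapted to n̄ ⊕ b shows that U(g) is free as a right U(b)-module on the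
  -- monomials M a.
  let PB := Module.Basis.mk (linearIndependent_orderedMonomial hli ι_injective_of_isSimple)
    (span_orderedMonomial hsp).ge
  have hPB (a c) : PB (Fin.append a c) = M a * envMap (borel h) (N c) := by
    rw [hN, Module.Basis.mk_apply, ← orderedMonomial_append]
    congr 1
    funext i
    refine Fin.addCases (fun i => ?_) (fun i => ?_) i <;> simp only [Fin.append_left,
      Fin.append_right]
  -- This is the expected isomorphism U(g) ⊗_{U(b)} ℂ_λ ≅ U(n̄) in coordinates: M a · u goes to χ(u)
  -- times the basis vector a. Once it is known to kill the defining left ideal, it separates the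
  -- vectors M a · v.
  let π : 𝒰 →ₗ[ℂ] ((Fin (r + 1) → ℕ) →₀ ℂ) := PB.constr ℂ fun d =>
    Finsupp.single (fun i => d (Fin.castAdd _ i)) (χU (N fun i => d (Fin.natAdd _ i)))
  have hπ (a) (u : UniversalEnvelopingAlgebra ℂ (borel h)) :
      π (M a * envMap (borel h) u) = Finsupp.single a (χU u) := by
    have hu : u ∈ Submodule.span ℂ (Set.range N) := hNspan ▸ Submodule.mem_top
    induction hu using Submodule.span_induction with
    | mem u hu =>
      obtain ⟨c, rfl⟩ := hu
      rw [← hPB, Module.Basis.constr_basis]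
      simp only [Fin.append_left, Fin.append_right]
    | zero => simp
    | add u v _ _ hu hv => rw [map_add, mul_add, map_add, hu, hv, map_add, Finsupp.single_add]
    | smul c u _ hu =>
      rw [map_smul, mul_smul_comm, map_smul, hu, map_smul, Finsupp.smul_single]
  have hMN (u : 𝒰) : u ∈ Submodule.span ℂ {u | ∃ a c, u = M a * envMap (borel h) (N c)} := by
    have hu : u ∈ Submodule.span ℂ (Set.range PB) := PB.span_eq ▸ Submodule.mem_top
    refine Submodule.span_mono ?_ hu
    rintro _ ⟨d, rfl⟩
    refine ⟨fun i => d (Fin.castAdd _ i), fun i => d (Fin.natAdd _ i), ?_⟩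
    rw [← hPB]
    congr 1
    exact (Fin.append_castAdd_natAdd ..).symm
  have hker (z : UniversalEnvelopingAlgebra ℂ (borel h)) (hz : χU z = 0) (u : 𝒰) :
      π (u * envMap (borel h) z) = 0 := by
    have hu := hMN u
    induction hu using Submodule.span_induction with
    | mem u hu =>
      obtain ⟨a, c, rfl⟩ := hu
      rw [mul_assoc, ← map_mul, hπ, map_mul, hz, mul_zero, Finsupp.single_zero]
    | zero => rw [zero_mul, map_zero]
    | add u v _ _ hu hv => rw [add_mul, map_add, hu, hv, add_zero]
    | smul c u _ hu => rw [smul_mul_assoc, map_smul, hu, smul_zero]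
  have hideal (y : 𝒰) (hy : y ∈ vermaIdeal lam) : ∀ u, π (u * y) = 0 := by
    induction hy using Submodule.span_induction with
    | mem y hy =>
      rcases hy with ⟨x, hx, rfl⟩ | ⟨x, rfl⟩
      · rw [commutator_borel hab] at hx
        have hxb : x ∈ borel h := posPart_le_nonnegPart (-h) hx
        have := hker (UniversalEnvelopingAlgebra.ι ℂ ⟨x, hxb⟩)
          ((UniversalEnvelopingAlgebra.lift_ι_apply ..).trans (hχ2 x hxb hx))
        rwa [envMap_ι] at this
      · have hxb := cartan_le_borel h x.2
        have := hker (UniversalEnvelopingAlgebra.ι ℂ ⟨x, hxb⟩ - algebraMap ℂ _ (lam x)) (by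
          rw [map_sub, AlgHom.commutes]
          refine sub_eq_zero.2 ((UniversalEnvelopingAlgebra.lift_ι_apply ..).trans (hχ1 x hxb)))
        rwa [map_sub, envMap_ι, AlgHom.commutes] at this
    | zero => simp
    | add y z _ _ hy hz => intro u; rw [mul_add, map_add, hy, hz, add_zero]
    | smul a y _ hy => intro u; rw [smul_eq_mul, ← mul_assoc]; exact hy _
  have hliV : LinearIndependent ℂ fun a => M a • vermaVector lam := by
    rw [linearIndependent_iff]
    intro l hl
    have h1 : Finsupp.linearCombination ℂ (fun a => M a • vermaVector lam) l =
        Finsupp.linearCombination ℂ M l • vermaVector lam := by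
      rw [Finsupp.linearCombination_apply, Finsupp.linearCombination_apply, Finsupp.sum,
        Finsupp.sum, Finset.sum_smul]
      exact Finset.sum_congr rfl fun a _ => (smul_assoc _ _ _).symm
    rw [h1, smul_vermaVector_eq_zero_iff] at hl
    have h2 := hideal _ hl 1
    rw [one_mul, Finsupp.linearCombination_apply, Finsupp.sum, map_sum] at h2
    rw [← Finsupp.sum_single l, Finsupp.sum, ← h2]
    refine Finset.sum_congr rfl fun a _ => ?_
    have h3 := hπ a 1
    rw [map_one, map_one, mul_one] at h3
    rw [map_smul, h3, Finsupp.smul_single, smul_eq_mul, mul_one]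
  have hspV : ⊤ ≤ Submodule.span ℂ (Set.range fun a => M a • vermaVector lam) := by
    intro v _
    obtain ⟨u, rfl⟩ := exists_smul_vermaVector lam v
    have hu := hMN u
    induction hu using Submodule.span_induction with
    | mem u hu =>
      obtain ⟨a, c, rfl⟩ := hu
      rw [mul_smul, envMap_smul_vermaVector hab lam hχ1 hχ2, smul_comm]
      exact Submodule.smul_mem _ _ (Submodule.subset_span ⟨a, rfl⟩)
    | zero => rw [zero_smul]; exact Submodule.zero_mem _
    | add u v _ _ hu hv =>
      rw [add_smul]; exact Submodule.add_mem _ (hu trivial) (hv trivial)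
    | smul c u _ hu => rw [smul_assoc]; exact Submodule.smul_mem _ _ (hu trivial)
  exact ⟨Module.Basis.mk hliV hspV, fun a => Module.Basis.mk_apply ..⟩

end Verma

/-! ### Modules over U(g) as Lie modules -/

section Action

variable {g : Type u} [LieRing g] [LieAlgebra ℂ g]

/-- A module over `U(g)` as a `g`-module. -/
instance lieRingModuleOfEnv (M : ModuleCat.{u} (UniversalEnvelopingAlgebra ℂ g)) :
    LieRingModule g M where
  bracket x v := UniversalEnvelopingAlgebra.ι ℂ x • v
  add_lie x y v := by rw [map_add, add_smul]
  lie_add x v w := smul_add _ v w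
  leibniz_lie x y v := by
    change UniversalEnvelopingAlgebra.ι ℂ x • UniversalEnvelopingAlgebra.ι ℂ y • v =
      UniversalEnvelopingAlgebra.ι ℂ ⁅x, y⁆ • v +
        UniversalEnvelopingAlgebra.ι ℂ y • UniversalEnvelopingAlgebra.ι ℂ x • v
    rw [LieHom.map_lie, LieRing.of_associative_ring_bracket, sub_smul, mul_smul, mul_smul,
      sub_add_cancel]

theorem lie_eq_ι_smul {M : ModuleCat.{u} (UniversalEnvelopingAlgebra ℂ g)} (x : g) (v : M) :
    ⁅x, v⁆ = UniversalEnvelopingAlgebra.ι ℂ x • v := rfl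

instance lieModuleOfEnv (M : ModuleCat.{u} (UniversalEnvelopingAlgebra ℂ g)) :
    LieModule ℂ g M where
  smul_lie c x v := by
    rw [lie_eq_ι_smul, map_smul, smul_assoc, lie_eq_ι_smul]
  lie_smul c x v := smul_comm _ _ _

end Action

/-! ### Eigenspaces in a basis of eigenvectors -/

section Weights

theorem mem_eigenspace_iff_repr {I M : Type*} [AddCommGroup M] [Module ℂ M]
    (B : Module.Basis I ℂ M) {D : Module.End ℂ M} {ω : I → ℂ} (hD : ∀ i, D (B i) = ω i • B i)
    (c : ℂ) (v : M) : v ∈ D.eigenspace c ↔ ∀ i, ω i ≠ c → B.repr v i = 0 := by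
  have h1 (v : M) (i : I) : B.repr (D v) i = ω i * B.repr v i := by
    have h2 : (Finsupp.lapply i ∘ₗ B.repr.toLinearMap ∘ₗ D : M →ₗ[ℂ] ℂ) =
        ω i • (Finsupp.lapply i ∘ₗ B.repr.toLinearMap) := by
      refine B.ext fun j => ?_
      simp only [LinearMap.comp_apply, hD, map_smul, LinearMap.smul_apply,
        LinearEquiv.coe_coe, Module.Basis.repr_self, Finsupp.lapply_apply, smul_eq_mul]
      by_cases hij : j = i
      · rw [hij]
      · rw [Finsupp.single_eq_of_ne (Ne.symm hij), mul_zero, mul_zero]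
    exact DFunLike.congr_fun h2 v
  rw [Module.End.mem_eigenspace_iff, ← B.repr.injective.eq_iff, Finsupp.ext_iff]
  refine forall_congr' fun i => ?_
  rw [h1, map_smul, Finsupp.smul_apply, smul_eq_mul]
  refine ⟨fun h hne => ?_, fun h => ?_⟩
  · exact (mul_eq_mul_right_iff.1 h).resolve_left hne
  · by_cases hne : ω i = c
    · rw [hne]
    · rw [h hne, mul_zero, mul_zero]

/-- A basis of eigenvectors restricts to bases of the eigenspaces. -/
theorem exists_basis_eigenspace {I M : Type*} [AddCommGroup M] [Module ℂ M]
    (B : Module.Basis I ℂ M) {D : Module.End ℂ M} {ω : I → ℂ} (hD : ∀ i, D (B i) = ω i • B i)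
    (c : ℂ) : ∃ B' : Module.Basis {i // ω i = c} ℂ (D.eigenspace c), ∀ i, (B' i : M) = B i := by
  have hmem (i : {i // ω i = c}) : B i ∈ D.eigenspace c := by
    rw [Module.End.mem_eigenspace_iff, hD, i.2]
  refine ⟨Module.Basis.mk (v := fun i => ⟨B i, hmem i⟩) ?_ ?_, fun i => by
    rw [Module.Basis.mk_apply]⟩
  · refine LinearIndependent.of_comp (D.eigenspace c).subtype ?_
    exact B.linearIndependent.comp _ Subtype.val_injective
  · rintro ⟨v, hv⟩ _
    have h1 := (mem_eigenspace_iff_repr B hD c v).1 hv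
    have h2 : v = ∑ i ∈ (B.repr v).support, B.repr v i • B i :=
      (B.linearCombination_repr v).symm
    have h3 : (⟨v, hv⟩ : D.eigenspace c) = ∑ i ∈ (B.repr v).support.attach, B.repr v i •
        (⟨B i, hmem ⟨i, by
          by_contra hne
          exact (Finsupp.mem_support_iff.1 i.2) (h1 i hne)⟩⟩ : D.eigenspace c) := by
      refine Subtype.ext ?_
      rw [Submodule.coe_sum]
      refine h2.trans (Finset.sum_attach _ (fun i => B.repr v i • B i)).symm
    rw [h3]
    exact Submodule.sum_mem _ fun i _ => Submodule.smul_mem _ _ (Submodule.subset_span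
      ⟨⟨i.1, by_contra fun hne => (Finsupp.mem_support_iff.1 i.2) (h1 i hne)⟩, rfl⟩)

theorem finrank_eigenspace_eq_card {I M : Type*} [AddCommGroup M] [Module ℂ M]
    (B : Module.Basis I ℂ M) {D : Module.End ℂ M} {ω : I → ℂ} (hD : ∀ i, D (B i) = ω i • B i)
    (c : ℂ) : Module.finrank ℂ (D.eigenspace c) = Nat.card {i // ω i = c} := by
  obtain ⟨B', _⟩ := exists_basis_eigenspace B hD c
  exact Module.finrank_eq_nat_card_basis B'

theorem finite_weights {r : ℕ} {w : Fin r → ℕ} (hw : ∀ i, 0 < w i) (c : ℂ) :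
    Finite {a : Fin r → ℕ // ((∑ i, a i * w i : ℕ) : ℂ) = c} := by
  by_cases hc : ∃ n : ℕ, c = n
  · obtain ⟨n, rfl⟩ := hc
    -- All weights are at least 1, so each exponent is at most the total weight n.
    refine Finite.of_injective (β := Set.Iic (fun _ : Fin r => n))
      (fun a => ⟨a.1, fun i => ?_⟩) fun a b hab => Subtype.ext (Subtype.mk.inj hab)
    have h1 : ∑ i, a.1 i * w i = n := Nat.cast_injective a.2
    have h2 := Finset.single_le_sum (f := fun i => a.1 i * w i) (fun _ _ => Nat.zero_le _)
      (Finset.mem_univ i)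
    have h3 := Nat.le_mul_of_pos_right (a.1 i) (hw i)
    exact (h3.trans h2).trans h1.le
  · have : IsEmpty {a : Fin r → ℕ // ((∑ i, a i * w i : ℕ) : ℂ) = c} :=
      ⟨fun a => hc ⟨_, a.2.symm⟩⟩
    infer_instance

theorem mul_orderedMonomial {A : Type*} [Ring A] [Algebra ℂ A] {n : ℕ} (H : A) (x : Fin n → A)
    (w : Fin n → ℂ) (hx : ∀ i, H * x i = x i * H + w i • x i) (a : Fin n → ℕ) :
    H * orderedMonomial x a = orderedMonomial x a * H + (∑ i, a i * w i) • orderedMonomial x a := by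
  induction n with
  | zero => simp [orderedMonomial]
  | succ n ih =>
    have hpow (k : ℕ) : H * x 0 ^ k = x 0 ^ k * H + (k * w 0) • x 0 ^ k := by
      induction k with
      | zero => simp
      | succ k ihk =>
        rw [pow_succ, ← mul_assoc, ihk, add_mul, mul_assoc, hx, mul_add, smul_mul_assoc,
          mul_smul_comm, ← mul_assoc, add_assoc, ← add_smul]
        push_cast
        congr 2
        ring
    obtain ⟨k, a, rfl⟩ : ∃ k a', a = Fin.cons k a' := ⟨a 0, Fin.tail a, (Fin.cons_self_tail a).symm⟩
    rw [orderedMonomial_cons, ← mul_assoc, hpow, add_mul, mul_assoc, ih _ _ fun i => hx i.succ,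
      Fin.sum_univ_succ, mul_add, smul_mul_assoc, mul_smul_comm, ← mul_assoc, add_smul]
    simp only [Fin.cons_zero, Fin.cons_succ]
    abel

end Weights

/-! ### Weights of the Verma module and the partition function -/

section VermaWeights

variable {g : Type u} [LieRing g] [LieAlgebra ℂ g] {h e f : g}

/-- By the Leibniz rule a monomial in eigenvectors is an eigenvector, with eigenvalue the weighted
sum of its exponents. -/
theorem symDerivation_basis {V : Type*} [AddCommGroup V] [Module ℂ V] {r : ℕ}
    (b : Module.Basis (Fin r) ℂ V) {D : V →ₗ[ℂ] V} {w : Fin r → ℂ}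
    (hD : ∀ i, D (b i) = w i • b i) (m : Fin r →₀ ℕ) :
    symDerivation D (b.symmetricAlgebra m) =
      (∑ i, m i * w i) • b.symmetricAlgebra m := by
  let E := SymmetricAlgebra.equivMvPolynomial b
  have hE (m : Fin r →₀ ℕ) : b.symmetricAlgebra m = E.symm (MvPolynomial.monomial m 1) := by
    simp [Module.Basis.symmetricAlgebra, E]
  have hadd (m n : Fin r →₀ ℕ) :
      b.symmetricAlgebra (m + n) = b.symmetricAlgebra m * b.symmetricAlgebra n := by
    rw [hE, hE, hE, ← map_mul, MvPolynomial.monomial_mul, one_mul]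
  induction m using Finsupp.induction_linear with
  | zero =>
    rw [hE, MvPolynomial.monomial_zero', MvPolynomial.C_1, map_one, Derivation.map_one_eq_zero]
    simp
  | add m n hm hn =>
    rw [hadd, Derivation.leibniz, hm, hn]
    simp only [Finsupp.add_apply, Nat.cast_add, add_mul, Finset.sum_add_distrib, smul_eq_mul, mul_smul_comm]
    rw [add_smul, mul_comm (b.symmetricAlgebra n), add_comm]
  | single i k =>
    have h1 : b.symmetricAlgebra (Finsupp.single i k) = SymmetricAlgebra.ι ℂ V (b i) ^ k := by
      rw [hE, ← MvPolynomial.X_pow_eq_monomial, map_pow, SymmetricAlgebra.equivMvPolynomial_symm_X]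
    rw [h1, Derivation.leibniz_pow, symDerivation_ι, hD, map_smul]
    rw [Finset.sum_eq_single i (fun j _ hj => by simp [hj]) (by simp)]
    cases k with
    | zero => simp
    | succ k =>
      simp only [Finsupp.single_eq_same, smul_eq_mul, mul_smul_comm, Nat.add_sub_cancel,
        ← pow_succ, ← Nat.cast_smul_eq_nsmul ℂ, smul_smul]

/-- Monomials in an eigenbasis of n̄ ∩ k^⊥ are an eigenbasis of its symmetric algebra, so P counts
exponent vectors of a given weight. Since t is spanned by h, the simultaneous eigenspace is that of
h alone. -/
theorem partitionFunction_eq_card (T : IsSl2Triple h e f) {r : ℕ}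
    (b : Module.Basis (Fin r) ℂ (nbarPerp T)) {w : Fin r → ℕ}
    (hw : ∀ i, ⁅h, (b i : g)⁆ = (w i : ℂ) • (b i : g)) (ν : Module.Dual ℂ (torus h)) :
    partitionFunction T ν =
      Nat.card {a : Fin r → ℕ // ((∑ i, a i * w i : ℕ) : ℂ) = ν ⟨h, mem_torus h⟩} := by
  set D := LieModule.toEnd ℂ (torus h) (nbarPerp T) ⟨h, mem_torus h⟩ with hDdef
  have hD (i) : D (b i) = (w i : ℂ) • b i := Subtype.ext (hw i)
  have h1 : (⨅ x : torus h, Module.End.eigenspace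
      ((symDerivation (LieModule.toEnd ℂ (torus h) (nbarPerp T) x)).toLinearMap) (ν x) :
      Submodule ℂ (SymmetricAlgebra ℂ (nbarPerp T))) =
      Module.End.eigenspace (symDerivation D).toLinearMap (ν ⟨h, mem_torus h⟩) := by
    refine le_antisymm (iInf_le _ _) (le_iInf fun x s hs => ?_)
    obtain ⟨c, hc⟩ := Submodule.mem_span_singleton.1 x.2
    have hx : x = c • (⟨h, mem_torus h⟩ : torus h) := Subtype.ext hc.symm
    have h2 : (symDerivation (c • D)).toLinearMap = c • (symDerivation D).toLinearMap := by
      refine b.symmetricAlgebra.ext fun m => ?_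
      have h3 := symDerivation_basis b hD m
      have h4 := symDerivation_basis b (D := c • D) (w := fun i => c * w i)
        (fun i => by rw [LinearMap.smul_apply, hD, smul_smul]) m
      refine h4.trans ?_
      rw [LinearMap.smul_apply]
      refine Eq.trans ?_ (congrArg (c • ·) h3).symm
      rw [smul_smul, Finset.mul_sum]
      congr 1
      exact Finset.sum_congr rfl fun i _ => by ring
    rw [Module.End.mem_eigenspace_iff] at hs ⊢
    rw [hx, map_smul, map_smul, ← hDdef, h2, LinearMap.smul_apply, hs, smul_smul, smul_eq_mul]
  rw [partitionFunction, h1, finrank_eigenspace_eq_card b.symmetricAlgebra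
    (D := (symDerivation D).toLinearMap) (symDerivation_basis b hD)]
  refine Nat.card_congr (Equiv.subtypeEquiv Finsupp.equivFunOnFinite fun m => ?_)
  push_cast
  rfl

variable [FiniteDimensional ℂ g]

/-- All weights of n̄ ∩ k^⊥ are positive, so only the empty monomial has weight zero. -/
theorem partitionFunction_eq_one (T : IsSl2Triple h e f)
    (hab : ∀ x ∈ cartan h, ∀ y ∈ cartan h, ⁅x, y⁆ = 0) {ν : Module.Dual ℂ (torus h)}
    (hν : ν ⟨h, mem_torus h⟩ = 0) : partitionFunction T ν = 1 := by
  obtain ⟨r, b, w, hw, hbw⟩ := exists_basis_nbarPerp T hab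
  rw [partitionFunction_eq_card T b hbw, Nat.card_eq_one_iff_exists]
  refine ⟨⟨0, by rw [hν]; simp⟩, fun a => Subtype.ext (funext fun i => ?_)⟩
  have h1 := a.2.trans hν
  rw [Nat.cast_eq_zero, Finset.sum_eq_zero_iff] at h1
  simpa [(hw i).ne'] using h1 i (Finset.mem_univ i)

theorem partitionFunction_eq_zero (T : IsSl2Triple h e f)
    (hab : ∀ x ∈ cartan h, ∀ y ∈ cartan h, ⁅x, y⁆ = 0) {ν : Module.Dual ℂ (torus h)} {z : ℤ}
    (hz : z < 0) (hν : ν ⟨h, mem_torus h⟩ = z) : partitionFunction T ν = 0 := by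
  obtain ⟨r, b, w, hw, hbw⟩ := exists_basis_nbarPerp T hab
  rw [partitionFunction_eq_card T b hbw, hν]
  have : IsEmpty {a : Fin r → ℕ // ((∑ i, a i * w i : ℕ) : ℂ) = z} := by
    refine ⟨fun a => ?_⟩
    have h1 : ((∑ i, a.1 i * w i : ℕ) : ℤ) = z := by exact_mod_cast a.2
    lia
  exact Nat.card_of_isEmpty

variable [LieAlgebra.IsSimple ℂ g]

/-- The value of a weight of `C(t)` on `h`. -/
abbrev evalH (lam : Module.Dual ℂ (cartan h)) : ℂ :=
  lam ⟨h, torus_le_cartan h (mem_torus h)⟩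

/-- A weight basis of the Verma module adapted to the action of `e`. -/
theorem exists_verma_weight_basis (T : IsSl2Triple h e f)
    (hab : ∀ x ∈ cartan h, ∀ y ∈ cartan h, ⁅x, y⁆ = 0) (lam : Module.Dual ℂ (cartan h)) :
    ∃ (r : ℕ) (w : Fin r → ℕ) (B : Module.Basis (ℕ × (Fin r → ℕ)) ℂ (verma lam)),
      (∀ i, 0 < w i) ∧ (∀ k a, ⁅e, B (k, a)⁆ = B (k + 1, a)) ∧
      (∀ k a, ⁅h, B (k, a)⁆ = (evalH lam + (2 * k + ∑ i, a i * w i : ℕ)) • B (k, a)) ∧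
      ∀ ν, partitionFunction T ν =
        Nat.card {a : Fin r → ℕ // ((∑ i, a i * w i : ℕ) : ℂ) = ν ⟨h, mem_torus h⟩} := by
  obtain ⟨r, b, w, hw, hbw⟩ := exists_basis_nbarPerp T hab
  obtain ⟨B, hB⟩ := exists_verma_basis T hab lam b
  have hc (k : ℕ) (a : Fin r → ℕ) : (Fin.consEquiv fun _ => ℕ) (k, a) = Fin.cons k a := rfl
  refine ⟨r, w, B.reindex (Fin.consEquiv fun _ => ℕ).symm, hw, fun k a => ?_, fun k a => ?_,
    partitionFunction_eq_card T b hbw⟩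
  · rw [Module.Basis.reindex_apply, Module.Basis.reindex_apply, lie_eq_ι_smul, hB, hB,
      Equiv.symm_symm, hc, hc, orderedMonomial_cons, orderedMonomial_cons, ← mul_smul, ← mul_assoc, pow_succ',
      Fin.cons_zero]
  · rw [Module.Basis.reindex_apply, lie_eq_ι_smul, hB, Equiv.symm_symm, hc]
    have h1 := mul_orderedMonomial (UniversalEnvelopingAlgebra.ι ℂ h)
      (fun i => UniversalEnvelopingAlgebra.ι ℂ
        ((Fin.cons e (fun i => (b i : g)) : Fin (r + 1) → g) i))
      (Fin.cons 2 fun i => (w i : ℂ)) (fun i => by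
        have h2 : ⁅h, (Fin.cons e (fun i => (b i : g)) : Fin (r + 1) → g) i⁆ =
            (Fin.cons 2 (fun i => (w i : ℂ)) : Fin (r + 1) → ℂ) i •
              (Fin.cons e (fun i => (b i : g)) : Fin (r + 1) → g) i := by
          refine Fin.cases ?_ (fun i => ?_) i
          · exact T.lie_h_e_smul ℂ
          · exact hbw i
        rw [← map_smul, ← h2, LieHom.map_lie, LieRing.of_associative_ring_bracket]
        abel) (Fin.cons k a)
    rw [← mul_smul, h1, add_smul, mul_smul,
      ι_cartan_smul_vermaVector lam ⟨h, torus_le_cartan h (mem_torus h)⟩, smul_comm, smul_assoc,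
      ← add_smul, Fin.sum_univ_succ]
    simp only [Fin.cons_zero, Fin.cons_succ]
    push_cast
    congr 2
    ring

/-- The structure of the Verma module as a module over `⟨h, e⟩`. -/
structure VermaFacts (T : IsSl2Triple h e f) (lam : Module.Dual ℂ (cartan h)) : Prop where
  injective : Function.Injective fun v : verma lam => ⁅e, v⁆
  iSup_eigenspace : ⨆ c : ℂ, (LieModule.toEnd ℂ g (verma lam) h).eigenspace c = ⊤
  finite (c : ℂ) : FiniteDimensional ℂ ((LieModule.toEnd ℂ g (verma lam) h).eigenspace c)
  weight (c : ℂ) : (LieModule.toEnd ℂ g (verma lam) h).eigenspace c ≠ ⊥ →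
    ∃ n : ℕ, c = evalH lam + n
  finrank (c : ℂ) (ν : Module.Dual ℂ (torus h)) : ν ⟨h, mem_torus h⟩ = c + 2 - evalH lam →
    Module.finrank ℂ ((LieModule.toEnd ℂ g (verma lam) h).eigenspace (c + 2)) =
      Module.finrank ℂ ((LieModule.toEnd ℂ g (verma lam) h).eigenspace c) +
        partitionFunction T ν

/-- In the adapted basis e only raises the first exponent, so the module is free over ℂ[e]. Basis
vectors of weight c + 2 with positive e-exponent correspond to basis vectors of weight c, and those
with e-exponent zero are counted by P. -/
theorem vermaFacts (T : IsSl2Triple h e f)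
    (hab : ∀ x ∈ cartan h, ∀ y ∈ cartan h, ⁅x, y⁆ = 0) (lam : Module.Dual ℂ (cartan h)) :
    VermaFacts T lam := by
  obtain ⟨r, w, B, hw, he, hh, hP⟩ := exists_verma_weight_basis T hab lam
  let ω (p : ℕ × (Fin r → ℕ)) : ℂ := evalH lam + (2 * p.1 + ∑ i, p.2 i * w i : ℕ)
  have hD (p) : LieModule.toEnd ℂ g (verma lam) h (B p) = ω p • B p := hh p.1 p.2
  have hfin (c : ℂ) : Finite {p // ω p = c} := by
    -- The exponent of e is one more variable, of weight 2.
    have hw' : ∀ i, 0 < (Fin.cons 2 w : Fin (r + 1) → ℕ) i :=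
      Fin.cases two_pos fun i => hw i
    have := finite_weights hw' (c - evalH lam)
    refine Finite.of_injective (β := {a : Fin (r + 1) → ℕ //
      ((∑ i, a i * (Fin.cons 2 w : Fin (r + 1) → ℕ) i : ℕ) : ℂ) = c - evalH lam})
      (fun p => ⟨Fin.cons p.1.1 p.1.2, ?_⟩) fun p q hpq => ?_
    · have hp := p.2
      rw [Fin.sum_univ_succ]
      simp only [Fin.cons_zero, Fin.cons_succ, ω] at hp ⊢
      push_cast at hp ⊢
      linear_combination hp
    · have := Fin.cons_inj.1 (Subtype.mk.inj hpq)
      exact Subtype.ext (Prod.ext this.1 this.2)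
  refine ⟨?_, ?_, fun c => ?_, fun c hc => ?_, fun c ν hν => ?_⟩
  · have h1 (k a v) : B.repr ⁅e, v⁆ (k + 1, a) = B.repr v (k, a) := by
      have h2 : (Finsupp.lapply (k + 1, a) ∘ₗ B.repr.toLinearMap ∘ₗ
          LieModule.toEnd ℂ g (verma lam) e : verma lam →ₗ[ℂ] ℂ) =
          Finsupp.lapply (k, a) ∘ₗ B.repr.toLinearMap := by
        refine B.ext fun ⟨k', a'⟩ => ?_
        simp only [LinearMap.comp_apply, LieModule.toEnd_apply_apply, he, LinearEquiv.coe_coe,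
          Module.Basis.repr_self, Finsupp.lapply_apply, Finsupp.single_apply, Prod.mk.injEq,
          Nat.add_right_cancel_iff]
      exact DFunLike.congr_fun h2 v
    intro v v' hvv
    refine B.repr.injective (Finsupp.ext fun ⟨k, a⟩ => ?_)
    exact (h1 k a v).symm.trans ((congrArg (fun v => B.repr v (k + 1, a)) hvv).trans (h1 k a v'))
  · rw [eq_top_iff, ← B.span_eq]
    refine Submodule.span_le.2 ?_
    rintro _ ⟨p, rfl⟩
    exact Submodule.mem_iSup_of_mem (ω p) (Module.End.mem_eigenspace_iff.2 (hD p))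
  · obtain ⟨B', _⟩ := exists_basis_eigenspace B hD c
    have := hfin c
    exact Module.Finite.of_basis B'
  · obtain ⟨v, hv, hv0⟩ := Submodule.exists_mem_ne_zero_of_ne_bot hc
    by_contra hne
    refine hv0 (B.repr.injective (Finsupp.ext fun p => ?_))
    rw [(mem_eigenspace_iff_repr B hD c v).1 hv p fun h => hne ⟨_, h.symm⟩, map_zero]
    rfl
  · rw [finrank_eigenspace_eq_card B hD, finrank_eigenspace_eq_card B hD, hP, hν]
    have := hfin c
    have := finite_weights hw (c + 2 - evalH lam)
    rw [← Nat.card_sum]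
    have h0 (a : Fin r → ℕ) :
        ω (0, a) = c + 2 ↔ ((∑ i, a i * w i : ℕ) : ℂ) = c + 2 - evalH lam := by
      simp only [ω]
      push_cast
      exact ⟨fun h => by linear_combination h, fun h => by linear_combination h⟩
    have h1 (k : ℕ) (a : Fin r → ℕ) : ω (k + 1, a) = c + 2 ↔ ω (k, a) = c := by
      simp only [ω]
      push_cast
      exact ⟨fun h => by linear_combination h, fun h => by linear_combination h⟩
    exact Nat.card_congr
      { toFun := fun p => match p with
          | ⟨(0, a), hp⟩ => Sum.inr ⟨a, (h0 a).1 hp⟩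
          | ⟨(k + 1, a), hp⟩ => Sum.inl ⟨(k, a), (h1 k a).1 hp⟩
        invFun := fun p => match p with
          | Sum.inr a => ⟨(0, a.1), (h0 a.1).2 a.2⟩
          | Sum.inl p => ⟨(p.1.1 + 1, p.1.2), (h1 p.1.1 p.1.2).2 p.2⟩
        left_inv := by rintro ⟨⟨_ | k, a⟩, hp⟩ <;> rfl
        right_inv := by rintro (⟨⟨k, a⟩, hp⟩ | a) <;> rfl }

end VermaWeights

/-! ### Vectors finite under k -/

section FiniteVectors

variable {g : Type u} [LieRing g] [LieAlgebra ℂ g] {h e f : g}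

theorem e_mem_toLieSubalgebra (T : IsSl2Triple h e f) : e ∈ T.toLieSubalgebra ℂ :=
  Submodule.subset_span (by simp)

theorem f_mem_toLieSubalgebra (T : IsSl2Triple h e f) : f ∈ T.toLieSubalgebra ℂ :=
  Submodule.subset_span (by simp)

theorem h_mem_toLieSubalgebra (T : IsSl2Triple h e f) : h ∈ T.toLieSubalgebra ℂ :=
  Submodule.subset_span (by simp)

/-- An `sl(2)`-triple as a triple in its span. -/
theorem isSl2Triple_toLieSubalgebra (T : IsSl2Triple h e f) :
    IsSl2Triple (⟨h, h_mem_toLieSubalgebra T⟩ : T.toLieSubalgebra ℂ)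
      ⟨e, e_mem_toLieSubalgebra T⟩ ⟨f, f_mem_toLieSubalgebra T⟩ where
  h_ne_zero h0 := T.h_ne_zero (congrArg Subtype.val h0)
  lie_e_f := Subtype.ext T.lie_e_f
  lie_h_e_nsmul := Subtype.ext T.lie_h_e_nsmul
  lie_h_f_nsmul := Subtype.ext T.lie_h_f_nsmul

/-- The space `U(k) v` as a `k`-module. -/
def envSpanLie (k : LieSubalgebra ℂ g) (V : ModuleCat.{u} (UniversalEnvelopingAlgebra ℂ g))
    (v : V) : LieSubmodule ℂ k V where
  __ := envSpan k V v
  lie_mem {x _} hm := ι_smul_mem_envSpan k V v x.2 hm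

theorem pow_toEnd_apply (V : ModuleCat.{u} (UniversalEnvelopingAlgebra ℂ g)) (x : g) (n : ℕ)
    (v : V) : (LieModule.toEnd ℂ g V x ^ n) v = UniversalEnvelopingAlgebra.ι ℂ x ^ n • v := by
  induction n with
  | zero => simp
  | succ n ih =>
    rw [pow_succ', Module.End.mul_apply, ih, pow_succ', mul_smul]
    rfl

variable [FiniteDimensional ℂ g]

/-- The element `e` acts nilpotently on `k`-finite vectors. -/
theorem exists_pow_smul_eq_zero (T : IsSl2Triple h e f)
    {V : ModuleCat.{u} (UniversalEnvelopingAlgebra ℂ g)} {v : V}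
    (hv : v ∈ finitePart (T.toLieSubalgebra ℂ) V) :
    ∃ n : ℕ, UniversalEnvelopingAlgebra.ι ℂ e ^ n • v = 0 := by
  let N := envSpanLie (T.toLieSubalgebra ℂ) V v
  have : FiniteDimensional ℂ N := hv
  obtain ⟨n, hn⟩ := isNilpotent_toEnd_e (M := N) (isSl2Triple_toLieSubalgebra T)
  refine ⟨n, ?_⟩
  have h1 (j : ℕ) (w : N) : (((LieModule.toEnd ℂ (T.toLieSubalgebra ℂ) N
      ⟨e, e_mem_toLieSubalgebra T⟩ ^ j) w : N) : V) =
      UniversalEnvelopingAlgebra.ι ℂ e ^ j • (w : V) := by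
    induction j with
    | zero => simp
    | succ j ih =>
      rw [pow_succ', Module.End.mul_apply, pow_succ', mul_smul, ← ih]
      rfl
  rw [← h1 n ⟨v, mem_envSpan_self _ V v⟩, hn]
  rfl

/-- The `k`-finite vectors are sums of `k`-finite eigenvectors of `h`. -/
theorem finitePart_le_eigenspaces (T : IsSl2Triple h e f)
    (V : ModuleCat.{u} (UniversalEnvelopingAlgebra ℂ g)) :
    (finitePart (T.toLieSubalgebra ℂ) V).restrictScalars ℂ ≤
      ⨆ c : ℂ, (finitePart (T.toLieSubalgebra ℂ) V).restrictScalars ℂ ⊓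
        (LieModule.toEnd ℂ g V h).eigenspace c := by
  intro v hv
  let N := envSpanLie (T.toLieSubalgebra ℂ) V v
  have hfin : FiniteDimensional ℂ N := hv
  have h1 := iSup_eigenspace_eq_top (M := N) (isSl2Triple_toLieSubalgebra T)
  have h2 : (⟨v, mem_envSpan_self _ V v⟩ : N) ∈ (⊤ : Submodule ℂ N) := Submodule.mem_top
  rw [← h1] at h2
  have h3 (w : N) (hw : w ∈ ⨆ a : ℂ, (LieModule.toEnd ℂ (T.toLieSubalgebra ℂ) N
      ⟨h, h_mem_toLieSubalgebra T⟩).eigenspace a) :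
      (w : V) ∈ ⨆ c : ℂ, (finitePart (T.toLieSubalgebra ℂ) V).restrictScalars ℂ ⊓
        (LieModule.toEnd ℂ g V h).eigenspace c := by
    induction hw using Submodule.iSup_induction' with
    | mem a w hw =>
      refine Submodule.mem_iSup_of_mem a ⟨?_, ?_⟩
      · have : FiniteDimensional ℂ (envSpan (T.toLieSubalgebra ℂ) V v) := hv
        refine Submodule.finiteDimensional_of_le (S₂ := envSpan _ V v) (envSpan_le _ _ _ _ w.2 ?_)
        exact fun x hx w hw => ι_smul_mem_envSpan _ V v hx hw
      · rw [Module.End.mem_eigenspace_iff] at hw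
        exact Module.End.mem_eigenspace_iff.2 (congrArg Subtype.val hw)
    | zero => exact Submodule.zero_mem _
    | add x y _ _ hx hy => exact Submodule.add_mem _ hx hy
  exact h3 _ h2

end FiniteVectors

/-! ### Localization at a locally ad-nilpotent element -/

section Ore

/-- If `D` is a derivation, products of elements killed by powers of `D` are killed by powers
of `D`. -/
theorem iterate_mul_eq_zero {A : Type*} [Ring A] (D : A →+ A)
    (hD : ∀ a b, D (a * b) = D a * b + a * D b) (m n : ℕ) (a b : A) (ha : D^[m] a = 0)
    (hb : D^[n] b = 0) : D^[m + n] (a * b) = 0 := by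
  have h0 (j : ℕ) : D^[j] 0 = 0 := iterate_map_zero D j
  induction hN : m + n generalizing m n a b with
  | zero =>
    obtain rfl : m = 0 := by lia
    rw [show a = 0 from ha, zero_mul, h0]
  | succ N ih =>
    rcases m with _ | m
    · rw [show a = 0 from ha, zero_mul, h0]
    rcases n with _ | n
    · rw [show b = 0 from hb, mul_zero, h0]
    rw [Function.iterate_succ_apply, hD, iterate_map_add D, ih m (n + 1) (D a) b ha hb (by lia),
      ih (m + 1) n a (D b) ha hb (by lia), add_zero]

/-- A sufficiently high power of x can be moved to the right of a: from x^{N+1}a = (x^N a)x + x^N[x,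
a], the first term gains a factor x on the right, and the second involves an element killed by one
power less of ad x. This is the Ore condition, and it also shows that if a power of x kills a vector
u, then some power kills au. -/
theorem exists_pow_mul_eq {A : Type*} [Ring A] (x : A) (d k : ℕ) (a : A)
    (ha : (fun a => x * a - a * x)^[d] a = 0) : ∃ b, x ^ (d + k) * a = b * x ^ k := by
  induction hN : d + k generalizing d k a with
  | zero =>
    obtain rfl : k = 0 := by lia
    exact ⟨a, by simp⟩
  | succ N ih =>
    rcases d with _ | d
    · exact ⟨0, by rw [show a = 0 from ha]; simp⟩
    rcases k with _ | k
    · exact ⟨x ^ (N + 1) * a, by simp⟩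
    obtain ⟨b, hb⟩ := ih (d + 1) k a ha (by lia)
    obtain ⟨c, hc⟩ := ih d (k + 1) (x * a - a * x) ha (by lia)
    refine ⟨b + c, ?_⟩
    have h1 : x ^ (N + 1) * a = x ^ N * a * x + x ^ N * (x * a - a * x) := by
      rw [pow_succ]
      noncomm_ring
    rw [h1, hb, hc, add_mul, mul_assoc, ← pow_succ]

theorem pow_mul_eq_iterate {A : Type*} [Ring A] (x a : A) (ha : a * x = 0) (n : ℕ) :
    (fun a => x * a - a * x)^[n] a = x ^ n * a := by
  induction n with
  | zero => simp
  | succ n ih =>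
    rw [Function.iterate_succ_apply', ih, mul_assoc, ha, mul_zero, sub_zero, pow_succ', mul_assoc]

/-- The powers of a locally `ad`-nilpotent element form an Ore set. -/
theorem nonempty_oreSet_powers {A : Type*} [Ring A] (x : A)
    (hx : ∀ a, ∃ n, (fun a => x * a - a * x)^[n] a = 0) :
    Nonempty (OreLocalization.OreSet (Submonoid.powers x)) := by
  rw [OreLocalization.nonempty_oreSet_iff]
  refine ⟨?_, ?_⟩
  · rintro a b ⟨_, k, rfl⟩ hab
    obtain ⟨N, hN⟩ : ∃ N, x ^ N * (a - b) = 0 := by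
      -- If c·x = 0, then (ad x)^n c = x^n c, so ad-nilpotency turns right annihilation by a power
      -- of x into left annihilation by a power. The induction removes one factor x at a time.
      have h1 : (a - b) * x ^ k = 0 := by rw [sub_mul]; exact sub_eq_zero.2 hab
      generalize a - b = c at h1
      clear hab
      induction k generalizing c with
      | zero => exact ⟨0, by simpa using h1⟩
      | succ k ih =>
        obtain ⟨N, hN⟩ := ih (c * x) (by rwa [pow_succ', ← mul_assoc] at h1)
        rw [← mul_assoc] at hN
        obtain ⟨n, hn⟩ := hx (x ^ N * c)
        rw [pow_mul_eq_iterate x _ hN, ← mul_assoc, ← pow_add] at hn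
        exact ⟨_, hn⟩
    refine ⟨⟨x ^ N, N, rfl⟩, ?_⟩
    rwa [mul_sub, sub_eq_zero] at hN
  · rintro a ⟨_, k, rfl⟩
    obtain ⟨d, hd⟩ := hx a
    obtain ⟨b, hb⟩ := exists_pow_mul_eq x d k a hd
    exact ⟨b, ⟨x ^ (d + k), d + k, rfl⟩, hb⟩

variable {g : Type u} [LieRing g] [LieAlgebra ℂ g]

/-- If `ad e` is nilpotent on `g`, it is locally nilpotent on `U(g)`. -/
theorem exists_iterate_commutator_eq_zero {e : g} (he : IsNilpotent (LieAlgebra.ad ℂ g e))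
    (a : UniversalEnvelopingAlgebra ℂ g) :
    ∃ n, (fun a => UniversalEnvelopingAlgebra.ι ℂ e * a -
      a * UniversalEnvelopingAlgebra.ι ℂ e)^[n] a = 0 := by
  set x := UniversalEnvelopingAlgebra.ι ℂ e with hx
  let D : UniversalEnvelopingAlgebra ℂ g →+ UniversalEnvelopingAlgebra ℂ g :=
    AddMonoidHom.mulLeft x - AddMonoidHom.mulRight x
  change ∃ n, D^[n] a = 0
  induction a using env_induction with
  | h1 c => exact ⟨1, sub_eq_zero.2 (Algebra.commutes c x).symm⟩
  | h2 y =>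
    obtain ⟨n, hn⟩ := he
    refine ⟨n, ?_⟩
    have h1 (j : ℕ) : D^[j] (UniversalEnvelopingAlgebra.ι ℂ y) =
        UniversalEnvelopingAlgebra.ι ℂ ((LieAlgebra.ad ℂ g e ^ j) y) := by
      induction j with
      | zero => simp
      | succ j ih =>
        rw [Function.iterate_succ_apply', ih, pow_succ', Module.End.mul_apply, LieAlgebra.ad_apply,
          LieHom.map_lie, LieRing.of_associative_ring_bracket]
        rfl
    rw [h1, hn, LinearMap.zero_apply, map_zero]
  | h3 a b ha hb =>
    obtain ⟨m, hm⟩ := ha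
    obtain ⟨n, hn⟩ := hb
    refine ⟨m + n, iterate_mul_eq_zero D (fun a b => ?_) m n a b hm hn⟩
    change x * (a * b) - a * b * x = (x * a - a * x) * b + a * (x * b - b * x)
    noncomm_ring
  | h4 a b ha hb =>
    obtain ⟨m, hm⟩ := ha
    obtain ⟨n, hn⟩ := hb
    refine ⟨m + n, ?_⟩
    rw [iterate_map_add D, add_comm m n, Function.iterate_add_apply, hm, iterate_map_zero D,
      add_comm n m, Function.iterate_add_apply, hn, iterate_map_zero D, add_zero]

/-- The data of the localization of a `g`-module at `e`. -/
structure IsLocalizationAt (e : g) {V Y : ModuleCat.{u} (UniversalEnvelopingAlgebra ℂ g)}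
    (φ : V ⟶ Y) : Prop where
  injective : Function.Injective φ.hom
  bijective : Function.Bijective fun y : Y => UniversalEnvelopingAlgebra.ι ℂ e • y
  exists_pow (y : Y) : ∃ (n : ℕ) (v : V), UniversalEnvelopingAlgebra.ι ℂ e ^ n • y = φ.hom v

/-- Ore localization of the module at the powers of e. The canonical map is injective because every
power of e acts injectively on the module. -/
theorem exists_localizationAt {e : g} (he : IsNilpotent (LieAlgebra.ad ℂ g e))
    (V : ModuleCat.{u} (UniversalEnvelopingAlgebra ℂ g))
    (hV : Function.Injective fun v : V => UniversalEnvelopingAlgebra.ι ℂ e • v) :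
    ∃ (Y : ModuleCat.{u} (UniversalEnvelopingAlgebra ℂ g)) (φ : V ⟶ Y),
      IsLocalizationAt e φ := by
  set x := UniversalEnvelopingAlgebra.ι ℂ e with hx
  obtain ⟨_⟩ := nonempty_oreSet_powers x (exists_iterate_commutator_eq_zero he)
  let Y := OreLocalization (Submonoid.powers x) V
  let φ : V →ₗ[UniversalEnvelopingAlgebra ℂ g] Y :=
    { toFun := fun v => OreLocalization.oreDiv v 1
      map_add' := fun v w => OreLocalization.add_oreDiv.symm
      map_smul' := fun a v => (OreLocalization.smul_oreDiv_one a v).symm }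
  have hpow (n : ℕ) : Function.Injective fun v : V => x ^ n • v := by
    induction n with
    | zero => intro v w hvw; simpa using hvw
    | succ n ih =>
      intro v w hvw
      simp only [pow_succ, mul_smul] at hvw
      exact hV (ih hvw)
  let u := OreLocalization.numeratorUnit (⟨x, 1, pow_one x⟩ : Submonoid.powers x)
  have hu (y : Y) : u • y = x • y := OreLocalization.oreDiv_one_smul x y
  refine ⟨ModuleCat.of _ Y, ModuleCat.ofHom φ, ⟨?_, ?_, ?_⟩⟩
  · intro v w hvw
    obtain ⟨s, b, h1, h2⟩ := OreLocalization.oreDiv_eq_iff.1 hvw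
    obtain ⟨_, n, rfl⟩ := s
    simp only [OneMemClass.coe_one, mul_one] at h2
    rw [← h2] at h1
    exact (hpow n h1).symm
  · have : (fun y : Y => x • y) = fun y : Y => u • y := funext fun y => (hu y).symm
    change Function.Bijective fun y : Y => x • y
    rw [this]
    exact MulAction.bijective u
  · intro y
    induction y using OreLocalization.ind with
    | _ v s =>
      obtain ⟨_, n, rfl⟩ := s
      refine ⟨n, v, ?_⟩
      change x ^ n • (OreLocalization.oreDiv v _ : Y) = OreLocalization.oreDiv v 1
      rw [← OreLocalization.oreDiv_one_smul]
      exact OreLocalization.smul_cancel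

end Ore

/-! ### R¹Γ through the localization at e -/

section Localization

variable {g : Type u} [LieRing g] [LieAlgebra ℂ g] {h e f : g}
  {V Y : ModuleCat.{u} (UniversalEnvelopingAlgebra ℂ g)} {φ : V ⟶ Y}

theorem IsLocalizationAt.pow_bijective (hφ : IsLocalizationAt e φ) (n : ℕ) :
    Function.Bijective fun y : Y => UniversalEnvelopingAlgebra.ι ℂ e ^ n • y := by
  have h1 : (fun y : Y => UniversalEnvelopingAlgebra.ι ℂ e ^ n • y) =
      (fun y : Y => UniversalEnvelopingAlgebra.ι ℂ e • y)^[n] := by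
    funext y
    induction n with
    | zero => simp
    | succ n ih => rw [Function.iterate_succ_apply', ← ih, pow_succ', mul_smul]
  rw [h1]
  exact hφ.bijective.iterate n

theorem IsLocalizationAt.eq_zero (hφ : IsLocalizationAt e φ) {n : ℕ} {y : Y}
    (hy : UniversalEnvelopingAlgebra.ι ℂ e ^ n • y = 0) : y = 0 :=
  (hφ.pow_bijective n).1 (hy.trans (smul_zero _).symm)

/-- The localization of a weight module is a weight module. -/
theorem IsLocalizationAt.eigSpan_eq_top (hφ : IsLocalizationAt e φ) (T : IsSl2Triple h e f)
    (hV : eigSpan h V = ⊤) : eigSpan h Y = ⊤ := by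
  set H := UniversalEnvelopingAlgebra.ι ℂ h with hH
  set E := UniversalEnvelopingAlgebra.ι ℂ e with hE
  have hHE : H * E = E * H + (2 : ℂ) • E := by
    rw [hH, hE, ← map_smul, ← T.lie_h_e_smul ℂ, LieHom.map_lie,
      LieRing.of_associative_ring_bracket]
    abel
  have h1 (w : Y) (hw : w ∈ eigSpan h Y) : ∀ y, E • y = w → y ∈ eigSpan h Y := by
    induction hw using Submodule.span_induction with
    | mem w hw =>
      rintro y rfl
      obtain ⟨a, ha⟩ := hw
      -- Division by e lowers the weight by 2.
      refine Submodule.subset_span ⟨a - 2, hφ.bijective.1 ?_⟩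
      change E • H • y = E • (a - 2) • y
      have h2 : E • H • y = H • E • y - (2 : ℂ) • E • y := by
        rw [← mul_smul H, hHE, add_smul, mul_smul, smul_assoc, add_sub_cancel_right]
      rw [h2, ha, smul_comm E, sub_smul]
    | zero =>
      intro y hy
      have h2 : y = 0 := hφ.eq_zero (n := 1) (by rwa [pow_one])
      rw [h2]
      exact Submodule.zero_mem _
    | add w w' _ _ hw hw' =>
      intro y hy
      obtain ⟨z, rfl⟩ := hφ.bijective.2 w
      obtain ⟨z', rfl⟩ := hφ.bijective.2 w'
      have : y = z + z' := hφ.bijective.1 (hy.trans (smul_add _ _ _).symm)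
      rw [this]
      exact Submodule.add_mem _ (hw z rfl) (hw' z' rfl)
    | smul c w _ hw =>
      intro y hy
      obtain ⟨z, rfl⟩ := hφ.bijective.2 w
      have : y = c • z := hφ.bijective.1 (hy.trans (smul_comm _ _ _))
      rw [this]
      exact Submodule.smul_mem _ _ (hw z rfl)
  have h2 (v : V) : φ.hom v ∈ eigSpan h Y := by
    have hv : v ∈ eigSpan h V := hV ▸ Submodule.mem_top
    induction hv using Submodule.span_induction with
    | mem v hv =>
      obtain ⟨a, ha⟩ := hv
      refine Submodule.subset_span ⟨a, ?_⟩
      rw [← map_smul, ha]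
      exact (toComplexLinear φ).map_smul a v
    | zero => rw [map_zero]; exact Submodule.zero_mem _
    | add v w _ _ hv hw => rw [map_add]; exact Submodule.add_mem _ hv hw
    | smul c v _ hv =>
      exact ((toComplexLinear φ).map_smul c v).symm ▸ Submodule.smul_mem _ c hv
  have h3 (n : ℕ) : ∀ y : Y, E ^ n • y ∈ eigSpan h Y → y ∈ eigSpan h Y := by
    induction n with
    | zero => intro y hy; simpa using hy
    | succ n ih =>
      intro y hy
      rw [pow_succ, mul_smul] at hy
      exact h1 _ (ih _ hy) y rfl
  refine eq_top_iff.2 fun y _ => ?_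
  obtain ⟨n, v, hv⟩ := hφ.exists_pow y
  exact h3 n y (hv ▸ h2 v)

/-- The quotient of the localization by the module. -/
def locQuot (φ : V ⟶ Y) : ModuleCat.{u} (UniversalEnvelopingAlgebra ℂ g) :=
  ModuleCat.of _ (Y ⧸ LinearMap.range φ.hom)

theorem mono_of_injective (l : LieSubalgebra ℂ g) {M N : RelCat l} (ψ : M ⟶ N)
    (hψ : Function.Injective ψ.hom.hom) : Mono ψ :=
  (relProp l).ι.mono_of_mono_map ((ModuleCat.mono_iff_injective _).2 hψ)

theorem injective_of_mono (l : LieSubalgebra ℂ g) {M N : RelCat l} (ψ : M ⟶ N) [Mono ψ] :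
    Function.Injective ψ.hom.hom := by
  have := (relProp l).preservesMonomorphisms_ι_of_isNormalEpiCategory
  exact (ModuleCat.mono_iff_injective ((relProp l).ι.map ψ)).1 inferInstance

/-- The category C(g, l) is closed under submodules and quotients, so its inclusion into all modules
is exact and exactness can be tested on elements. -/
theorem exact_iff_of_exact (l : LieSubalgebra ℂ g) {S : ShortComplex (RelCat l)} (hS : S.Exact)
    (x : S.X₂.obj) : S.g.hom.hom x = 0 ↔ ∃ y, S.f.hom.hom y = x := by
  have h1 : (relProp l).ι.PreservesHomology :=
    ⟨fun _ _ f => (relProp l).preservesKernels_ι f, fun _ _ f => (relProp l).preservesCokernels_ι f⟩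
  have h2 := (ShortComplex.moduleCat_exact_iff _).1 (hS.map (relProp l).ι)
  refine ⟨h2 x, ?_⟩
  rintro ⟨y, rfl⟩
  exact ShortComplex.moduleCat_zero_apply (S.map (relProp l).ι) y

variable [FiniteDimensional ℂ g]

theorem map_mem_finitePart (k : LieSubalgebra ℂ g)
    {M N : ModuleCat.{u} (UniversalEnvelopingAlgebra ℂ g)} (ψ : M ⟶ N) {v : M}
    (hv : v ∈ finitePart k M) : ψ.hom v ∈ finitePart k N := by
  have : FiniteDimensional ℂ (envSpan k M v) := hv
  change FiniteDimensional ℂ (envSpan k N _)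
  rw [← envSpan_map]
  infer_instance

/-- Injectivity is required only on U(k)v, since the lemma is also applied to a projection with a
large kernel. -/
theorem mem_finitePart_of_injOn (k : LieSubalgebra ℂ g)
    {M N : ModuleCat.{u} (UniversalEnvelopingAlgebra ℂ g)} (ψ : M ⟶ N) {v : M}
    (hψ : ∀ w ∈ envSpan k M v, ψ.hom w = 0 → w = 0) (hv : ψ.hom v ∈ finitePart k N) :
    v ∈ finitePart k M := by
  have : FiniteDimensional ℂ (envSpan k N (ψ.hom v)) := hv
  rw [← envSpan_map] at this
  change FiniteDimensional ℂ (envSpan k M v)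
  refine Module.Finite.of_injective
    ((toComplexLinear ψ).restrict (q := (envSpan k M v).map (toComplexLinear ψ))
      fun w hw => Submodule.mem_map_of_mem hw) ?_
  rw [← LinearMap.ker_eq_bot, LinearMap.ker_eq_bot']
  intro w hw
  exact Subtype.ext (hψ w w.2 (congrArg Subtype.val hw))

/-- The first cohomology of the functor of `k`-finite vectors, computed through the localization
at `e`. -/
theorem exists_equiv_of_exact (T : IsSl2Triple h e f) (hφ : IsLocalizationAt e φ)
    {P Q R : ModuleCat.{u} (UniversalEnvelopingAlgebra ℂ g)} (i : V ⟶ P) (d : P ⟶ Q) (d' : Q ⟶ R)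
    (hi : Function.Injective i.hom) (hid : ∀ p, d.hom p = 0 ↔ ∃ v, i.hom v = p)
    (hdd : ∀ q, d'.hom q = 0 ↔ ∃ p, d.hom p = q) (γ : Y ⟶ P) (hγ : φ ≫ γ = i)
    {M N L : ModuleCat.{u} (UniversalEnvelopingAlgebra ℂ g)} (D : M ⟶ N) (D' : N ⟶ L)
    (aM : M →ₗ[UniversalEnvelopingAlgebra ℂ g] P) (aN : N →ₗ[UniversalEnvelopingAlgebra ℂ g] Q)
    (aL : L →ₗ[UniversalEnvelopingAlgebra ℂ g] R)
    (hM : ∀ p, (∃ m, aM m = p) ↔ p ∈ finitePart (T.toLieSubalgebra ℂ) P)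
    (hN : ∀ p, (∃ m, aN m = p) ↔ p ∈ finitePart (T.toLieSubalgebra ℂ) Q)
    (hNi : Function.Injective aN) (hLi : Function.Injective aL)
    (hD : ∀ m, aN (D.hom m) = d.hom (aM m)) (hD' : ∀ n, aL (D'.hom n) = d'.hom (aN n))
    (S : Submodule (UniversalEnvelopingAlgebra ℂ g) (LinearMap.ker D'.hom))
    (hS : ∀ z, z ∈ S ↔ ∃ m, D.hom m = z) :
    Nonempty ((finitePart (T.toLieSubalgebra ℂ) (locQuot φ)) ≃ₗ[UniversalEnvelopingAlgebra ℂ g]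
      (LinearMap.ker D'.hom ⧸ S)) := by
  set E := UniversalEnvelopingAlgebra.ι ℂ e with hE
  set k := T.toLieSubalgebra ℂ with hk
  have hγφ (v : V) : γ.hom (φ.hom v) = i.hom v := by rw [← hγ]; rfl
  -- Every element of Y is carried into V by a power of e, and γ extends the injective map i.
  have hγi : Function.Injective γ.hom := by
    rw [← LinearMap.ker_eq_bot, LinearMap.ker_eq_bot']
    intro y hy
    obtain ⟨n, v, hv⟩ := hφ.exists_pow y
    have h1 : i.hom v = 0 := by rw [← hγφ, ← hv, map_smul, hy, smul_zero]
    rw [hi (h1.trans (map_zero _).symm), map_zero] at hv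
    exact hφ.eq_zero hv
  have hdγφ : LinearMap.range φ.hom ≤ LinearMap.ker (d.hom ∘ₗ γ.hom) := by
    rintro _ ⟨v, rfl⟩
    rw [LinearMap.mem_ker, LinearMap.comp_apply, hγφ]
    exact (hid _).2 ⟨v, rfl⟩
  -- The composite d ∘ γ embeds Y/V into Q, with image among the cocycles. Restricted to k-finite
  -- vectors it gives the map to the cohomology.
  let ψ : locQuot φ ⟶ Q := ModuleCat.ofHom ((LinearMap.range φ.hom).liftQ _ hdγφ)
  have hψmk (y : Y) : ψ.hom (Submodule.Quotient.mk y) = d.hom (γ.hom y) := rfl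
  have hψi : ∀ q, ψ.hom q = 0 → q = 0 := by
    intro q hq
    obtain ⟨y, rfl⟩ := Submodule.Quotient.mk_surjective _ q
    rw [hψmk] at hq
    obtain ⟨v, hv⟩ := (hid _).1 hq
    rw [← hγφ] at hv
    exact (Submodule.Quotient.mk_eq_zero _).2 ⟨v, hγi hv⟩
  have hex (q : finitePart k (locQuot φ)) : ∃ n : LinearMap.ker D'.hom, aN n = ψ.hom q := by
    obtain ⟨n, hn⟩ := (hN _).2 (map_mem_finitePart k ψ q.2)
    refine ⟨⟨n, ?_⟩, hn⟩
    obtain ⟨y, hy⟩ := Submodule.Quotient.mk_surjective _ q.1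
    refine hLi ?_
    rw [hD', hn, map_zero, ← hy, hψmk]
    exact (hdd _).2 ⟨_, rfl⟩
  choose F hF using hex
  let F' : finitePart k (locQuot φ) →ₗ[UniversalEnvelopingAlgebra ℂ g] LinearMap.ker D'.hom :=
    { toFun := F
      map_add' := fun q r => Subtype.ext (hNi (by
        rw [hF, Submodule.coe_add, Submodule.coe_add, map_add, map_add, hF, hF]))
      map_smul' := fun c q => Subtype.ext (hNi (by
        rw [hF, Submodule.coe_smul, RingHom.id_apply, Submodule.coe_smul, map_smul, map_smul,
          hF])) }
  refine ⟨LinearEquiv.ofBijective (S.mkQ ∘ₗ F') ⟨?_, ?_⟩⟩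
  · rw [← LinearMap.ker_eq_bot, LinearMap.ker_eq_bot']
    intro q hq
    obtain ⟨m, hm⟩ := (hS _).1 ((Submodule.Quotient.mk_eq_zero _).1 hq)
    have h1 : d.hom (aM m) = ψ.hom q := by
      rw [← hD, hm]
      exact hF q
    -- If the class becomes the coboundary of a k-finite m, then m lies in γ(Y). It is killed by a
    -- power of e, which is injective on Y, so m = 0 and the class was zero.
    obtain ⟨n, hn⟩ := exists_pow_smul_eq_zero T ((hM _).1 ⟨m, rfl⟩)
    obtain ⟨y, hy⟩ := Submodule.Quotient.mk_surjective _ q.1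
    rw [← hy, hψmk] at h1
    obtain ⟨v, hv⟩ := (hid (aM m - γ.hom y)).1 (by rw [map_sub, h1, sub_self])
    have h2 : aM m = γ.hom (φ.hom v + y) := by rw [map_add, hγφ, hv, sub_add_cancel]
    have h3 : φ.hom v + y = 0 := by
      refine hφ.eq_zero (n := n) (hγi ?_)
      rw [map_smul, ← h2, hn, map_zero]
    refine Subtype.ext (hy.symm.trans ((Submodule.Quotient.mk_eq_zero _).2 ⟨-v, ?_⟩))
    rw [map_neg]
    exact neg_eq_of_add_eq_zero_right h3
  · intro z
    obtain ⟨z, rfl⟩ := S.mkQ_surjective z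
    -- A k-finite cocycle is d(u) for some u in P and is killed by e^n. So e^n u comes from V and
    -- equals e^n γ(y) for a y in Y; correcting u by γ(y) gives a vector killed by e^n.
    obtain ⟨u, hu⟩ := (hdd (aN z)).1 (by rw [← hD', z.2, map_zero])
    obtain ⟨n, hn⟩ := exists_pow_smul_eq_zero T ((hN _).1 ⟨z.1, rfl⟩)
    obtain ⟨v, hv⟩ := (hid (E ^ n • u)).1 (by rw [map_smul, hu, hn])
    obtain ⟨y, hy⟩ := (hφ.pow_bijective n).2 (φ.hom v)
    have hu' : E ^ n • (u - γ.hom y) = 0 := by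
      rw [smul_sub, ← map_smul, ← hv, ← hγφ, ← hy]
      exact sub_self _
    let B := LinearMap.range (d.hom ∘ₗ γ.hom)
    -- The kernel of π is contained in γ(Y). Every vector of U(k)(u − γ(y)) is killed by a power of
    -- e, whereas e is injective on γ(Y), so π is injective on this space. The image of u − γ(y) is
    -- the class of the k-finite z, hence u − γ(y) is itself k-finite.
    let π : P ⟶ ModuleCat.of _ (Q ⧸ B) := ModuleCat.ofHom (B.mkQ ∘ₗ d.hom)
    have hπ (p : P) (hp : π.hom p = 0) : ∃ y, γ.hom y = p := by
      obtain ⟨y, hy⟩ := (Submodule.Quotient.mk_eq_zero _).1 hp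
      obtain ⟨v, hv⟩ := (hid (p - γ.hom y)).1 (by
        rw [map_sub, sub_eq_zero]
        exact hy.symm)
      exact ⟨φ.hom v + y, by rw [map_add, hγφ, hv, sub_add_cancel]⟩
    have hfin : u - γ.hom y ∈ finitePart k P := by
      refine mem_finitePart_of_injOn k π ?_ ?_
      · rintro _ ⟨a, rfl⟩ hw
        obtain ⟨y', hy'⟩ := hπ _ hw
        change γ.hom y' = envMap k a • (u - γ.hom y) at hy'
        obtain ⟨r, hr⟩ := exists_iterate_commutator_eq_zero
          (isNilpotent_toEnd_e (M := g) T) (envMap k a)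
        obtain ⟨b, hb⟩ := exists_pow_mul_eq _ r n _ hr
        have h0 : y' = 0 := by
          refine hφ.eq_zero (n := r + n) (hγi ?_)
          rw [map_smul, hy', ← mul_smul, hb, mul_smul, hu', smul_zero, map_zero]
        change envMap k a • (u - γ.hom y) = 0
        rw [← hy', h0, map_zero]
      · have h1 : π.hom (u - γ.hom y) = (ModuleCat.ofHom B.mkQ).hom (aN z) := by
          rw [map_sub, sub_eq_iff_eq_add, ← hu]
          have h2 : π.hom (γ.hom y) = 0 := (Submodule.Quotient.mk_eq_zero _).2 ⟨y, rfl⟩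
          rw [h2, add_zero]
          rfl
        rw [h1]
        exact map_mem_finitePart k _ ((hN _).1 ⟨z.1, rfl⟩)
    obtain ⟨m, hm⟩ := (hM _).2 hfin
    -- The cocycle z differs from the image of the class of y by the coboundary of a k-finite
    -- vector. That class is k-finite because ψ is injective.
    have hψy : ψ.hom (Submodule.Quotient.mk y) = aN (z - D.hom m) := by
      rw [hψmk, map_sub, hD, hm, map_sub, hu, sub_sub_cancel]
    refine ⟨⟨Submodule.Quotient.mk y, mem_finitePart_of_injOn k ψ (fun w _ => hψi w) ?_⟩, ?_⟩
    · rw [hψy]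
      exact (hN _).1 ⟨_, rfl⟩
    · refine (Submodule.Quotient.eq S).2 ((hS _).2 ⟨-m, hNi ?_⟩)
      rw [Submodule.coe_sub, map_sub, map_neg, map_neg]
      have h1 := hF ⟨Submodule.Quotient.mk y, mem_finitePart_of_injOn k ψ (fun w _ => hψi w) (by
        rw [hψy]
        exact (hN _).1 ⟨_, rfl⟩)⟩
      change _ = aN (F _) - _
      rw [h1, hψy, map_sub]
      abel

/-- The first derived functor of the functor of `k`-finite vectors on a module on which `e` acts
injectively. -/
theorem exists_derivedGam_equiv (T : IsSl2Triple h e f) (V : RelCat (torus h))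
    (hV : eigSpan h V.obj = ⊤) {Y : ModuleCat.{u} (UniversalEnvelopingAlgebra ℂ g)}
    {φ : V.obj ⟶ Y} (hφ : IsLocalizationAt e φ) :
    Nonempty ((finitePart (T.toLieSubalgebra ℂ) (locQuot φ)) ≃ₗ[UniversalEnvelopingAlgebra ℂ g]
      ((derivedGam (T.toLieSubalgebra ℂ) (torus h) 1).obj V)) := by
  let P := InjectiveResolution.of V
  let Y' : RelCat (torus h) := ⟨Y, relProp_torus_of_eigSpan (hφ.eigSpan_eq_top T hV)⟩
  let φ' : V ⟶ Y' := ObjectProperty.homMk φ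
  have : Mono φ' := mono_of_injective _ φ' hφ.injective
  let i : V ⟶ P.cocomplex.X 0 := P.ι.f 0
  have : Mono i := inferInstanceAs (Mono (P.ι.f 0))
  -- The extension exists because Y is again a weight module, hence an object of C(g, t), in which
  -- the resolution is injective.
  let γ : Y' ⟶ P.cocomplex.X 0 := Injective.factorThru i φ'
  have hγ : φ' ≫ γ = i := Injective.comp_factorThru i φ'
  let K := ((Gam (T.toLieSubalgebra ℂ) (torus h)).mapHomologicalComplex _).obj P.cocomplex
  let S := K.sc' 0 1 2
  obtain ⟨Φ⟩ := exists_equiv_of_exact T hφ i.hom (P.cocomplex.d 0 1).hom (P.cocomplex.d 1 2).hom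
    (injective_of_mono _ i) (exact_iff_of_exact _ P.exact₀) (exact_iff_of_exact _ (P.exact_succ 0))
    γ.hom (congrArg InducedCategory.Hom.hom hγ) S.f S.g
    (finitePart _ (P.cocomplex.X 0).obj).subtype (finitePart _ (P.cocomplex.X 1).obj).subtype
    (finitePart _ (P.cocomplex.X 2).obj).subtype (fun p => ⟨fun ⟨m, hm⟩ => hm ▸ m.2,
      fun hp => ⟨⟨p, hp⟩, rfl⟩⟩) (fun p => ⟨fun ⟨m, hm⟩ => hm ▸ m.2, fun hp => ⟨⟨p, hp⟩, rfl⟩⟩)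
    (Submodule.injective_subtype _) (Submodule.injective_subtype _) (fun _ => rfl) (fun _ => rfl)
    (LinearMap.range S.moduleCatToCycles)
    (fun z => ⟨fun ⟨m, hm⟩ => ⟨m, congrArg Subtype.val hm⟩, fun ⟨m, hm⟩ => ⟨m, Subtype.ext hm⟩⟩)
  have e1 : (derivedGam (T.toLieSubalgebra ℂ) (torus h) 1).obj V ≅ K.homology 1 :=
    P.isoRightDerivedObj (Gam (T.toLieSubalgebra ℂ) (torus h)) 1
  have e2 : K.homology 1 ≅ S.homology :=
    ShortComplex.homologyMapIso (K.isoSc' 0 1 2 (by simp) (by simp))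
  have e3 := S.moduleCatHomologyIso
  exact ⟨Φ.trans (e1 ≪≫ e2 ≪≫ e3).toLinearEquiv.symm⟩

end Localization

/-! ### Highest weight vectors and maps from simple sl(2)-modules -/

section HighestWeight

variable {L M : Type*} [LieRing L] [LieAlgebra ℂ L] [AddCommGroup M] [Module ℂ M]
  [LieRingModule L M] [LieModule ℂ L M] {h e f : L}

open LieModule

theorem lie_h_pow_f (T : IsSl2Triple h e f) {a : ℂ} {v : M} (hv : ⁅h, v⁆ = a • v) (n : ℕ) :
    ⁅h, (toEnd ℂ L M f ^ n) v⁆ = (a - 2 * n) • (toEnd ℂ L M f ^ n) v := by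
  induction n with
  | zero => simpa using hv
  | succ n ih =>
    rw [pow_succ', Module.End.mul_apply, toEnd_apply_apply, leibniz_lie h, T.lie_lie_smul_f ℂ, ih,
      lie_smul, neg_lie, smul_lie]
    push_cast
    module

/-- The point is that the scalar vanishes for a = n: on weight n the operators e and f^{n+1}
commute, without assuming that e kills v. -/
theorem lie_e_pow_f (T : IsSl2Triple h e f) {a : ℂ} {v : M} (hv : ⁅h, v⁆ = a • v) (n : ℕ) :
    ⁅e, (toEnd ℂ L M f ^ (n + 1)) v⁆ =
      (toEnd ℂ L M f ^ (n + 1)) ⁅e, v⁆ + ((n + 1) * (a - n)) • (toEnd ℂ L M f ^ n) v := by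
  induction n with
  | zero => simp [leibniz_lie e, T.lie_e_f, hv, add_comm]
  | succ n ih =>
    rw [pow_succ', Module.End.mul_apply, toEnd_apply_apply, leibniz_lie e, T.lie_e_f, ih,
      lie_h_pow_f T hv, lie_add, lie_smul, Module.End.mul_apply (toEnd ℂ L M f),
      toEnd_apply_apply]
    rw [show ⁅f, (toEnd ℂ L M f ^ n) v⁆ = (toEnd ℂ L M f ^ (n + 1)) v by
      rw [pow_succ', Module.End.mul_apply, toEnd_apply_apply]]
    push_cast
    module

variable (M h e f) in
/-- The vectors of `M` that can be images of a highest weight vector of the simple module of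
highest weight `m`. -/
def primitiveSpace (m : ℕ) : Submodule ℂ M :=
  (toEnd ℂ L M h).eigenspace m ⊓ LinearMap.ker (toEnd ℂ L M e) ⊓
    LinearMap.ker (toEnd ℂ L M f ^ (m + 1))

theorem mem_primitiveSpace {m : ℕ} {v : M} : v ∈ primitiveSpace M h e f m ↔
    ⁅h, v⁆ = (m : ℂ) • v ∧ ⁅e, v⁆ = 0 ∧ (toEnd ℂ L M f ^ (m + 1)) v = 0 := by
  rw [primitiveSpace, Submodule.mem_inf, Submodule.mem_inf, Module.End.mem_eigenspace_iff, and_assoc]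
  rfl

/-- The span of the vectors `f ^ j v` for a vector `v` as in a simple module. -/
theorem lie_mem_span_pow_f (T : IsSl2Triple h e f) {m : ℕ} {v : M}
    (hv : v ∈ primitiveSpace M h e f m) {x : L} (hx : x ∈ T.toLieSubalgebra ℂ) {w : M}
    (hw : w ∈ Submodule.span ℂ (Set.range fun j : Fin (m + 1) => (toEnd ℂ L M f ^ (j : ℕ)) v)) :
    ⁅x, w⁆ ∈ Submodule.span ℂ (Set.range fun j : Fin (m + 1) => (toEnd ℂ L M f ^ (j : ℕ)) v) := by
  obtain ⟨h1, h2, h3⟩ := mem_primitiveSpace.1 hv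
  set S := Submodule.span ℂ (Set.range fun j : Fin (m + 1) => (toEnd ℂ L M f ^ (j : ℕ)) v) with hS
  have hmem (j : ℕ) : (toEnd ℂ L M f ^ j) v ∈ S := by
    by_cases hj : j < m + 1
    · exact Submodule.subset_span ⟨⟨j, hj⟩, rfl⟩
    · obtain ⟨i, rfl⟩ := Nat.exists_eq_add_of_le (not_lt.1 hj)
      rw [add_comm, pow_add, Module.End.mul_apply, h3, map_zero]
      exact Submodule.zero_mem _
  obtain ⟨a, b, c, rfl⟩ := IsSl2Triple.mem_toLieSubalgebra_iff.1 hx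
  induction hw using Submodule.span_induction with
  | mem w hw =>
    obtain ⟨⟨j, hj⟩, rfl⟩ := hw
    simp only [T.lie_e_f, add_lie, smul_lie]
    refine Submodule.add_mem _ (Submodule.add_mem _ (Submodule.smul_mem _ _ ?_)
      (Submodule.smul_mem _ _ ?_)) (Submodule.smul_mem _ _ ?_)
    · cases j with
      | zero =>
        simp only [pow_zero, Module.End.one_apply, h2]
        exact Submodule.zero_mem _
      | succ j =>
        rw [lie_e_pow_f T h1, h2, map_zero, zero_add]
        exact Submodule.smul_mem _ _ (hmem j)
    · have := hmem (j + 1)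
      rwa [pow_succ', Module.End.mul_apply] at this
    · rw [lie_h_pow_f T h1]
      exact Submodule.smul_mem _ _ (hmem j)
  | zero => rw [lie_zero]; exact Submodule.zero_mem _
  | add w w' _ _ hw hw' => rw [lie_add]; exact Submodule.add_mem _ hw hw'
  | smul c w _ hw => rw [lie_smul]; exact Submodule.smul_mem _ _ hw

variable {W : Type*} [AddCommGroup W] [Module ℂ W] [LieRingModule L W] [LieModule ℂ L W]

/-- Maps from a simple module are determined by the image of the highest weight vector. -/
theorem exists_map_of_mem_primitiveSpace [FiniteDimensional ℂ W]
    [LieModule.IsIrreducible ℂ L W] (T : IsSl2Triple h e f) (hL : T.toLieSubalgebra ℂ = ⊤)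
    {m : ℕ} {w : W} (P : T.HasPrimitiveVectorWith w (m : ℂ)) {v : M}
    (hv : v ∈ primitiveSpace M h e f m) :
    ∃ φ : W →ₗ[ℂ] M, φ w = v ∧ ∀ (x : L) (w : W), φ ⁅x, w⁆ = ⁅x, φ w⁆ := by
  obtain ⟨h1, h2, h3⟩ := mem_primitiveSpace.1 hv
  have hw : w ∈ primitiveSpace W h e f m :=
    mem_primitiveSpace.2 ⟨P.lie_h, P.lie_e, P.pow_toEnd_f_eq_zero_of_eq_nat rfl⟩
  obtain ⟨w1, w2, w3⟩ := mem_primitiveSpace.1 hw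
  let b (j : Fin (m + 1)) : W := (toEnd ℂ L W f ^ (j : ℕ)) w
  have hli : LinearIndependent ℂ b := by
    refine (toEnd ℂ L W h).eigenvectors_linearIndependent'
      (fun j : Fin (m + 1) => (m : ℂ) - 2 * (j : ℕ)) (fun i j hij => ?_) b (fun j => ⟨?_, ?_⟩)
    · refine Fin.ext (Nat.cast_injective (R := ℂ) ?_)
      linear_combination (-1 / 2 : ℂ) * hij
    · exact Module.End.mem_eigenspace_iff.2 (lie_h_pow_f T w1 j)
    · exact P.pow_toEnd_f_ne_zero_of_eq_nat rfl (Nat.lt_succ_iff.1 j.2)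
  let S : LieSubmodule ℂ L W :=
    { __ := Submodule.span ℂ (Set.range b)
      lie_mem := fun {x _} hm =>
        lie_mem_span_pow_f T hw (hL ▸ LieSubalgebra.mem_top x : x ∈ T.toLieSubalgebra ℂ) hm }
  -- By irreducibility the vectors f^j w with j ≤ m span W. They are independent as eigenvectors for
  -- distinct weights, so a map may be prescribed on them.
  have hS : S = ⊤ := by
    refine (eq_bot_or_eq_top S).resolve_left fun h0 => P.ne_zero ?_
    have : w ∈ S := Submodule.subset_span ⟨0, rfl⟩
    rw [h0] at this
    exact (LieSubmodule.mem_bot w).1 this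
  have hsp : ⊤ ≤ Submodule.span ℂ (Set.range b) :=
    (congrArg LieSubmodule.toSubmodule hS).ge
  let B := Module.Basis.mk hli hsp
  let φ : W →ₗ[ℂ] M := B.constr ℂ fun j => (toEnd ℂ L M f ^ (j : ℕ)) v
  have hφ (j : ℕ) : φ ((toEnd ℂ L W f ^ j) w) = (toEnd ℂ L M f ^ j) v := by
    by_cases hj : j < m + 1
    · have := B.constr_basis ℂ (fun j => (toEnd ℂ L M f ^ (j : ℕ)) v) ⟨j, hj⟩
      rwa [Module.Basis.mk_apply] at this
    · obtain ⟨i, rfl⟩ := Nat.exists_eq_add_of_le (not_lt.1 hj)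
      rw [add_comm, pow_add _ i, pow_add _ i, Module.End.mul_apply, Module.End.mul_apply, h3, w3,
        map_zero, map_zero, map_zero]
  refine ⟨φ, hφ 0, fun x => ?_⟩
  suffices hx : φ ∘ₗ toEnd ℂ L W x = toEnd ℂ L M x ∘ₗ φ from DFunLike.congr_fun hx
  obtain ⟨a, c, d, rfl⟩ := IsSl2Triple.mem_toLieSubalgebra_iff.1
    (hL ▸ LieSubalgebra.mem_top x : x ∈ T.toLieSubalgebra ℂ)
  refine B.ext fun ⟨j, hj⟩ => ?_
  rw [Module.Basis.mk_apply]
  have he : φ ⁅e, (toEnd ℂ L W f ^ j) w⁆ = ⁅e, (toEnd ℂ L M f ^ j) v⁆ := by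
    cases j with
    | zero => simp [h2, w2]
    | succ j =>
      rw [lie_e_pow_f T h1, lie_e_pow_f T w1, h2, w2, map_zero, map_zero, zero_add, zero_add,
        map_smul, hφ]
  have hf : φ ⁅f, (toEnd ℂ L W f ^ j) w⁆ = ⁅f, (toEnd ℂ L M f ^ j) v⁆ := by
    have := hφ (j + 1)
    rwa [pow_succ', pow_succ', Module.End.mul_apply, Module.End.mul_apply] at this
  have hh : φ ⁅h, (toEnd ℂ L W f ^ j) w⁆ = ⁅h, (toEnd ℂ L M f ^ j) v⁆ := by
    rw [lie_h_pow_f T h1, lie_h_pow_f T w1, map_smul, hφ]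
  simp only [b, LinearMap.comp_apply, T.lie_e_f, map_add, map_smul, LinearMap.add_apply,
    LinearMap.smul_apply, toEnd_apply_apply, he, hf, hh, hφ]

end HighestWeight

/-! ### Homomorphisms from W(m) as primitive vectors -/

section Hom

variable {g : Type u} [LieRing g] [LieAlgebra ℂ g] {h e f : g}

theorem toLieSubalgebra_eq_top (T : IsSl2Triple h e f) :
    (isSl2Triple_toLieSubalgebra T).toLieSubalgebra ℂ = ⊤ := by
  refine eq_top_iff.2 fun x _ => ?_
  obtain ⟨a, b, c, hx⟩ := IsSl2Triple.mem_toLieSubalgebra_iff.1 x.2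
  exact IsSl2Triple.mem_toLieSubalgebra_iff.2 ⟨a, b, c, Subtype.ext hx⟩

/-- The space `Hom_k(W, M)` for `W` of highest weight `m`. -/
theorem exists_homK_equiv (T : IsSl2Triple h e f) {μ : Module.Dual ℂ (torus h)} {m : ℕ}
    (hμ : μ ⟨h, mem_torus h⟩ = m) {W : Type v} [AddCommGroup W] [Module ℂ W]
    [LieRingModule (T.toLieSubalgebra ℂ) W] [LieModule ℂ (T.toLieSubalgebra ℂ) W]
    (hW : IsTypeOfHighestWeight T μ W) (M : ModuleCat.{u} (UniversalEnvelopingAlgebra ℂ g)) :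
    Nonempty (homK (T.toLieSubalgebra ℂ) W M ≃ₗ[ℂ] primitiveSpace M h e f m) := by
  obtain ⟨hfin, hirr, w, hw0, hwe, hwh⟩ := hW
  let k := T.toLieSubalgebra ℂ
  have T' := isSl2Triple_toLieSubalgebra T
  have P : T'.HasPrimitiveVectorWith w (m : ℂ) := ⟨hw0, by
    rw [hwh _ (mem_torus h)]
    exact congrArg (· • w) hμ, hwe _ rfl⟩
  have hmem (φ : homK k W M) : φ.1 w ∈ primitiveSpace M h e f m := by
    refine mem_primitiveSpace.2 ⟨?_, ?_, ?_⟩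
    · have := φ.2 ⟨h, h_mem_toLieSubalgebra T⟩ w
      rw [P.lie_h, map_smul] at this
      exact this.symm
    · have := φ.2 ⟨e, e_mem_toLieSubalgebra T⟩ w
      rw [P.lie_e, map_zero] at this
      exact this.symm
    · have h1 (j : ℕ) : φ.1 ((LieModule.toEnd ℂ k W ⟨f, f_mem_toLieSubalgebra T⟩ ^ j) w) =
          (LieModule.toEnd ℂ g M f ^ j) (φ.1 w) := by
        induction j with
        | zero => rfl
        | succ j ih =>
          rw [pow_succ', pow_succ', Module.End.mul_apply, Module.End.mul_apply, ← ih]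
          exact φ.2 _ _
      rw [← h1, P.pow_toEnd_f_eq_zero_of_eq_nat rfl, map_zero]
  let ev : homK k W M →ₗ[ℂ] primitiveSpace M h e f m :=
    { toFun := fun φ => ⟨φ.1 w, hmem φ⟩
      map_add' := fun _ _ => rfl
      map_smul' := fun _ _ => rfl }
  refine ⟨LinearEquiv.ofBijective ev ⟨?_, ?_⟩⟩
  · rw [← LinearMap.ker_eq_bot, LinearMap.ker_eq_bot']
    intro φ hφ
    let N : LieSubmodule ℂ k W :=
      { __ := LinearMap.ker φ.1
        lie_mem := fun {x m} hm => by
          change φ.1 ⁅x, m⁆ = 0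
          rw [φ.2, show φ.1 m = 0 from hm, smul_zero] }
    have hN : N = ⊤ := by
      refine (eq_bot_or_eq_top N).resolve_left fun h0 => hw0 ?_
      have : w ∈ N := congrArg Subtype.val hφ
      rw [h0] at this
      exact (LieSubmodule.mem_bot w).1 this
    refine Subtype.ext (LinearMap.ext fun x => ?_)
    have : x ∈ N := hN ▸ LieSubmodule.mem_top x
    exact this
  · rintro ⟨q, hq⟩
    obtain ⟨φ, hφ1, hφ2⟩ := exists_map_of_mem_primitiveSpace (M := M) T'
      (toLieSubalgebra_eq_top T) P (v := q) hq
    exact ⟨⟨φ, fun x w => hφ2 x w⟩, Subtype.ext hφ1⟩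

variable [FiniteDimensional ℂ g]

/-- Homomorphisms from a finite-dimensional module take values in the `k`-finite vectors. -/
theorem exists_homK_finitePart_equiv (k : LieSubalgebra ℂ g) (W : Type v) [AddCommGroup W]
    [Module ℂ W] [LieRingModule k W] [FiniteDimensional ℂ W]
    {M N : ModuleCat.{u} (UniversalEnvelopingAlgebra ℂ g)}
    (Φ : finitePart k M ≃ₗ[UniversalEnvelopingAlgebra ℂ g] N) :
    Nonempty (homK k W N ≃ₗ[ℂ] homK k W M) := by
  let i : N →ₗ[UniversalEnvelopingAlgebra ℂ g] M := (finitePart k M).subtype ∘ₗ Φ.symm.toLinearMap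
  have hi : Function.Injective i := (Submodule.injective_subtype _).comp Φ.symm.injective
  have hfin (φ : homK k W M) (w : W) : φ.1 w ∈ finitePart k M := by
    refine Submodule.finiteDimensional_of_le (S₂ := LinearMap.range φ.1)
      (envSpan_le k M _ _ ⟨w, rfl⟩ ?_)
    rintro x hx _ ⟨w, rfl⟩
    exact ⟨⁅(⟨x, hx⟩ : k), w⁆, φ.2 ⟨x, hx⟩ w⟩
  let F : homK k W N →ₗ[ℂ] homK k W M :=
    { toFun := fun φ => ⟨i.restrictScalars ℂ ∘ₗ φ.1, fun x w => by
        rw [LinearMap.comp_apply, φ.2]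
        exact i.map_smul _ _⟩
      map_add' := fun φ ψ => Subtype.ext (LinearMap.comp_add _ _ _)
      map_smul' := fun c φ => Subtype.ext (LinearMap.comp_smul _ _ _) }
  refine ⟨LinearEquiv.ofBijective F ⟨fun φ ψ hφψ => ?_, fun φ => ?_⟩⟩
  · refine Subtype.ext (LinearMap.ext fun w => hi ?_)
    exact DFunLike.congr_fun (congrArg Subtype.val hφψ) w
  · let φ' : W →ₗ[ℂ] finitePart k M :=
      { toFun := fun w => ⟨φ.1 w, hfin φ w⟩
        map_add' := fun v w => Subtype.ext (map_add φ.1 v w)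
        map_smul' := fun c w => Subtype.ext (map_smul φ.1 c w) }
    refine ⟨⟨Φ.toLinearMap.restrictScalars ℂ ∘ₗ φ', fun x w => ?_⟩, ?_⟩
    · have h1 : φ' ⁅x, w⁆ = UniversalEnvelopingAlgebra.ι ℂ (x : g) • φ' w :=
        Subtype.ext (φ.2 x w)
      rw [LinearMap.comp_apply, h1]
      exact Φ.map_smul _ _
    · refine Subtype.ext (LinearMap.ext fun w => ?_)
      change ((Φ.symm (Φ (φ' w)) : finitePart k M) : M) = φ.1 w
      rw [Φ.symm_apply_apply]
      rfl

end Hom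

/-! ### Counting primitive vectors in the quotient Y/V -/

section Dimension

/-- An eigenvector in the image of a map that intertwines two endomorphisms, the first of which is
diagonalizable, is the image of an eigenvector. -/
theorem exists_eigenvector_of_intertwining {V Q : Type*} [AddCommGroup V] [Module ℂ V]
    [AddCommGroup Q] [Module ℂ Q] {D : Module.End ℂ V} {D' : Module.End ℂ Q} (θ : V →ₗ[ℂ] Q)
    (hθ : ∀ v, D' (θ v) = θ (D v)) (hD : ⨆ c : ℂ, D.eigenspace c = ⊤) {c : ℂ} {v : V}
    (hv : D' (θ v) = c • θ v) : ∃ w, D w = c • w ∧ θ w = θ v := by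
  have h1 : v ∈ ⨆ c : ℂ, D.eigenspace c := hD ▸ Submodule.mem_top
  rw [iSup_split_single _ c] at h1
  obtain ⟨w, hw, r, hr, rfl⟩ := Submodule.mem_sup.1 h1
  rw [Module.End.mem_eigenspace_iff] at hw
  refine ⟨w, hw, ?_⟩
  have h2 : θ r ∈ ⨆ (a : ℂ) (_ : a ≠ c), D'.eigenspace a := by
    have h3 : (⨆ (a : ℂ) (_ : a ≠ c), D.eigenspace a) ≤
        (⨆ (a : ℂ) (_ : a ≠ c), D'.eigenspace a).comap θ := by
      refine iSup₂_le fun a ha x hx => ?_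
      refine Submodule.mem_iSup_of_mem a (Submodule.mem_iSup_of_mem ha ?_)
      rw [Module.End.mem_eigenspace_iff] at hx ⊢
      rw [hθ, hx, map_smul]
    exact h3 hr
  have h4 : θ r ∈ D'.eigenspace c := by
    have h5 : D' (θ w) = c • θ w := by rw [hθ, hw, map_smul]
    rw [map_add, map_add, h5, smul_add] at hv
    exact Module.End.mem_eigenspace_iff.2 (add_left_cancel hv)
  rw [map_add, Submodule.disjoint_def.1 (D'.eigenspaces_iSupIndep c) _ h4 h2, add_zero]

variable {g : Type u} [LieRing g] [LieAlgebra ℂ g] {h e f : g}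
  {V Y : ModuleCat.{u} (UniversalEnvelopingAlgebra ℂ g)} {φ : V ⟶ Y}

open LieModule

/-- The map `v ↦ e⁻¹ v` from `V` to the quotient of its localization by `V`. -/
theorem IsLocalizationAt.exists_divE (hφ : IsLocalizationAt e φ) (T : IsSl2Triple h e f) :
    ∃ θ : V →ₗ[ℂ] locQuot φ, (∀ q, ⁅e, q⁆ = 0 ↔ ∃ v, θ v = q) ∧
      (∀ v, θ v = 0 ↔ ∃ w, ⁅e, w⁆ = v) ∧ (∀ v, ⁅h, θ v⁆ = θ (⁅h, v⁆ - (2 : ℂ) • v)) ∧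
      ∀ (m : ℕ) (v : V), ⁅h, v⁆ = ((m : ℂ) + 2) • v →
        (toEnd ℂ g (locQuot φ) f ^ (m + 1)) (θ v) = θ ((toEnd ℂ g V f ^ (m + 1)) v) := by
  let E : Y ≃ₗ[ℂ] Y := LinearEquiv.ofBijective (toEnd ℂ g Y e) hφ.bijective
  have hE (y : Y) : ⁅e, E.symm y⁆ = y := E.apply_symm_apply y
  have hEi (y z : Y) (hyz : ⁅e, y⁆ = ⁅e, z⁆) : y = z := hφ.bijective.1 hyz
  let π : Y ⟶ locQuot φ := ModuleCat.ofHom (LinearMap.range φ.hom).mkQ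
  have hπ (x : g) (y : Y) : ⁅x, π.hom y⁆ = π.hom ⁅x, y⁆ := (π.hom.map_smul _ _).symm
  have hφl (x : g) (v : V) : φ.hom ⁅x, v⁆ = ⁅x, φ.hom v⁆ := φ.hom.map_smul _ _
  have hπ0 (y : Y) : π.hom y = 0 ↔ ∃ v, φ.hom v = y := Submodule.Quotient.mk_eq_zero _
  have hHE (y : Y) : ⁅h, E.symm y⁆ = E.symm (⁅h, y⁆ - (2 : ℂ) • y) := by
    refine hEi _ _ ?_
    have h1 := leibniz_lie h e (E.symm y)
    rw [hE, T.lie_h_e_smul ℂ, smul_lie, hE] at h1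
    rw [hE, h1]
    abel
  refine ⟨toComplexLinear π ∘ₗ E.symm.toLinearMap ∘ₗ toComplexLinear φ, fun q => ?_, fun v => ?_,
    fun v => ?_, fun m v hv => ?_⟩
  · constructor
    · intro hq
      obtain ⟨y, rfl⟩ := Submodule.Quotient.mk_surjective _ q
      obtain ⟨v, hv⟩ := (hπ0 ⁅e, y⁆).1 ((hπ e y).symm.trans hq)
      refine ⟨v, congrArg π.hom (hEi _ _ ?_)⟩
      exact (hE _).trans hv
    · rintro ⟨v, rfl⟩
      refine (hπ e _).trans ((hπ0 _).2 ⟨v, ?_⟩)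
      exact (hE _).symm
  · refine (hπ0 _).trans ⟨?_, ?_⟩
    · rintro ⟨w, hw⟩
      refine ⟨w, hφ.injective ?_⟩
      rw [hφl, hw]
      exact hE _
    · rintro ⟨w, rfl⟩
      refine ⟨w, hEi _ _ ?_⟩
      rw [← hφl]
      exact (hE _).symm
  · refine (hπ h _).trans (congrArg π.hom ?_)
    refine (hHE _).trans (congrArg E.symm ?_)
    rw [map_sub, map_smul]
    exact congrArg (· - _) (hφl h v).symm
  · have hpowπ (j : ℕ) (y : Y) : (toEnd ℂ g (locQuot φ) f ^ j) (π.hom y) =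
        π.hom ((toEnd ℂ g Y f ^ j) y) := by
      rw [pow_toEnd_apply, pow_toEnd_apply]
      exact (π.hom.map_smul _ _).symm
    have hpowφ (j : ℕ) (v : V) : φ.hom ((toEnd ℂ g V f ^ j) v) =
        (toEnd ℂ g Y f ^ j) (φ.hom v) := by
      rw [pow_toEnd_apply, pow_toEnd_apply]
      exact φ.hom.map_smul _ _
    refine (hpowπ _ _).trans (congrArg π.hom (hEi _ _ ?_))
    have h1 : ⁅h, E.symm (φ.hom v)⁆ = (m : ℂ) • E.symm (φ.hom v) := by
      rw [hHE, ← hφl, hv, ← map_smul E.symm]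
      congr 1
      refine (congrArg (· - _) ((toComplexLinear φ).map_smul _ v)).trans ?_
      change ((m : ℂ) + 2) • φ.hom v - _ = _
      module
    -- The vector e⁻¹v has weight m, where f^{m+1} commutes with e. Hence f^{m+1}e⁻¹v = e⁻¹f^{m+1}v.
    refine (lie_e_pow_f T h1 m).trans ?_
    rw [sub_self, mul_zero, zero_smul, add_zero, hE, ← hpowφ]
    exact (hE _).symm

/-- The vectors of weight `c` that are killed by `e`. -/
def singularSpace (M : Type*) [AddCommGroup M] [Module ℂ M] [LieRingModule g M] [LieModule ℂ g M]
    (h e : g) (c : ℂ) : Submodule ℂ M :=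
  (toEnd ℂ g M h).eigenspace c ⊓ LinearMap.ker (toEnd ℂ g M e)

theorem mem_singularSpace {M : Type*} [AddCommGroup M] [Module ℂ M] [LieRingModule g M]
    [LieModule ℂ g M] {c : ℂ} {q : M} :
    q ∈ singularSpace M h e c ↔ ⁅h, q⁆ = c • q ∧ ⁅e, q⁆ = 0 := by
  rw [singularSpace, Submodule.mem_inf, Module.End.mem_eigenspace_iff]
  rfl

/-- The map θ plays the role of e⁻¹: it identifies V/eV with the kernel of e in Q and lowers weights
by 2. So the singular vectors of weight c form V_{c+2}/eV_c, and e is injective on V_c. -/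
theorem finrank_singularSpace {Q : Type*} [AddCommGroup Q] [Module ℂ Q] [LieRingModule g Q]
    [LieModule ℂ g Q] (T : IsSl2Triple h e f) (he : Function.Injective fun v : V => ⁅e, v⁆)
    (hV : ⨆ c : ℂ, (toEnd ℂ g V h).eigenspace c = ⊤) (θ : V →ₗ[ℂ] Q)
    (h1 : ∀ q : Q, ⁅e, q⁆ = 0 ↔ ∃ v, θ v = q) (h2 : ∀ v, θ v = 0 ↔ ∃ w, ⁅e, w⁆ = v)
    (h3 : ∀ v, ⁅h, θ v⁆ = θ (⁅h, v⁆ - (2 : ℂ) • v)) (c : ℂ)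
    (hfin : FiniteDimensional ℂ ((toEnd ℂ g V h).eigenspace (c + 2))) :
    FiniteDimensional ℂ (singularSpace Q h e c) ∧
    (∀ q ∈ singularSpace Q h e c, ∃ v, ⁅h, v⁆ = (c + 2) • v ∧ θ v = q) ∧
      Module.finrank ℂ (singularSpace Q h e c) +
        Module.finrank ℂ ((toEnd ℂ g V h).eigenspace c) =
      Module.finrank ℂ ((toEnd ℂ g V h).eigenspace (c + 2)) := by
  have h4 (q : Q) (hq : q ∈ singularSpace Q h e c) :
      ∃ v, ⁅h, v⁆ = (c + 2) • v ∧ θ v = q := by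
    obtain ⟨hqh, hqe⟩ := mem_singularSpace.1 hq
    obtain ⟨v, rfl⟩ := (h1 q).1 hqe
    refine exists_eigenvector_of_intertwining (D := toEnd ℂ g V h)
      (D' := toEnd ℂ g Q h + (2 : ℂ) • 1) θ (fun v => ?_) hV ?_
    · simp only [LinearMap.add_apply, toEnd_apply_apply, LinearMap.smul_apply,
        Module.End.one_apply, h3, map_sub, map_smul, sub_add_cancel]
    · simp only [LinearMap.add_apply, toEnd_apply_apply, LinearMap.smul_apply,
        Module.End.one_apply, hqh, add_smul]
  let θ' := θ.domRestrict ((toEnd ℂ g V h).eigenspace (c + 2))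
  have hr : LinearMap.range θ' = singularSpace Q h e c := by
    ext q
    constructor
    · rintro ⟨⟨v, hv⟩, rfl⟩
      rw [Module.End.mem_eigenspace_iff, toEnd_apply_apply] at hv
      refine mem_singularSpace.2 ⟨?_, (h1 _).2 ⟨v, rfl⟩⟩
      change ⁅h, θ v⁆ = c • θ v
      rw [h3, hv, ← sub_smul, add_sub_cancel_right, map_smul]
    · intro hq
      obtain ⟨v, hv, rfl⟩ := h4 q hq
      exact ⟨⟨v, Module.End.mem_eigenspace_iff.2 hv⟩, rfl⟩
  have hmem (v : (toEnd ℂ g V h).eigenspace c) :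
      ⁅e, v.1⁆ ∈ (toEnd ℂ g V h).eigenspace (c + 2) := by
    have := Module.End.mem_eigenspace_iff.1 v.2
    rw [toEnd_apply_apply] at this
    rw [Module.End.mem_eigenspace_iff, toEnd_apply_apply, leibniz_lie, this, T.lie_h_e_smul ℂ,
      smul_lie, lie_smul, ← add_smul, add_comm]
  let ε : (toEnd ℂ g V h).eigenspace c →ₗ[ℂ] LinearMap.ker θ' :=
    { toFun := fun v => ⟨⟨⁅e, v.1⁆, hmem v⟩, (h2 _).2 ⟨v.1, rfl⟩⟩
      map_add' := fun v w => Subtype.ext (Subtype.ext (lie_add e v.1 w.1))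
      map_smul' := fun a v => Subtype.ext (Subtype.ext (lie_smul a e v.1)) }
  have hε : Function.Bijective ε := by
    refine ⟨fun v w hvw => Subtype.ext (he ?_), ?_⟩
    · exact congrArg Subtype.val (congrArg Subtype.val hvw)
    · rintro ⟨⟨v, hv⟩, hv0⟩
      obtain ⟨w, rfl⟩ := (h2 v).1 hv0
      refine ⟨⟨w, Module.End.mem_eigenspace_iff.2 (he ?_)⟩, rfl⟩
      rw [Module.End.mem_eigenspace_iff, toEnd_apply_apply, leibniz_lie, T.lie_h_e_smul ℂ,
        smul_lie] at hv
      change ⁅e, ⁅h, w⁆⁆ = ⁅e, c • w⁆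
      rw [lie_smul, ← sub_eq_zero, ← sub_eq_zero.2 hv]
      module
  refine ⟨?_, h4, ?_⟩
  · rw [← hr]
    infer_instance
  · rw [(LinearEquiv.ofBijective ε hε).finrank_eq, ← hr]
    exact θ'.finrank_range_add_finrank_ker

/-- The dimension of the space of highest weight vectors of weight `m` in the quotient of the
localization of `V` by `V`. -/
theorem IsLocalizationAt.finrank_primitiveSpace (hφ : IsLocalizationAt e φ)
    (T : IsSl2Triple h e f) (he : Function.Injective fun v : V => ⁅e, v⁆)
    (hV : ⨆ c : ℂ, (toEnd ℂ g V h).eigenspace c = ⊤)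
    (hfin : ∀ c, FiniteDimensional ℂ ((toEnd ℂ g V h).eigenspace c)) (m : ℕ)
    (hm : ∀ v : V, ⁅h, v⁆ = (-m : ℂ) • v →
      ∃ w w', ⁅h, w'⁆ = ((m : ℂ) + 2) • w' ∧ v = ⁅e, w⁆ + (toEnd ℂ g V f ^ (m + 1)) w') :
    FiniteDimensional ℂ (primitiveSpace (locQuot φ) h e f m) ∧
      Module.finrank ℂ (primitiveSpace (locQuot φ) h e f m) +
        Module.finrank ℂ ((toEnd ℂ g V h).eigenspace (-m - 2 + 2 : ℂ)) +
        Module.finrank ℂ ((toEnd ℂ g V h).eigenspace (m : ℂ)) =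
      Module.finrank ℂ ((toEnd ℂ g V h).eigenspace (m + 2 : ℂ)) +
        Module.finrank ℂ ((toEnd ℂ g V h).eigenspace (-m - 2 : ℂ)) := by
  obtain ⟨θ, h1, h2, h3, h4⟩ := hφ.exists_divE T
  obtain ⟨fin1, _, rank1⟩ := finrank_singularSpace T he hV θ h1 h2 h3 m (hfin _)
  obtain ⟨fin2, ex2, rank2⟩ := finrank_singularSpace T he hV θ h1 h2 h3 (-m - 2 : ℂ) (hfin _)
  have hmem (q : locQuot φ) (hq : q ∈ singularSpace (locQuot φ) h e (m : ℂ)) :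
      (toEnd ℂ g (locQuot φ) f ^ (m + 1)) q ∈ singularSpace (locQuot φ) h e (-m - 2 : ℂ) := by
    obtain ⟨hqh, hqe⟩ := mem_singularSpace.1 hq
    refine mem_singularSpace.2 ⟨?_, ?_⟩
    · rw [lie_h_pow_f T hqh]
      congr 1
      push_cast
      ring
    · rw [lie_e_pow_f T hqh, hqe, map_zero, sub_self, mul_zero, zero_smul, add_zero]
  let F : singularSpace (locQuot φ) h e (m : ℂ) →ₗ[ℂ] singularSpace (locQuot φ) h e (-m - 2 : ℂ) :=
    (toEnd ℂ g (locQuot φ) f ^ (m + 1)).restrict hmem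
  -- A singular vector of weight −m − 2 is θ(v) with v of weight −m. Writing v = ew + f^{m+1}w', the
  -- first term dies under θ, and the second is f^{m+1} applied to θ(w').
  have hF : Function.Surjective F := by
    rintro ⟨q, hq⟩
    obtain ⟨v, hv, rfl⟩ := ex2 q hq
    obtain ⟨w, w', hw', rfl⟩ := hm v (by rw [hv]; congr 1; ring)
    refine ⟨⟨θ w', mem_singularSpace.2 ⟨?_, (h1 _).2 ⟨w', rfl⟩⟩⟩, Subtype.ext ?_⟩
    · rw [h3, hw', ← sub_smul, add_sub_cancel_right, map_smul]
    · refine (h4 m w' hw').trans ?_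
      change _ = θ (⁅e, w⁆ + _)
      rw [map_add, (h2 _).2 ⟨w, rfl⟩, zero_add]
  let κ : primitiveSpace (locQuot φ) h e f m →ₗ[ℂ] LinearMap.ker F :=
    { toFun := fun q => ⟨⟨q.1, q.2.1⟩, Subtype.ext q.2.2⟩
      map_add' := fun _ _ => rfl
      map_smul' := fun _ _ => rfl }
  have hκ : Function.Bijective κ := by
    refine ⟨fun q r hqr => Subtype.ext ?_, fun q => ⟨⟨q.1.1, q.1.2, ?_⟩, rfl⟩⟩
    · exact congrArg (fun z : LinearMap.ker F => z.1.1) hqr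
    · exact congrArg Subtype.val q.2
  have hκe := LinearEquiv.ofBijective κ hκ
  have h5 := F.finrank_range_add_finrank_ker
  rw [LinearMap.range_eq_top.2 hF, finrank_top, ← hκe.finrank_eq] at h5
  exact ⟨Module.Finite.equiv hκe.symm, by lia⟩

end Dimension

/-! ### The dual of the Verma module and integrality -/

section Dual

variable {g : Type u} [LieRing g] [LieAlgebra ℂ g] {h e f : g}

open LieModule

/-- A `g`-module as a module over `U(g)`. -/
@[reducible]
def envModule (M : Type*) [AddCommGroup M] [Module ℂ M] [LieRingModule g M] [LieModule ℂ g M] :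
    Module (UniversalEnvelopingAlgebra ℂ g) M :=
  Module.compHom M (UniversalEnvelopingAlgebra.lift ℂ (toEnd ℂ g M)).toRingHom

/-- The dual of a `g`-module. -/
def dualModule (V : ModuleCat.{u} (UniversalEnvelopingAlgebra ℂ g)) :
    ModuleCat.{u} (UniversalEnvelopingAlgebra ℂ g) :=
  letI := envModule (g := g) (V →ₗ[ℂ] ℂ)
  ModuleCat.of _ (V →ₗ[ℂ] ℂ)

variable {V : ModuleCat.{u} (UniversalEnvelopingAlgebra ℂ g)}

/-- The evaluation of an element of the dual module. -/
def dualEval (v : V) : dualModule V →+ ℂ where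
  toFun ξ := (show V →ₗ[ℂ] ℂ from ξ) v
  map_zero' := rfl
  map_add' _ _ := rfl

theorem dualEval_ext {ξ η : dualModule V} (hξ : ∀ v, dualEval v ξ = dualEval v η) : ξ = η :=
  LinearMap.ext (f := (show V →ₗ[ℂ] ℂ from ξ)) hξ

theorem dualEval_add (v w : V) (ξ : dualModule V) :
    dualEval (v + w) ξ = dualEval v ξ + dualEval w ξ :=
  map_add (show V →ₗ[ℂ] ℂ from ξ) v w

theorem dualEval_smul_left (c : ℂ) (v : V) (ξ : dualModule V) :
    dualEval (c • v) ξ = c * dualEval v ξ :=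
  map_smul (show V →ₗ[ℂ] ℂ from ξ) c v

theorem dualEval_lie (x : g) (v : V) (ξ : dualModule V) :
    dualEval v ⁅x, ξ⁆ = - dualEval ⁅x, v⁆ ξ := by
  change (UniversalEnvelopingAlgebra.lift ℂ (toEnd ℂ g (V →ₗ[ℂ] ℂ))
    (UniversalEnvelopingAlgebra.ι ℂ x) ξ) v = _
  rw [UniversalEnvelopingAlgebra.lift_ι_apply]
  rfl

theorem dualEval_smul (c : ℂ) (v : V) (ξ : dualModule V) :
    dualEval v (c • ξ) = c * dualEval v ξ := by
  rw [← algebraMap_smul (UniversalEnvelopingAlgebra ℂ g)]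
  change (UniversalEnvelopingAlgebra.lift ℂ (toEnd ℂ g (V →ₗ[ℂ] ℂ))
    (algebraMap ℂ _ c) ξ) v = _
  rw [AlgHom.commutes]
  rfl

theorem exists_dual (ξ : V →ₗ[ℂ] ℂ) : ∃ η : dualModule V, ∀ v, dualEval v η = ξ v :=
  ⟨ξ, fun _ => rfl⟩

/-- Elements of the dual that agree on eigenvectors are equal. -/
theorem dualEval_ext_eigenvectors (hV : ⨆ c : ℂ, (toEnd ℂ g V h).eigenspace c = ⊤)
    {ξ η : dualModule V}
    (hξ : ∀ (c : ℂ) (v : V), ⁅h, v⁆ = c • v → dualEval v ξ = dualEval v η) : ξ = η := by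
  refine dualEval_ext fun v => ?_
  have hv : v ∈ ⨆ c : ℂ, (toEnd ℂ g V h).eigenspace c := hV ▸ Submodule.mem_top
  induction hv using Submodule.iSup_induction' with
  | mem c v hv => exact hξ c v (Module.End.mem_eigenspace_iff.1 hv)
  | zero => exact (map_zero (show V →ₗ[ℂ] ℂ from ξ)).trans (map_zero (show V →ₗ[ℂ] ℂ from η)).symm
  | add v w _ _ hv hw => rw [dualEval_add, dualEval_add, hv, hw]

theorem dualEval_pow (x : g) (n : ℕ) (v : V) (ξ : dualModule V) :
    dualEval v ((toEnd ℂ g (dualModule V) x ^ n) ξ) =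
      (-1) ^ n * dualEval ((toEnd ℂ g V x ^ n) v) ξ := by
  induction n generalizing v with
  | zero => simp
  | succ n ih =>
    rw [pow_succ', Module.End.mul_apply, toEnd_apply_apply, dualEval_lie, ih, pow_succ (toEnd ℂ g V x),
      Module.End.mul_apply, toEnd_apply_apply, pow_succ']
    ring

/-- If the weight space of weight `-m` is not spanned by the images of `e` and `f ^ (m + 1)`, the
dual contains a nonzero vector as in a simple module of highest weight `m`. -/
theorem exists_dual_primitive (T : IsSl2Triple h e f)
    (hV : ⨆ c : ℂ, (toEnd ℂ g V h).eigenspace c = ⊤) (m : ℕ)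
    (hm : ¬ ∀ v : V, ⁅h, v⁆ = (-m : ℂ) • v →
      ∃ w w', ⁅h, w'⁆ = ((m : ℂ) + 2) • w' ∧ v = ⁅e, w⁆ + (toEnd ℂ g V f ^ (m + 1)) w') :
    ∃ ξ ∈ primitiveSpace (dualModule V) h e f m, ξ ≠ 0 := by
  push Not at hm
  obtain ⟨v, hv, hne⟩ := hm
  let V' (c : ℂ) : Submodule ℂ V := (toEnd ℂ g V h).eigenspace c
  -- The functional sought vanishes on X, which makes it killed by e and f^{m+1}, and on Z, the
  -- other weight spaces, which makes it an eigenvector of weight m. It exists and is nonzero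
  -- because v lies outside X + Z.
  let X : Submodule ℂ V := (V' (-m - 2)).map (toEnd ℂ g V e) ⊔
    (V' (m + 2)).map (toEnd ℂ g V f ^ (m + 1))
  let Z : Submodule ℂ V := ⨆ (c : ℂ) (_ : c ≠ (-m : ℂ)), V' c
  have hX : X ≤ V' (-m) := by
    refine sup_le ?_ ?_
    · rintro _ ⟨w, hw, rfl⟩
      replace hw := Module.End.mem_eigenspace_iff.1 hw
      rw [toEnd_apply_apply] at hw
      rw [Module.End.mem_eigenspace_iff, toEnd_apply_apply, toEnd_apply_apply, leibniz_lie, hw,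
        T.lie_h_e_smul ℂ, smul_lie, lie_smul, ← add_smul]
      congr 1
      ring
    · rintro _ ⟨w, hw, rfl⟩
      rw [Module.End.mem_eigenspace_iff, toEnd_apply_apply,
        lie_h_pow_f T (Module.End.mem_eigenspace_iff.1 hw)]
      congr 1
      push_cast
      ring
  have hvX : v ∉ X ⊔ Z := by
    intro hvX
    obtain ⟨x, hx, z, hz, hxz⟩ := Submodule.mem_sup.1 hvX
    have hz0 : z = 0 := by
      refine Submodule.disjoint_def.1 ((toEnd ℂ g V h).eigenspaces_iSupIndep (-m : ℂ)) z ?_ hz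
      have : z = v - x := by rw [← hxz, add_sub_cancel_left]
      rw [this]
      exact Submodule.sub_mem _ (Module.End.mem_eigenspace_iff.2 hv) (hX hx)
    obtain ⟨_, ⟨w, hw, rfl⟩, _, ⟨w', hw', rfl⟩, hww⟩ := Submodule.mem_sup.1 hx
    refine hne w w' (Module.End.mem_eigenspace_iff.1 hw') ?_
    rw [← hxz, hz0, add_zero, ← hww]
    rfl
  obtain ⟨ξ', hξv, hξX⟩ := Submodule.exists_le_ker_of_notMem hvX
  obtain ⟨ξ, hξ⟩ := exists_dual ξ'
  have hZ (c : ℂ) (hc : c ≠ -m) (w : V) (hw : ⁅h, w⁆ = c • w) : dualEval w ξ = 0 := by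
    rw [hξ]
    refine hξX (Submodule.mem_sup_right (Submodule.mem_iSup_of_mem c (Submodule.mem_iSup_of_mem hc
      (Module.End.mem_eigenspace_iff.2 hw))))
  refine ⟨ξ, mem_primitiveSpace.2 ⟨?_, ?_, ?_⟩, ?_⟩
  · refine dualEval_ext_eigenvectors hV fun c w hw => ?_
    rw [dualEval_lie, hw, dualEval_smul, dualEval_smul_left]
    by_cases hc : c = -m
    · rw [hc]
      ring
    · rw [hZ c hc w hw, mul_zero, mul_zero, neg_zero]
  · refine dualEval_ext_eigenvectors hV fun c w hw => ?_
    rw [dualEval_lie, map_zero, neg_eq_zero]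
    by_cases hc : c = -m - 2
    · rw [hξ]
      refine hξX (Submodule.mem_sup_left (Submodule.mem_sup_left ⟨w, ?_, rfl⟩))
      exact Module.End.mem_eigenspace_iff.2 (hc ▸ hw)
    · refine hZ (c + 2) (fun h1 => hc (by linear_combination h1)) _ ?_
      rw [leibniz_lie, hw, T.lie_h_e_smul ℂ, smul_lie, lie_smul, ← add_smul, add_comm]
  · refine dualEval_ext_eigenvectors hV fun c w hw => ?_
    rw [dualEval_pow, map_zero]
    refine mul_eq_zero_of_right _ ?_
    by_cases hc : c = m + 2
    · rw [hξ]
      refine hξX (Submodule.mem_sup_left (Submodule.mem_sup_right ⟨w, ?_, rfl⟩))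
      exact Module.End.mem_eigenspace_iff.2 (hc ▸ hw)
    · refine hZ _ (fun h1 => hc ?_) _ (lie_h_pow_f T hw (m + 1))
      push_cast at h1
      linear_combination h1
  · rintro rfl
    exact hξv ((hξ v).symm.trans (map_zero _))

variable [FiniteDimensional ℂ g]

theorem primitiveSpace_le_finitePart (T : IsSl2Triple h e f) {m : ℕ} {v : V}
    (hv : v ∈ primitiveSpace V h e f m) : v ∈ finitePart (T.toLieSubalgebra ℂ) V := by
  let S := Submodule.span ℂ (Set.range fun j : Fin (m + 1) => (toEnd ℂ g V f ^ (j : ℕ)) v)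
  have : FiniteDimensional ℂ S := FiniteDimensional.span_of_finite ℂ (Set.finite_range _)
  refine Submodule.finiteDimensional_of_le (S₂ := S) (envSpan_le _ _ _ _ ?_ ?_)
  · exact Submodule.subset_span ⟨0, rfl⟩
  · exact fun x hx w hw => lie_mem_span_pow_f T hv hx hw

/-- The weights of `k`-finite vectors are symmetric. -/
theorem exists_neg_eigenvector_finitePart (T : IsSl2Triple h e f) {a : ℂ} {v : V}
    (hv : v ∈ finitePart (T.toLieSubalgebra ℂ) V) (h0 : v ≠ 0) (ha : ⁅h, v⁆ = a • v) :
    ∃ w : V, w ≠ 0 ∧ ⁅h, w⁆ = (-a) • w := by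
  let N := envSpanLie (T.toLieSubalgebra ℂ) V v
  have : FiniteDimensional ℂ N := hv
  obtain ⟨w, hw0, hw⟩ := exists_neg_eigenvector (M := N) (isSl2Triple_toLieSubalgebra T) (a := a)
    (v := ⟨v, mem_envSpan_self _ V v⟩) (fun h1 => h0 (congrArg Subtype.val h1)) (Subtype.ext ha)
  exact ⟨w, fun h1 => hw0 (Subtype.ext h1), congrArg Subtype.val hw⟩

/-- The `k`-finite part of the dual of a module whose weights are bounded below is
finite-dimensional. -/
theorem finiteDimensional_finitePart_dual (T : IsSl2Triple h e f)
    (hV : ⨆ c : ℂ, (toEnd ℂ g V h).eigenspace c = ⊤)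
    (hfin : ∀ c, FiniteDimensional ℂ ((toEnd ℂ g V h).eigenspace c)) (a : ℂ)
    (hwt : ∀ c, (toEnd ℂ g V h).eigenspace c ≠ ⊥ → ∃ n : ℕ, c = a + n) :
    FiniteDimensional ℂ (finitePart (T.toLieSubalgebra ℂ) (dualModule V)) := by
  -- A functional of weight b lives on the weight space of weight −b.
  have hwt' (b : ℂ) (η : dualModule V) (h0 : η ≠ 0) (hη : ⁅h, η⁆ = b • η) :
      ∃ n : ℕ, -b = a + n := by
    by_contra hne
    refine h0 (dualEval_ext_eigenvectors hV fun c v hv => ?_)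
    rw [map_zero]
    by_contra h1
    have h2 := dualEval_lie h v η
    rw [hη, hv, dualEval_smul, dualEval_smul_left] at h2
    have h3 : -b = c := mul_right_cancel₀ h1 (by linear_combination -h2)
    refine hne (h3 ▸ hwt c fun h4 => h1 ?_)
    have h5 : v ∈ (toEnd ℂ g V h).eigenspace c := Module.End.mem_eigenspace_iff.2 hv
    rw [h4, Submodule.mem_bot] at h5
    rw [h5]
    exact map_zero (show V →ₗ[ℂ] ℂ from η)
  obtain ⟨s, hs⟩ : ∃ s : ℕ, ∀ (b : ℂ) (η : dualModule V),
      η ∈ finitePart (T.toLieSubalgebra ℂ) (dualModule V) → η ≠ 0 → ⁅h, η⁆ = b • η →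
      ∃ n : ℕ, n < s ∧ -b = a + n := by
    -- If a k-finite functional has weight b, then −b is a weight of the dual too, so −b = a + n and
    -- b = a + n'. Adding gives n + n' = −2a, which bounds n. If −2a is not a natural number, there
    -- are no such weights and s = 0 works.
    by_cases hs : ∃ s : ℕ, -(2 * a) = s
    · obtain ⟨s, hs⟩ := hs
      refine ⟨s + 1, fun b η hη h0 hb => ?_⟩
      obtain ⟨n, hn⟩ := hwt' b η h0 hb
      obtain ⟨η', h0', hb'⟩ := exists_neg_eigenvector_finitePart T hη h0 hb
      obtain ⟨n', hn'⟩ := hwt' (-b) η' h0' hb'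
      refine ⟨n, ?_, hn⟩
      have : ((n + n' : ℕ) : ℂ) = s := by
        push_cast
        linear_combination hs - hn - hn'
      have := Nat.cast_injective this
      lia
    · refine ⟨0, fun b η hη h0 hb => ?_⟩
      obtain ⟨n, hn⟩ := hwt' b η h0 hb
      obtain ⟨η', h0', hb'⟩ := exists_neg_eigenvector_finitePart T hη h0 hb
      obtain ⟨n', hn'⟩ := hwt' (-b) η' h0' hb'
      refine absurd ⟨n + n', ?_⟩ hs
      push_cast
      linear_combination hn + hn'
  let X : Submodule ℂ V := ⨆ i : Fin s, (toEnd ℂ g V h).eigenspace (a + (i : ℕ))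
  have hXfin : FiniteDimensional ℂ X := by
    have (i : Fin s) := hfin (a + (i : ℕ))
    infer_instance
  have hvan (η : dualModule V) (hη : η ∈ finitePart (T.toLieSubalgebra ℂ) (dualModule V)) (c : ℂ)
      (v : V) (hv : ⁅h, v⁆ = c • v) (hc : ∀ i : Fin s, c ≠ a + (i : ℕ)) : dualEval v η = 0 := by
    have h1 := finitePart_le_eigenspaces T (dualModule V) hη
    clear hη
    induction h1 using Submodule.iSup_induction' with
    | mem b η hη =>
      by_contra h1
      have hb := Module.End.mem_eigenspace_iff.1 hη.2
      rw [toEnd_apply_apply] at hb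
      have h2 := dualEval_lie h v η
      rw [hb, hv, dualEval_smul, dualEval_smul_left] at h2
      have h3 : -b = c := mul_right_cancel₀ h1 (by linear_combination -h2)
      obtain ⟨n, hn, hbn⟩ := hs b η hη.1 (fun h4 => h1 (by rw [h4, map_zero])) hb
      exact hc ⟨n, hn⟩ (h3.symm.trans hbn)
    | zero => exact map_zero _
    | add η η' _ _ h1 h2 => rw [map_add, h1, h2, add_zero]
  -- A k-finite functional is determined by its restriction to the finitely many weight spaces in X,
  -- which are finite-dimensional.
  let res : finitePart (T.toLieSubalgebra ℂ) (dualModule V) →ₗ[ℂ] Module.Dual ℂ X :=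
    { toFun := fun η => (show V →ₗ[ℂ] ℂ from η.1) ∘ₗ X.subtype
      map_add' := fun _ _ => rfl
      map_smul' := fun c η => LinearMap.ext fun x => dualEval_smul c x.1 η.1 }
  refine Module.Finite.of_injective res ?_
  rw [← LinearMap.ker_eq_bot, LinearMap.ker_eq_bot']
  intro η hη
  refine Subtype.ext (dualEval_ext_eigenvectors hV fun c v hv => ?_)
  refine Eq.trans ?_ (map_zero (dualEval v)).symm
  by_cases hc : ∃ i : Fin s, c = a + (i : ℕ)
  · obtain ⟨i, rfl⟩ := hc
    have hvX : v ∈ X := Submodule.mem_iSup_of_mem i (Module.End.mem_eigenspace_iff.2 hv)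
    exact DFunLike.congr_fun hη ⟨v, hvX⟩
  · push Not at hc
    exact hvan η.1 η.2 c v hv hc

/-- If the dual of a Verma module contains nonzero `k`-finite vectors, its weight is integral. -/
theorem isIntegral_of_finitePart_dual (T : IsSl2Triple h e f) {lam : Module.Dual ℂ (cartan h)}
    (F : FiniteDimensional ℂ (finitePart (T.toLieSubalgebra ℂ) (dualModule (verma lam))))
    {ξ : dualModule (verma lam)} (hξ : ξ ∈ finitePart (T.toLieSubalgebra ℂ) (dualModule (verma lam)))
    (hξ0 : ξ ≠ 0) : IsIntegral lam := by
  intro H E₁ F₁ _ T₁ _ _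
  set N := finitePart (T.toLieSubalgebra ℂ) (dualModule (verma lam)) with hN
  -- If all k-finite functionals vanished on the generator, they would vanish on the whole module,
  -- because N is stable under g.
  obtain ⟨η, hη⟩ : ∃ η : N, dualEval (vermaVector lam) η.1 ≠ 0 := by
    by_contra! h0
    have h1 (a : UniversalEnvelopingAlgebra ℂ g) : ∀ v : verma lam,
        (∀ η : N, dualEval v η.1 = 0) → ∀ η : N, dualEval (a • v) η.1 = 0 := by
      induction a using env_induction with
      | h1 c =>
        intro v hv η
        rw [algebraMap_smul, dualEval_smul_left, hv, mul_zero]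
      | h2 x =>
        intro v hv η
        have h2 := dualEval_lie x v η.1
        have h3 : dualEval v ⁅x, η.1⁆ = 0 := hv ⟨_, N.smul_mem _ η.2⟩
        rw [h3, lie_eq_ι_smul] at h2
        exact neg_eq_zero.1 h2.symm
      | h3 a b ha hb =>
        intro v hv η
        rw [mul_smul]
        exact ha _ (hb v hv) η
      | h4 a b ha hb =>
        intro v hv η
        rw [add_smul, dualEval_add, ha v hv, hb v hv, add_zero]
    refine hξ0 (dualEval_ext fun v => ?_)
    obtain ⟨a, rfl⟩ := exists_smul_vermaVector lam v
    rw [map_zero]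
    exact h1 a _ h0 ⟨ξ, hξ⟩
  let : LieRingModule g N := lieRingModuleOfEnv (ModuleCat.of _ N)
  let : LieModule ℂ g N := lieModuleOfEnv (ModuleCat.of _ N)
  obtain ⟨a, ζ, hζ, hζv⟩ : ∃ (a : ℂ) (ζ : N), ⁅(H : g), ζ⁆ = a • ζ ∧
      dualEval (vermaVector lam) ζ.1 ≠ 0 := by
    by_contra! h0
    have h1 : (η : N) ∈ ⨆ a : ℂ, (toEnd ℂ g N (H : g)).eigenspace a :=
      (iSup_eigenspace_eq_top (M := N) T₁).symm ▸ Submodule.mem_top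
    refine hη (Submodule.iSup_induction _
      (motive := fun ζ : N => dualEval (vermaVector lam) ζ.1 = 0) h1 ?_ ?_ ?_)
    · exact fun a ζ hζ => h0 a ζ (Module.End.mem_eigenspace_iff.1 hζ)
    · exact map_zero _
    · intro x y hx hy
      exact (map_add (dualEval (vermaVector lam)) x.1 y.1).trans (by rw [hx, hy, add_zero])
  have hζ0 : ζ ≠ 0 := by
    rintro rfl
    exact hζv (map_zero _)
  obtain ⟨z, rfl⟩ := exists_int_of_eigenvector T₁ hζ0 hζ
  -- Evaluating Hζ at the generator gives z·ζ(v) = −λ(H)·ζ(v), and ζ(v) ≠ 0.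
  refine ⟨-z, ?_⟩
  have h1 := dualEval_lie (H : g) (vermaVector lam) ζ.1
  have h2 : ⁅(H : g), ζ.1⁆ = (z : ℂ) • ζ.1 := congrArg Subtype.val hζ
  rw [h2, dualEval_smul, lie_eq_ι_smul, ι_cartan_smul_vermaVector, dualEval_smul_left] at h1
  push_cast
  exact mul_right_cancel₀ hζv (by linear_combination h1)

end Dual

/-! ### The multiplicity formula and its two cases -/

section Main

variable {g : Type u} [LieRing g] [LieAlgebra ℂ g] {h e f : g}

theorem evalH_restrictWeight (lam : Module.Dual ℂ (cartan h)) :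
    restrictWeight lam ⟨h, mem_torus h⟩ = evalH lam := rfl

theorem rho_apply (T : IsSl2Triple h e f) : rho T ⟨h, mem_torus h⟩ = 1 := by
  have h1 := lie_eq_rootOf T ⟨h, mem_torus h⟩
  have h2 : rootOf T ⟨h, mem_torus h⟩ = 2 := by
    change ⁅h, e⁆ = _ at h1
    rw [T.lie_h_e_smul ℂ] at h1
    exact (smul_left_injective ℂ T.e_ne_zero h1).symm
  rw [rho, LinearMap.smul_apply, h2, smul_eq_mul]
  norm_num

theorem smul_rho_apply (T : IsSl2Triple h e f) (c : ℂ) : (c • rho T) ⟨h, mem_torus h⟩ = c := by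
  rw [LinearMap.smul_apply, rho_apply, smul_eq_mul, mul_one]

variable [FiniteDimensional ℂ g] [LieAlgebra.IsSimple ℂ g]

open LieModule

/-- The multiplicities of `k`-types in `A¹(λ)`, under a condition on the weight spaces of the Verma
module. -/
theorem finrank_homK (T : IsSl2Triple h e f)
    (hab : ∀ x ∈ cartan h, ∀ y ∈ cartan h, ⁅x, y⁆ = 0) (lam : Module.Dual ℂ (cartan h))
    {μ : Module.Dual ℂ (torus h)} {m : ℕ} (hμ : μ ⟨h, mem_torus h⟩ = m)
    (hm : ∀ v : verma lam, ⁅h, v⁆ = (-m : ℂ) • v →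
      ∃ w w', ⁅h, w'⁆ = ((m : ℂ) + 2) • w' ∧ v = ⁅e, w⁆ + (toEnd ℂ g (verma lam) f ^ (m + 1)) w')
    {W : Type v} [AddCommGroup W] [Module ℂ W] [LieRingModule (T.toLieSubalgebra ℂ) W]
    [LieModule ℂ (T.toLieSubalgebra ℂ) W] (hW : IsTypeOfHighestWeight T μ W) :
    FiniteDimensional ℂ (homK (T.toLieSubalgebra ℂ) W (A T 1 lam)) ∧
      ∀ ν ν' : Module.Dual ℂ (torus h), ν ⟨h, mem_torus h⟩ = m + 2 - evalH lam →
        ν' ⟨h, mem_torus h⟩ = -m - evalH lam →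
        Module.finrank ℂ (homK (T.toLieSubalgebra ℂ) W (A T 1 lam)) + partitionFunction T ν' =
          partitionFunction T ν := by
  have facts := vermaFacts T hab lam
  obtain ⟨Y, φ, hφ⟩ := exists_localizationAt (isNilpotent_toEnd_e (M := g) T) (verma lam)
    facts.injective
  have hV : eigSpan h (verma lam) = ⊤ := by
    rw [eq_top_iff, ← facts.iSup_eigenspace]
    exact iSup_le fun c v hv => Submodule.subset_span ⟨c, Module.End.mem_eigenspace_iff.1 hv⟩
  obtain ⟨Φ⟩ := exists_derivedGam_equiv T ⟨verma lam, relProp_verma T lam⟩ hV hφ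
  have := hW.finite
  obtain ⟨ε⟩ := exists_homK_finitePart_equiv (T.toLieSubalgebra ℂ) W Φ
  obtain ⟨ε'⟩ := exists_homK_equiv T hμ hW (locQuot φ)
  obtain ⟨h1, h2⟩ := hφ.finrank_primitiveSpace T facts.injective facts.iSup_eigenspace
    facts.finite m hm
  have ε'' : homK (T.toLieSubalgebra ℂ) W (A T 1 lam) ≃ₗ[ℂ] primitiveSpace (locQuot φ) h e f m :=
    ε.trans ε'
  refine ⟨Module.Finite.equiv ε''.symm, fun ν ν' hν hν' => ?_⟩
  rw [ε''.finrank_eq]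
  -- The recursion for weight spaces at c = m and c = −m − 2 turns the four dimensions into the two
  -- values of P.
  have h3 := facts.finrank (m : ℂ) ν hν
  have h4 := facts.finrank (-m - 2 : ℂ) ν' (by rw [hν']; ring)
  lia

/-- The condition of `finrank_homK` when the weight is not integral. -/
theorem exists_eq_add_of_not_isIntegral (T : IsSl2Triple h e f)
    (hab : ∀ x ∈ cartan h, ∀ y ∈ cartan h, ⁅x, y⁆ = 0) {lam : Module.Dual ℂ (cartan h)}
    (hlam : ¬ IsIntegral lam) (m : ℕ) (v : verma lam) (hv : ⁅h, v⁆ = (-m : ℂ) • v) :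
    ∃ w w', ⁅h, w'⁆ = ((m : ℂ) + 2) • w' ∧
      v = ⁅e, w⁆ + (toEnd ℂ g (verma lam) f ^ (m + 1)) w' := by
  have facts := vermaFacts T hab lam
  revert v
  by_contra hne
  obtain ⟨ξ, hξ, hξ0⟩ := exists_dual_primitive T facts.iSup_eigenspace m hne
  exact hlam (isIntegral_of_finitePart_dual T (finiteDimensional_finitePart_dual T
    facts.iSup_eigenspace facts.finite (evalH lam) facts.weight)
    (primitiveSpace_le_finitePart T hξ) hξ0)

/-- The multiplicities of `k`-types in `A¹(λ)` when `λ(h) - 2` is a natural number. -/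
theorem finrank_homK_of_evalH (T : IsSl2Triple h e f)
    (hab : ∀ x ∈ cartan h, ∀ y ∈ cartan h, ⁅x, y⁆ = 0) {lam : Module.Dual ℂ (cartan h)} {n : ℕ}
    (hn : evalH lam - 2 = n) (m : ℕ) {W : Type v} [AddCommGroup W] [Module ℂ W]
    [LieRingModule (T.toLieSubalgebra ℂ) W] [LieModule ℂ (T.toLieSubalgebra ℂ) W]
    (hW : IsTypeOfHighestWeight T ((m : ℂ) • rho T) W) :
    FiniteDimensional ℂ (homK (T.toLieSubalgebra ℂ) W (A T 1 lam)) ∧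
      Module.finrank ℂ (homK (T.toLieSubalgebra ℂ) W (A T 1 lam)) =
        partitionFunction T (((m : ℂ) - n) • rho T) := by
  have hev : evalH lam = n + 2 := by linear_combination hn
  obtain ⟨h1, h2⟩ := finrank_homK T hab lam (smul_rho_apply T m) (fun v hv => by
    -- All weights of the Verma module are at least n + 2, so there is no nonzero vector of weight
    -- −m and the condition is vacuous.
    refine ⟨0, 0, by simp, ?_⟩
    rw [lie_zero, map_zero, add_zero]
    by_contra hv0
    obtain ⟨j, hj⟩ := (vermaFacts T hab lam).weight (-m : ℂ) fun hbot => hv0 (by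
      have h1 : v ∈ (toEnd ℂ g (verma lam) h).eigenspace (-m : ℂ) :=
        Module.End.mem_eigenspace_iff.2 hv
      rwa [hbot, Submodule.mem_bot] at h1)
    rw [hev] at hj
    have h2 : ((m + n + 2 + j : ℕ) : ℂ) = 0 := by
      push_cast
      linear_combination -hj
    have := Nat.cast_eq_zero.1 h2
    lia) hW
  refine ⟨h1, ?_⟩
  -- With λ(h) = n + 2 the two arguments of P are m − n and −m − n − 2. The second is negative, so
  -- its term is zero.
  rw [← h2 (((m : ℂ) - n) • rho T) ((-m - n - 2 : ℂ) • rho T)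
    (by rw [smul_rho_apply, hev]; ring) (by rw [smul_rho_apply, hev]; ring),
    partitionFunction_eq_zero T hab (z := -m - n - 2) (by lia) (by
      rw [smul_rho_apply]
      push_cast
      rfl), add_zero]

theorem homK_eq_bot_of_evalH (T : IsSl2Triple h e f)
    (hab : ∀ x ∈ cartan h, ∀ y ∈ cartan h, ⁅x, y⁆ = 0) {lam : Module.Dual ℂ (cartan h)} {m n : ℕ}
    (hn : evalH lam - 2 = n) (hmn : m < n) {W : Type v} [AddCommGroup W] [Module ℂ W]
    [LieRingModule (T.toLieSubalgebra ℂ) W] [LieModule ℂ (T.toLieSubalgebra ℂ) W]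
    (hW : IsTypeOfHighestWeight T ((m : ℂ) • rho T) W) :
    homK (T.toLieSubalgebra ℂ) W (A T 1 lam) = ⊥ := by
  obtain ⟨h1, h2⟩ := finrank_homK_of_evalH T hab hn m hW
  rw [partitionFunction_eq_zero T hab (z := (m : ℤ) - n) (by lia) (by
    rw [smul_rho_apply]
    push_cast
    rfl)] at h2
  exact Submodule.finrank_eq_zero.1 h2

end Main

end

end PrincipalSl2

theorem proposition6 {g : Type u} [LieRing g] [LieAlgebra ℂ g] [FiniteDimensional ℂ g]
    [LieAlgebra.IsSimple ℂ g] {h e f : g} (T : IsSl2Triple h e f)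
    (hT : PrincipalSl2.ContainsRegularNilpotent (T.toLieSubalgebra ℂ))
    (lam : Module.Dual ℂ (PrincipalSl2.cartan h)) :
    (¬ PrincipalSl2.IsIntegral lam →
      ∀ μ : Module.Dual ℂ (PrincipalSl2.torus h), PrincipalSl2.IsDominantIntegral μ →
      ∀ (W : Type v) [AddCommGroup W] [Module ℂ W] [LieRingModule (T.toLieSubalgebra ℂ) W]
        [LieModule ℂ (T.toLieSubalgebra ℂ) W], PrincipalSl2.IsTypeOfHighestWeight T μ W →
      FiniteDimensional ℂ
          (PrincipalSl2.homK (T.toLieSubalgebra ℂ) W (PrincipalSl2.A T 1 lam)) ∧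
        (Module.finrank ℂ
            (PrincipalSl2.homK (T.toLieSubalgebra ℂ) W (PrincipalSl2.A T 1 lam)) : ℤ) =
          PrincipalSl2.partitionFunction T
              (μ - PrincipalSl2.restrictWeight lam + (2 : ℂ) • PrincipalSl2.rho T) -
            PrincipalSl2.partitionFunction T (-μ - PrincipalSl2.restrictWeight lam)) ∧
    (∀ n : ℕ,
      lam ⟨h, PrincipalSl2.torus_le_cartan h (PrincipalSl2.mem_torus h)⟩ - 2 = (n : ℂ) →
      (∀ (W : Type v) [AddCommGroup W] [Module ℂ W] [LieRingModule (T.toLieSubalgebra ℂ) W]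
        [LieModule ℂ (T.toLieSubalgebra ℂ) W],
        PrincipalSl2.IsTypeOfHighestWeight T ((n : ℂ) • PrincipalSl2.rho T) W →
        Module.finrank ℂ
          (PrincipalSl2.homK (T.toLieSubalgebra ℂ) W (PrincipalSl2.A T 1 lam)) = 1) ∧
      ∀ (m : ℕ) (W : Type v) [AddCommGroup W] [Module ℂ W]
        [LieRingModule (T.toLieSubalgebra ℂ) W] [LieModule ℂ (T.toLieSubalgebra ℂ) W],
        PrincipalSl2.IsTypeOfHighestWeight T ((m : ℂ) • PrincipalSl2.rho T) W →
        PrincipalSl2.homK (T.toLieSubalgebra ℂ) W (PrincipalSl2.A T 1 lam) ≠ ⊥ → n ≤ m) := by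
  have hab : ∀ x ∈ PrincipalSl2.cartan h, ∀ y ∈ PrincipalSl2.cartan h, ⁅x, y⁆ = 0 :=
    fun x hx y hy => PrincipalSl2.lie_eq_zero_of_mem_cartan T hT hx hy
  refine ⟨fun hlam μ ⟨m, hμ⟩ W _ _ _ _ hW => ?_, fun n hn => ⟨fun W _ _ _ _ hW => ?_,
    fun m W _ _ _ _ hW hne => ?_⟩⟩
  · obtain ⟨h1, h2⟩ := PrincipalSl2.finrank_homK T hab lam hμ
      (PrincipalSl2.exists_eq_add_of_not_isIntegral T hab hlam m) hW
    refine ⟨h1, ?_⟩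
    have h3 := h2 (μ - PrincipalSl2.restrictWeight lam + (2 : ℂ) • PrincipalSl2.rho T)
      (-μ - PrincipalSl2.restrictWeight lam)
      (by
        rw [LinearMap.add_apply, LinearMap.sub_apply, hμ, PrincipalSl2.evalH_restrictWeight,
          PrincipalSl2.smul_rho_apply]
        ring)
      (by rw [LinearMap.sub_apply, LinearMap.neg_apply, hμ, PrincipalSl2.evalH_restrictWeight])
    lia
  · rw [(PrincipalSl2.finrank_homK_of_evalH T hab hn n hW).2]
    refine PrincipalSl2.partitionFunction_eq_one T hab ?_
    rw [PrincipalSl2.smul_rho_apply, sub_self]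
  · by_contra hmn
    exact hne (PrincipalSl2.homK_eq_bot_of_evalH T hab hn (not_le.1 hmn) hW)
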